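/- Let $d\ge 1$ and let $(S(n))_{n\ge 0}$ be the symmetric nearest-neighbour random walk on $\mathbb Z^d$ started at $0$, with expectation $E$. For $y\in\mathbb Z^d$ let $H(y)=\inf\{n\ge 0: S(n)=y\}$, and for a potential $v:\mathbb Z^d\to[0,\infty)$ put $$e(0,y,v)=E\Big[\exp\Big(-\sum_{n=0}^{H(y)-1}v(S(n))\Big)\mathbf 1_{H(y)<\infty}\Big].$$ For every $\gamma>0$ let $V_\gamma=(V_\gamma(x))_{x\in\mathbb Z^d}$ be a family of i.i.d. non-negative real random variables with $0<\mathbb E[V_\gamma(0)]<\infty$. Suppose that, as $\gamma\searrow 0$, $V_\gamma(0)/\gamma$ converges in distribution to a real random variable $V$ and $\mathbb E[V_\gamma(0)]/\gamma$ converges to $\mathbb E[V]\in[0,\infty]$. Then for every $\gamma>0$ there are a unique norm $\alpha_{V_\gamma}$ on $\mathbb R^d$ (the quenched Lyapunov exponent) such that, almost surely, for all $\ell\in\mathbb Z^d$, $$\alpha_{V_\gamma}(\ell)=\lim_{k\to\infty}\frac{-\ln e(0,k\ell,V_\gamma)}{k},$$ and a unique norm $\beta_{V_\gamma}$ on $\mathbb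 R^d$ (the annealed Lyapunov exponent) such that for all $\ell\in\mathbb Z^d$, $$\beta_{V_\gamma}(\ell)=\lim_{k\to\infty}\frac{-\ln\mathbb E[e(0,k\ell,V_\gamma)]}{k}.$$ Moreover, for every $\ell\in\mathbb R^d$, $$\lim_{\gamma\searrow 0}\frac{\alpha_{V_\gamma}(\ell)}{\sqrt\gamma}=\lim_{\gamma\searrow 0}\frac{\beta_{V_\gamma}(\ell)}{\sqrt\gamma}=\sqrt{2d\,\mathbb E[V]}\;\|\ell\|_2$$ in $[0,\infty]$, where $\|\cdot\|_2$ is the Euclidean norm and $\infty\cdot 0=0$. -/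

import Mathlib

open MeasureTheory ProbabilityTheory Filter Topology

noncomputable section

namespace RandomPotential

/-- The nearest-neighbour step in coordinate direction `s.1`, of sign `+` if `s.2` is true and of
sign `-` otherwise. These are the `2 d` unit vectors of `ℤ^d`. -/
def stepVec {d : ℕ} (s : Fin d × Bool) : Fin d → ℤ :=
  Pi.single s.1 (if s.2 then 1 else -1)

/-- The law of the sequence of steps of the symmetric nearest-neighbour random walk: independent
steps, each uniform on the `2 d` possible ones (a probability measure for `d ≥ 1`). -/
def walkMeasure (d : ℕ) : Measure (ℕ → Fin d × Bool) :=
  Measure.infinitePi (fun _ => uniformOn (Set.univ : Set (Fin d × Bool)))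

/-- The position `S(n)` of the walk, started at `0`, after `n` steps. -/
def walk {d : ℕ} (n : ℕ) (ω : ℕ → Fin d × Bool) : Fin d → ℤ :=
  ∑ i ∈ Finset.range n, stepVec (ω i)

/-- The first passage time `H(y)`; it is only used on the event that `y` is visited. -/
def hittingTime {d : ℕ} (y : Fin d → ℤ) (ω : ℕ → Fin d × Bool) : ℕ :=
  sInf {n : ℕ | walk n ω = y}

open Classical in
/-- `e(0, y, v) = E[exp(-∑_{n < H(y)} v(S(n))) ; H(y) < ∞]`, the probability that the walk reaches
`y` before being killed by the potential `v`. -/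
def passage {d : ℕ} (y : Fin d → ℤ) (v : (Fin d → ℤ) → ℝ) : ℝ :=
  ∫ ω, (if ∃ n, walk n ω = y then
      Real.exp (-∑ n ∈ Finset.range (hittingTime y ω), v (walk n ω)) else 0) ∂(walkMeasure d)

/-- The point of `ℝ^d` given by a lattice point. -/
def latticePoint {d : ℕ} (ℓ : Fin d → ℤ) : EuclideanSpace ℝ (Fin d) :=
  WithLp.toLp 2 (fun i => (ℓ i : ℝ))

/-- `V = (V(x))_{x ∈ ℤ^d}` is an i.i.d. family of non-negative random variables. -/
structure IsIIDPotential {d : ℕ} {Ω : Type*} [MeasurableSpace Ω] (μ : Measure Ω)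
    (V : (Fin d → ℤ) → Ω → ℝ) : Prop where
  measurable : ∀ x, Measurable (V x)
  nonneg : ∀ x ω, 0 ≤ V x ω
  indep : iIndepFun V μ
  identDistrib : ∀ x, IdentDistrib (V x) (V 0) μ μ

/-- `α` is the quenched Lyapunov exponent of `V`: the (non-random) norm on `ℝ^d` such that almost
surely `α(ℓ) = lim_k -ln e(0, kℓ, V) / k` for all `ℓ ∈ ℤ^d`. -/
structure IsQuenchedExponent {d : ℕ} {Ω : Type*} [MeasurableSpace Ω] (μ : Measure Ω)
    (V : (Fin d → ℤ) → Ω → ℝ) (α : Seminorm ℝ (EuclideanSpace ℝ (Fin d))) : Prop where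
  definite : ∀ x, α x = 0 → x = 0
  tendsto : ∀ᵐ ω ∂μ, ∀ ℓ : Fin d → ℤ,
    Tendsto (fun k : ℕ => -Real.log (passage (k • ℓ) (fun x => V x ω)) / (k : ℝ)) atTop
      (𝓝 (α (latticePoint ℓ)))

/-- `β` is the annealed Lyapunov exponent of `V`: the norm on `ℝ^d` such that
`β(ℓ) = lim_k -ln 𝔼[e(0, kℓ, V)] / k` for all `ℓ ∈ ℤ^d`. -/
structure IsAnnealedExponent {d : ℕ} {Ω : Type*} [MeasurableSpace Ω] (μ : Measure Ω)
    (V : (Fin d → ℤ) → Ω → ℝ) (β : Seminorm ℝ (EuclideanSpace ℝ (Fin d))) : Prop where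
  definite : ∀ x, β x = 0 → x = 0
  tendsto : ∀ ℓ : Fin d → ℤ,
    Tendsto (fun k : ℕ => -Real.log (∫ ω, passage (k • ℓ) (fun x => V x ω) ∂μ) / (k : ℝ)) atTop
      (𝓝 (β (latticePoint ℓ)))

/-- The filter `γ ↘ 0` on the positive reals. -/
def toZero : Filter (Set.Ioi (0 : ℝ)) :=
  comap Subtype.val (𝓝[>] (0 : ℝ))

end RandomPotential

end

open MeasureTheory ProbabilityTheory Filter Topology

noncomputable section

namespace RandomPotential

open scoped NNReal ENNReal

set_option linter.unusedSectionVars false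

/-- The lattice `ℤ^d`. -/
abbrev Site (d : ℕ) := Fin d → ℤ

/-! ### The killed walk as a recursion -/

/-- The average of `f` over the nearest neighbours of `x`. -/
def avg {d : ℕ} (f : Site d → ℝ) (x : Site d) : ℝ :=
  (2 * d : ℝ)⁻¹ * ∑ s : Fin d × Bool, f (x + stepVec s)

section avg

variable {d : ℕ}

lemma avg_mono_at {f g : Site d → ℝ} {x : Site d}
    (h : ∀ s, f (x + stepVec s) ≤ g (x + stepVec s)) : avg f x ≤ avg g x :=
  mul_le_mul_of_nonneg_left (Finset.sum_le_sum fun s _ => h s) (by positivity)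

lemma avg_mono {f g : Site d → ℝ} (h : ∀ x, f x ≤ g x) (x : Site d) : avg f x ≤ avg g x :=
  avg_mono_at fun _ => h _

lemma avg_nonneg {f : Site d → ℝ} (h : ∀ x, 0 ≤ f x) (x : Site d) : 0 ≤ avg f x :=
  mul_nonneg (by positivity) (Finset.sum_nonneg fun s _ => h _)

lemma avg_const [NeZero d] (c : ℝ) (x : Site d) : avg (fun _ => c) x = c := by
  have : (d : ℝ) ≠ 0 := Nat.cast_ne_zero.2 (NeZero.ne d)
  simp [avg]
  field_simp

lemma avg_add (f g : Site d → ℝ) (x : Site d) :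
    avg (fun z => f z + g z) x = avg f x + avg g x := by
  simp [avg, Finset.sum_add_distrib, mul_add]

lemma avg_mul_left (c : ℝ) (f : Site d → ℝ) (x : Site d) :
    avg (fun z => c * f z) x = c * avg f x := by
  simp only [avg, ← Finset.mul_sum]; ring

lemma avg_mul_right (c : ℝ) (f : Site d → ℝ) (x : Site d) :
    avg (fun z => f z * c) x = avg f x * c := by
  simp only [avg, ← Finset.sum_mul]; ring

lemma tendsto_avg {ι : Type*} {l : Filter ι} {F : ι → Site d → ℝ} {f : Site d → ℝ}
    (h : ∀ x, Tendsto (fun n => F n x) l (𝓝 (f x))) (x : Site d) :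
    Tendsto (fun n => avg (F n) x) l (𝓝 (avg f x)) :=
  tendsto_const_nhds.mul (tendsto_finsetSum _ fun _ _ => h _)

/-- Averages over the `2 d` neighbours split into the two signs. -/
lemma avg_eq_sum (f : Site d → ℝ) (x : Site d) :
    avg f x = (2 * d : ℝ)⁻¹ * ∑ i : Fin d, (f (x + Pi.single i 1) + f (x + Pi.single i (-1))) := by
  simp [avg, Fintype.sum_prod_type, stepVec]

end avg

open Classical in
/-- `kill D w f n x` is the expectation of `f` at the walk from `x` stopped after `n` steps or on
reaching `D`, weighted by the product of `w` over the sites it steps from. -/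
def kill {d : ℕ} (D : Set (Site d)) (w f : Site d → ℝ) : ℕ → Site d → ℝ
  | 0, x => f x
  | n + 1, x => if x ∈ D then f x else w x * avg (kill D w f n) x

section kill

variable {d : ℕ} {D : Set (Site d)} {w w' f g : Site d → ℝ}

lemma kill_zero (x : Site d) : kill D w f 0 x = f x := rfl

lemma kill_of_mem {x : Site d} (hx : x ∈ D) (n : ℕ) : kill D w f n x = f x := by
  cases n <;> simp [kill, hx]

lemma kill_succ_of_notMem {x : Site d} (hx : x ∉ D) (n : ℕ) :
    kill D w f (n + 1) x = w x * avg (kill D w f n) x := by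
  simp [kill, hx]

lemma kill_nonneg (hw : ∀ x, 0 ≤ w x) (hf : ∀ x, 0 ≤ f x) (n : ℕ) (x : Site d) :
    0 ≤ kill D w f n x := by
  induction n generalizing x with
  | zero => exact hf x
  | succ n ih =>
    by_cases hx : x ∈ D
    · rw [kill_of_mem hx]; exact hf x
    · rw [kill_succ_of_notMem hx]; exact mul_nonneg (hw x) (avg_nonneg ih x)

/-- Comparison with a time-dependent supersolution. -/
lemma kill_le_of_super {U : ℕ → Site d → ℝ} (hw : ∀ x, 0 ≤ w x) (h0 : ∀ x, f x ≤ U 0 x)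
    (hD : ∀ n, ∀ x ∈ D, f x ≤ U n x)
    (hU : ∀ n, ∀ x ∉ D, w x * avg (U n) x ≤ U (n + 1) x) (n : ℕ) (x : Site d) :
    kill D w f n x ≤ U n x := by
  induction n generalizing x with
  | zero => exact h0 x
  | succ n ih =>
    by_cases hx : x ∈ D
    · rw [kill_of_mem hx]; exact hD _ x hx
    · rw [kill_succ_of_notMem hx]
      exact (mul_le_mul_of_nonneg_left (avg_mono ih x) (hw x)).trans (hU n x hx)

lemma kill_mono (hw : ∀ x, 0 ≤ w x) (hw' : ∀ x, 0 ≤ w' x) (hww : ∀ x ∉ D, w x ≤ w' x)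
    (hg : ∀ x, 0 ≤ g x) (hf : ∀ x, f x ≤ g x) (n : ℕ) (x : Site d) :
    kill D w f n x ≤ kill D w' g n x :=
  kill_le_of_super hw hf (fun n x hx => by rw [kill_of_mem hx]; exact hf x)
    (fun n x hx => by
      rw [kill_succ_of_notMem hx]
      exact mul_le_mul_of_nonneg_right (hww x hx) (avg_nonneg (kill_nonneg hw' hg n) x)) n x

lemma kill_congr (hw : ∀ x ∉ D, w x = w' x) (n : ℕ) (x : Site d) :
    kill D w f n x = kill D w' f n x := by
  induction n generalizing x with
  | zero => rfl
  | succ n ih =>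
    by_cases hx : x ∈ D
    · rw [kill_of_mem hx, kill_of_mem hx]
    · rw [kill_succ_of_notMem hx, kill_succ_of_notMem hx, hw x hx]
      congr 2
      exact funext ih

lemma kill_add (n : ℕ) (x : Site d) :
    kill D w (fun z => f z + g z) n x = kill D w f n x + kill D w g n x := by
  induction n generalizing x with
  | zero => rfl
  | succ n ih =>
    by_cases hx : x ∈ D
    · simp only [kill_of_mem hx]
    · simp only [kill_succ_of_notMem hx, ← mul_add, ← avg_add]
      congr 2
      exact funext ih

lemma kill_le_one [NeZero d] (hw : ∀ x, 0 ≤ w x) (hw1 : ∀ x, w x ≤ 1) (hf : ∀ x, f x ≤ 1)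
    (n : ℕ) (x : Site d) : kill D w f n x ≤ 1 :=
  kill_le_of_super (U := fun _ _ => 1) hw hf (fun _ x _ => hf x)
    (fun _ x _ => by rw [avg_const, mul_one]; exact hw1 x) n x

lemma kill_comp_equiv (φ : Site d ≃ Site d) (ψ : Fin d × Bool ≃ Fin d × Bool)
    (h : ∀ x s, φ (x + stepVec s) = φ x + stepVec (ψ s)) (n : ℕ) (x : Site d) :
    kill (φ ⁻¹' D) (w ∘ φ) (f ∘ φ) n x = kill D w f n (φ x) := by
  induction n generalizing x with
  | zero => rfl
  | succ n ih =>
    by_cases hx : φ x ∈ D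
    · rw [kill_of_mem hx, kill_of_mem (show x ∈ φ ⁻¹' D from hx)]; rfl
    · rw [kill_succ_of_notMem hx, kill_succ_of_notMem (show x ∉ φ ⁻¹' D from hx)]
      simp only [avg, Function.comp_apply, ih, h]
      congr 2
      exact Equiv.sum_comp ψ fun s => kill D w f n (φ x + stepVec s)

end kill

/-- The killing weight of a potential. -/
def wt {d : ℕ} (v : Site d → ℝ≥0) (x : Site d) : ℝ := Real.exp (-(v x : ℝ))

lemma wt_pos {d : ℕ} (v : Site d → ℝ≥0) (x : Site d) : 0 < wt v x := Real.exp_pos _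

lemma wt_nonneg {d : ℕ} (v : Site d → ℝ≥0) (x : Site d) : 0 ≤ wt v x := (wt_pos v x).le

lemma wt_le_one {d : ℕ} (v : Site d → ℝ≥0) (x : Site d) : wt v x ≤ 1 :=
  Real.exp_le_one_iff.2 (by simp)

lemma wt_anti {d : ℕ} {v v' : Site d → ℝ≥0} {x : Site d} (h : v x ≤ v' x) : wt v' x ≤ wt v x :=
  Real.exp_le_exp.2 (neg_le_neg (by exact_mod_cast h))

/-- The probability to reach `D` from `x` within `n` steps without being killed. -/
def greenN {d : ℕ} (D : Set (Site d)) (v : Site d → ℝ≥0) (n : ℕ) (x : Site d) : ℝ :=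
  kill D (wt v) (D.indicator 1) n x

/-- The probability to reach `D` from `x` without being killed. -/
def green {d : ℕ} (D : Set (Site d)) (v : Site d → ℝ≥0) (x : Site d) : ℝ :=
  ⨆ n, greenN D v n x

section green

variable {d : ℕ} {D D' : Set (Site d)} {v v' : Site d → ℝ≥0}

lemma indicator_one_nonneg (x : Site d) : 0 ≤ D.indicator (1 : Site d → ℝ) x :=
  Set.indicator_nonneg (fun _ _ => zero_le_one) x

lemma indicator_one_le (x : Site d) : D.indicator (1 : Site d → ℝ) x ≤ 1 :=
  Set.indicator_le_self' (fun _ _ => zero_le_one) x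

lemma greenN_nonneg (n : ℕ) (x : Site d) : 0 ≤ greenN D v n x :=
  kill_nonneg (wt_nonneg v) indicator_one_nonneg n x

lemma greenN_le_one [NeZero d] (n : ℕ) (x : Site d) : greenN D v n x ≤ 1 :=
  kill_le_one (wt_nonneg v) (wt_le_one v) indicator_one_le n x

lemma greenN_of_mem {x : Site d} (hx : x ∈ D) (n : ℕ) : greenN D v n x = 1 := by
  simp [greenN, kill_of_mem hx, hx]

lemma greenN_zero_of_notMem {x : Site d} (hx : x ∉ D) : greenN D v 0 x = 0 := by
  simp [greenN, kill_zero, hx]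

lemma greenN_succ_of_notMem {x : Site d} (hx : x ∉ D) (n : ℕ) :
    greenN D v (n + 1) x = wt v x * avg (greenN D v n) x :=
  kill_succ_of_notMem hx n

lemma greenN_le_succ (n : ℕ) (x : Site d) : greenN D v n x ≤ greenN D v (n + 1) x := by
  induction n generalizing x with
  | zero =>
    by_cases hx : x ∈ D
    · rw [greenN_of_mem hx, greenN_of_mem hx]
    · rw [greenN_zero_of_notMem hx]; exact greenN_nonneg _ _
  | succ n ih =>
    by_cases hx : x ∈ D
    · rw [greenN_of_mem hx, greenN_of_mem hx]
    · rw [greenN_succ_of_notMem hx, greenN_succ_of_notMem hx]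
      exact mul_le_mul_of_nonneg_left (avg_mono ih x) (wt_nonneg v x)

lemma greenN_monotone (x : Site d) : Monotone fun n => greenN D v n x :=
  monotone_nat_of_le_succ fun n => greenN_le_succ n x

variable [NeZero d]

lemma bddAbove_greenN (x : Site d) : BddAbove (Set.range fun n => greenN D v n x) :=
  ⟨1, by rintro _ ⟨n, rfl⟩; exact greenN_le_one n x⟩

lemma tendsto_greenN (x : Site d) :
    Tendsto (fun n => greenN D v n x) atTop (𝓝 (green D v x)) :=
  tendsto_atTop_ciSup (greenN_monotone x) (bddAbove_greenN x)

lemma greenN_le_green (n : ℕ) (x : Site d) : greenN D v n x ≤ green D v x :=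
  le_ciSup (bddAbove_greenN x) n

lemma green_nonneg (x : Site d) : 0 ≤ green D v x :=
  (greenN_nonneg 0 x).trans (greenN_le_green 0 x)

lemma green_le_one (x : Site d) : green D v x ≤ 1 :=
  ciSup_le fun n => greenN_le_one n x

lemma green_of_mem {x : Site d} (hx : x ∈ D) : green D v x = 1 := by
  simp [green, greenN_of_mem hx]

lemma green_of_notMem {x : Site d} (hx : x ∉ D) : green D v x = wt v x * avg (green D v) x := by
  have h1 := (tendsto_greenN (D := D) (v := v) x).comp (tendsto_add_atTop_nat 1)
  have h2 : Tendsto (fun n => wt v x * avg (greenN D v n) x) atTop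
      (𝓝 (wt v x * avg (green D v) x)) :=
    tendsto_const_nhds.mul (tendsto_avg tendsto_greenN x)
  refine tendsto_nhds_unique (h1.congr fun n => ?_) h2
  exact greenN_succ_of_notMem hx n

lemma green_le_wt {x : Site d} (hx : x ∉ D) : green D v x ≤ wt v x := by
  rw [green_of_notMem hx]
  refine mul_le_of_le_one_right (wt_nonneg v x) ?_
  calc avg (green D v) x ≤ avg (fun _ => 1) x := avg_mono green_le_one x
    _ = 1 := avg_const 1 x

/-- Comparison with a supersolution. -/
lemma green_le_of_super {U : Site d → ℝ} (h0 : ∀ x, 0 ≤ U x) (hD : ∀ x ∈ D, 1 ≤ U x)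
    (hU : ∀ x ∉ D, wt v x * avg U x ≤ U x) (x : Site d) : green D v x ≤ U x := by
  have hf : ∀ x ∈ D, D.indicator (1 : Site d → ℝ) x ≤ U x := fun x hx => by simpa [hx] using hD x hx
  refine ciSup_le fun n => kill_le_of_super (U := fun _ => U) (wt_nonneg v) (fun x => ?_)
    (fun _ => hf) (fun _ => hU) n x
  by_cases hx : x ∈ D
  · exact hf x hx
  · simpa [hx] using h0 x

lemma green_anti (h : ∀ x ∉ D, v x ≤ v' x) (x : Site d) : green D v' x ≤ green D v x :=
  green_le_of_super green_nonneg (fun _ hx => (green_of_mem hx).ge)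
    (fun x hx => by
      rw [green_of_notMem hx (v := v)]
      exact mul_le_mul_of_nonneg_right (wt_anti (h x hx)) (avg_nonneg green_nonneg x)) x

lemma green_mono_set (h : D ⊆ D') (x : Site d) : green D v x ≤ green D' v x :=
  green_le_of_super green_nonneg (fun _ hx => (green_of_mem (h hx)).ge)
    (fun x hx => by
      by_cases hx' : x ∈ D'
      · rw [green_of_mem hx']
        exact mul_le_one₀ (wt_le_one v x) (avg_nonneg green_nonneg x)
          ((avg_mono green_le_one x).trans_eq (avg_const 1 x))
      · rw [← green_of_notMem hx']) x

/-- Supermultiplicativity of the passage probabilities. -/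
lemma green_mul_green_le (x y : Site d) :
    green {y} v x * green D v y ≤ green D v x := by
  have key : ∀ n x, greenN {y} v n x * green D v y ≤ green D v x := by
    intro n
    induction n with
    | zero =>
      intro x
      by_cases hx : x = y
      · subst hx; rw [greenN_of_mem (Set.mem_singleton x), one_mul]
      · rw [greenN_zero_of_notMem (by simpa using hx), zero_mul]; exact green_nonneg x
    | succ n ih =>
      intro x
      by_cases hx : x = y
      · subst hx; rw [greenN_of_mem (Set.mem_singleton x), one_mul]
      · by_cases hD : x ∈ D
        · rw [green_of_mem hD]
          exact mul_le_one₀ (greenN_le_one _ _) (green_nonneg _) (green_le_one _)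
        · rw [greenN_succ_of_notMem (by simpa using hx), green_of_notMem hD, mul_assoc,
            ← avg_mul_right]
          exact mul_le_mul_of_nonneg_left (avg_mono ih x) (wt_nonneg v x)
  exact le_of_tendsto ((tendsto_greenN x).mul_const _) (Eventually.of_forall fun n => key n x)

lemma green_step_le (x : Site d) (s : Fin d × Bool) :
    wt v x * (2 * d : ℝ)⁻¹ * green D v (x + stepVec s) ≤ green D v x := by
  by_cases hx : x ∈ D
  · rw [green_of_mem hx]
    refine mul_le_one₀ (mul_le_one₀ (wt_le_one v x) (by positivity) ?_) (green_nonneg _)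
      (green_le_one _)
    have : (1 : ℝ) ≤ d := by exact_mod_cast NeZero.one_le
    exact inv_le_one_of_one_le₀ (by linarith)
  · rw [green_of_notMem hx, mul_assoc]
    refine mul_le_mul_of_nonneg_left (mul_le_mul_of_nonneg_left ?_ (by positivity)) (wt_nonneg v x)
    exact Finset.single_le_sum (f := fun s => green D v (x + stepVec s))
      (fun s _ => green_nonneg _) (Finset.mem_univ s)

end green

/-! ### Passage probabilities of the random walk in terms of the recursion -/

section product

variable {S : Type*} [MeasurableSpace S] (ν : Measure S) [IsProbabilityMeasure ν]

/-- Prepending an entry to a sequence. -/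
def seqCons {S : Type*} (a : S) (ω : ℕ → S) : ℕ → S
  | 0 => a
  | n + 1 => ω n

lemma measurable_seqCons : Measurable fun p : S × (ℕ → S) => seqCons p.1 p.2 := by
  refine measurable_pi_iff.2 fun n => ?_
  cases n with
  | zero => exact measurable_fst
  | succ n => exact (measurable_pi_apply n).comp measurable_snd

lemma measurePreserving_seqCons :
    MeasurePreserving (fun p : S × (ℕ → S) => seqCons p.1 p.2)
      (ν.prod (Measure.infinitePi fun _ : ℕ => ν)) (Measure.infinitePi fun _ : ℕ => ν) := by
  refine ⟨measurable_seqCons, Measure.eq_infinitePi _ fun s t ht => ?_⟩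
  classical
  obtain ⟨n, hn⟩ : ∃ n, ∀ i ∈ s, i < n + 1 :=
    ⟨s.sup id, fun i hi => Nat.lt_succ_of_le (Finset.le_sup (f := id) hi)⟩
  set t' : ℕ → Set S := fun i => if i ∈ s then t i else Set.univ with ht'
  have mt' : ∀ i, MeasurableSet (t' i) := fun i => by
    simp only [ht']; split_ifs
    exacts [ht i, MeasurableSet.univ]
  have hpre : (fun p : S × (ℕ → S) => seqCons p.1 p.2) ⁻¹' (Set.pi s t) =
      t' 0 ×ˢ Set.pi (Finset.range n) (fun i => t' (i + 1)) := by
    ext ⟨a, ω⟩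
    simp only [Set.mem_preimage, Set.mem_pi, Finset.mem_coe, Set.mem_prod, Finset.mem_range, ht']
    constructor
    · intro h
      refine ⟨?_, fun i _ => ?_⟩
      · split_ifs with h0
        exacts [h 0 h0, trivial]
      · split_ifs with h0
        exacts [h (i + 1) h0, trivial]
    · rintro ⟨h0, h1⟩ i hi
      cases i with
      | zero => simpa [hi, seqCons] using h0
      | succ i => simpa [hi, seqCons] using h1 i (by have := hn _ hi; omega)
  have hprod : ∏ i ∈ s, ν (t i) = ∏ i ∈ Finset.range (n + 1), ν (t' i) := by
    have hs : s ⊆ Finset.range (n + 1) := fun i hi => Finset.mem_range.2 (hn i hi)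
    rw [← Finset.prod_subset hs (fun i _ hi => by simp [ht', hi])]
    exact Finset.prod_congr rfl fun i hi => by simp [ht', hi]
  rw [Measure.map_apply measurable_seqCons (MeasurableSet.pi s.countable_toSet fun i _ => ht i),
    hpre, Measure.prod_prod, Measure.infinitePi_pi _ (fun i _ => mt' _), hprod,
    Finset.prod_range_succ', mul_comm]

end product

section passage

variable {d : ℕ}

open Classical in
/-- The weight of the walk from `x` with steps `ω` if it reaches `y` within `n` steps. -/
def pathWeight (y : Site d) (v : Site d → ℝ) : ℕ → Site d → (ℕ → Fin d × Bool) → ℝ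
  | 0, x, _ => if x = y then 1 else 0
  | n + 1, x, ω => if x = y then 1 else
      Real.exp (-v x) * pathWeight y v n (x + stepVec (ω 0)) (fun k => ω (k + 1))

lemma walk_zero (ω : ℕ → Fin d × Bool) : walk 0 ω = 0 := by simp [walk]

lemma add_walk_succ (x : Site d) (n : ℕ) (ω : ℕ → Fin d × Bool) :
    x + walk (n + 1) ω = x + stepVec (ω 0) + walk n (fun k => ω (k + 1)) := by
  rw [walk, walk, Finset.sum_range_succ']
  abel

lemma pathWeight_of_hit {y : Site d} {v : Site d → ℝ} {m n : ℕ} {x : Site d}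
    {ω : ℕ → Fin d × Bool} (hmn : m ≤ n) (hm : x + walk m ω = y)
    (hlt : ∀ k < m, x + walk k ω ≠ y) :
    pathWeight y v n x ω = Real.exp (-∑ k ∈ Finset.range m, v (x + walk k ω)) := by
  induction m generalizing n x ω with
  | zero =>
    rw [walk_zero, add_zero] at hm
    cases n <;> simp [pathWeight, hm]
  | succ m ih =>
    obtain ⟨n, rfl⟩ : ∃ k, n = k + 1 := ⟨n - 1, by omega⟩
    have hx : x ≠ y := by simpa [walk_zero] using hlt 0 (Nat.succ_pos m)
    rw [pathWeight, if_neg hx, ih (by omega) (by rw [← add_walk_succ]; exact hm)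
      (fun k hk => by rw [← add_walk_succ]; exact hlt _ (by omega)), ← Real.exp_add,
      Finset.sum_range_succ']
    simp only [add_walk_succ, walk_zero, add_zero]
    congr 1
    ring

lemma pathWeight_of_not_hit {y : Site d} {v : Site d → ℝ} {x : Site d}
    {ω : ℕ → Fin d × Bool} (h : ∀ k, x + walk k ω ≠ y) (n : ℕ) : pathWeight y v n x ω = 0 := by
  have hx : x ≠ y := by simpa [walk_zero] using h 0
  induction n generalizing x ω with
  | zero => simp [pathWeight, hx]
  | succ n ih =>
    have h' : ∀ k, x + stepVec (ω 0) + walk k (fun k => ω (k + 1)) ≠ y := fun k => by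
      rw [← add_walk_succ]; exact h _
    rw [pathWeight, if_neg hx, ih h' (by simpa [walk_zero] using h' 0), mul_zero]

lemma abs_pathWeight_le_one {y : Site d} {v : Site d → ℝ} (hv : ∀ x, 0 ≤ v x) (n : ℕ) (x : Site d)
    (ω : ℕ → Fin d × Bool) : |pathWeight y v n x ω| ≤ 1 := by
  induction n generalizing x ω with
  | zero => simp only [pathWeight]; split_ifs <;> simp
  | succ n ih =>
    rw [pathWeight]
    split_ifs
    · simp
    · rw [abs_mul, abs_of_pos (Real.exp_pos _)]
      exact mul_le_one₀ (Real.exp_le_one_iff.2 (by simpa using hv x)) (abs_nonneg _) (ih _ _)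

lemma measurable_pathWeight (y : Site d) (v : Site d → ℝ) (n : ℕ) (x : Site d) :
    Measurable (pathWeight y v n x) := by
  induction n generalizing x with
  | zero => exact measurable_const
  | succ n ih =>
    by_cases hx : x = y
    · simp only [pathWeight, hx, if_true]; exact measurable_const
    · simp only [pathWeight, hx, if_false]
      refine Measurable.const_mul ?_ _
      have h : Measurable fun p : (Fin d × Bool) × (ℕ → Fin d × Bool) =>
          pathWeight y v n (x + stepVec p.1) p.2 :=
        measurable_from_prod_countable_right fun s => ih (x + stepVec s)
      exact h.comp (f := fun ω : ℕ → Fin d × Bool => (ω 0, fun k => ω (k + 1)))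
        (by fun_prop)

lemma integral_uniformOn (f : Fin d × Bool → ℝ) :
    ∫ s, f s ∂(uniformOn (Set.univ : Set (Fin d × Bool))) = (2 * d : ℝ)⁻¹ * ∑ s, f s := by
  rw [integral_fintype (Integrable.of_finite), Finset.mul_sum]
  refine Finset.sum_congr rfl fun s _ => ?_
  rw [Measure.real, uniformOn_univ]
  simp
  left; ring

variable [NeZero d]

instance : IsProbabilityMeasure (uniformOn (Set.univ : Set (Fin d × Bool))) :=
  isProbabilityMeasure_uniformOn Set.finite_univ Set.univ_nonempty

instance : IsProbabilityMeasure (walkMeasure d) := by unfold walkMeasure; infer_instance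

lemma integral_pathWeight (y : Site d) (v : Site d → ℝ≥0) (n : ℕ) (x : Site d) :
    ∫ ω, pathWeight y (fun z => (v z : ℝ)) n x ω ∂(walkMeasure d) = greenN {y} v n x := by
  induction n generalizing x with
  | zero =>
    by_cases hx : x = y
    · subst hx; simp [pathWeight, greenN_of_mem]
    · rw [greenN_zero_of_notMem (by simpa using hx)]; simp [pathWeight, hx]
  | succ n ih =>
    by_cases hx : x = y
    · subst hx; simp [pathWeight, greenN_of_mem]
    · have hmp := measurePreserving_seqCons (uniformOn (Set.univ : Set (Fin d × Bool)))
      rw [greenN_succ_of_notMem (by simpa using hx)]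
      simp only [pathWeight, hx, if_false]
      rw [integral_const_mul]
      congr 1
      have hmeas : Measurable fun p : (Fin d × Bool) × (ℕ → Fin d × Bool) =>
          pathWeight y (fun z => (v z : ℝ)) n (x + stepVec p.1) p.2 :=
        measurable_from_prod_countable_right fun s =>
          measurable_pathWeight y (fun z => (v z : ℝ)) n (x + stepVec s)
      have hmeas' : Measurable fun ω : ℕ → Fin d × Bool =>
          pathWeight y (fun z => (v z : ℝ)) n (x + stepVec (ω 0)) (fun k => ω (k + 1)) :=
        hmeas.comp (f := fun ω : ℕ → Fin d × Bool => (ω 0, fun k => ω (k + 1))) (by fun_prop)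
      rw [walkMeasure, ← hmp.map_eq, integral_map hmp.measurable.aemeasurable
        hmeas'.aestronglyMeasurable]
      simp only [seqCons]
      rw [integral_prod _ (Integrable.of_bound hmeas.aestronglyMeasurable 1
        (Eventually.of_forall fun p => abs_pathWeight_le_one (fun z => (v z).2) _ _ _))]
      have := ih
      rw [walkMeasure] at this
      simp only [this, integral_uniformOn]
      rfl

lemma passage_eq_green (y : Site d) (v : Site d → ℝ≥0) :
    passage y (fun x => (v x : ℝ)) = green {y} v 0 := by
  refine tendsto_nhds_unique ?_ (tendsto_greenN (D := {y}) (v := v) 0)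
  simp only [← integral_pathWeight]
  refine tendsto_integral_of_dominated_convergence (fun _ => 1)
    (fun n => (measurable_pathWeight _ _ _ _).aestronglyMeasurable) (integrable_const 1)
    (fun n => Eventually.of_forall fun ω => abs_pathWeight_le_one (fun z => (v z).2) _ _ _)
    (Eventually.of_forall fun ω => ?_)
  by_cases h : ∃ n, walk n ω = y
  · rw [if_pos h]
    have hmem : walk (hittingTime y ω) ω = y := Nat.sInf_mem (s := {n | walk n ω = y}) h
    refine tendsto_const_nhds.congr' ?_
    filter_upwards [eventually_ge_atTop (hittingTime y ω)] with n hn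
    rw [pathWeight_of_hit hn (by rw [zero_add]; exact hmem)
      (fun k hk => by rw [zero_add]; exact fun hk' => Nat.notMem_of_lt_sInf hk hk')]
    simp only [zero_add]
  · rw [if_neg h]
    push Not at h
    refine tendsto_const_nhds.congr fun n => ?_
    rw [pathWeight_of_not_hit (fun k => by rw [zero_add]; exact h k)]

end passage

/-! ### Lattice induction and path costs -/

/-- The `ℓ¹` length of a lattice point. -/
def l1 {d : ℕ} (z : Site d) : ℝ := ∑ i, |(z i : ℝ)|

lemma site_induction {d : ℕ} {p : Site d → Prop} (h0 : p 0) (hs : ∀ s, p (stepVec s))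
    (hadd : ∀ z w, p z → p w → p (z + w)) (z : Site d) : p z := by
  have hsingle : ∀ (i : Fin d) (k : ℤ), p (Pi.single i k) := by
    intro i k
    induction k using Int.induction_on with
    | zero => simpa using h0
    | succ k ih =>
      have := hadd _ _ ih (hs (i, true))
      simpa [stepVec, ← Pi.single_add] using this
    | pred k ih =>
      have := hadd _ _ ih (hs (i, false))
      simpa [stepVec, ← Pi.single_add, sub_eq_add_neg] using this
  rw [← Finset.univ_sum_single z]
  exact Finset.sum_induction _ p hadd h0 fun i _ => hsingle i (z i)

/-- A subadditive function on the lattice is bounded by a multiple of the `ℓ¹` length. -/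
lemma subadditive_le_l1 {d : ℕ} {f : Site d → ℝ} {C : ℝ} (h0 : f 0 ≤ 0)
    (hs : ∀ s, f (stepVec s) ≤ C) (hadd : ∀ z w, f (z + w) ≤ f z + f w) (z : Site d) :
    f z ≤ C * l1 z := by
  have hsingle : ∀ (i : Fin d) (k : ℤ), f (Pi.single i k) ≤ C * |(k : ℝ)| := by
    intro i k
    have hnat : ∀ n : ℕ, f (Pi.single i (n : ℤ)) ≤ C * n ∧ f (Pi.single i (-n : ℤ)) ≤ C * n := by
      intro n
      induction n with
      | zero => simpa using h0
      | succ n ih =>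
        have e1 : (Pi.single i ((n + 1 : ℕ) : ℤ) : Site d) =
            Pi.single i (n : ℤ) + stepVec (i, true) := by
          simp [stepVec, ← Pi.single_add]
        have e2 : (Pi.single i (-((n + 1 : ℕ) : ℤ)) : Site d) =
            Pi.single i (-n : ℤ) + stepVec (i, false) := by
          simp only [stepVec, ← Pi.single_add]; congr 1; push_cast; simp; ring
        rw [e1, e2]
        push_cast
        have := hs (i, true)
        have := hs (i, false)
        exact ⟨by linarith [hadd (Pi.single i (n : ℤ)) (stepVec (i, true))],
          by linarith [hadd (Pi.single i (-n : ℤ)) (stepVec (i, false))]⟩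
    obtain ⟨n, rfl | rfl⟩ := Int.eq_nat_or_neg k
    · simpa using (hnat n).1
    · simpa using (hnat n).2
  have hsum : ∀ t : Finset (Fin d), f (∑ i ∈ t, Pi.single i (z i)) ≤ ∑ i ∈ t, C * |(z i : ℝ)| := by
    classical
    intro t
    induction t using Finset.induction_on with
    | empty => simpa using h0
    | insert i t hi ih =>
      rw [Finset.sum_insert hi, Finset.sum_insert hi]
      exact (hadd _ _).trans (add_le_add (hsingle i _) ih)
  have := hsum Finset.univ
  rwa [Finset.univ_sum_single, ← Finset.mul_sum] at this

section cost

variable {d : ℕ} [NeZero d]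

lemma green_pos (x y : Site d) (v : Site d → ℝ≥0) : 0 < green {y} v x := by
  have hd : (0 : ℝ) < d := Nat.cast_pos.2 (NeZero.pos d)
  have key : ∀ z x : Site d, 0 < green {x + z} v x := by
    intro z
    refine site_induction (p := fun z => ∀ x : Site d, 0 < green {x + z} v x) ?_ ?_ ?_ z
    · intro x; rw [green_of_mem (by simp)]; exact one_pos
    · intro s x
      refine lt_of_lt_of_le ?_ (green_step_le x s)
      rw [green_of_mem (by simp)]
      have := wt_pos v x
      positivity
    · intro z w hz hw x
      refine lt_of_lt_of_le (mul_pos (hz x) (hw (x + z))) ?_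
      rw [← add_assoc]
      exact green_mul_green_le _ _
  simpa using key (y - x) x

/-- The cost `-ln e(x, y, v)` of going from `x` to `y`. -/
def cost (x y : Site d) (v : Site d → ℝ≥0) : ℝ := -Real.log (green {y} v x)

lemma cost_nonneg (x y : Site d) (v : Site d → ℝ≥0) : 0 ≤ cost x y v :=
  neg_nonneg.2 (Real.log_nonpos (green_nonneg x) (green_le_one x))

lemma cost_self (x : Site d) (v : Site d → ℝ≥0) : cost x x v = 0 := by
  simp [cost, green_of_mem]

lemma cost_triangle (x y z : Site d) (v : Site d → ℝ≥0) :
    cost x z v ≤ cost x y v + cost y z v := by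
  have h := Real.log_le_log (mul_pos (green_pos x y v) (green_pos y z v))
    (green_mul_green_le (D := {z}) x y)
  rw [Real.log_mul (green_pos x y v).ne' (green_pos y z v).ne'] at h
  simp only [cost]; linarith

lemma cost_step_le (x : Site d) (s : Fin d × Bool) (v : Site d → ℝ≥0) :
    cost x (x + stepVec s) v ≤ v x + Real.log (2 * d) := by
  have hd : (0 : ℝ) < d := Nat.cast_pos.2 (NeZero.pos d)
  have h := green_step_le (D := {x + stepVec s}) (v := v) x s
  rw [green_of_mem (by simp), mul_one] at h
  have h2 := Real.log_le_log (mul_pos (wt_pos v x) (by positivity)) h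
  rw [Real.log_mul (wt_pos v x).ne' (by positivity), Real.log_inv, wt, Real.log_exp] at h2
  simp only [cost]; linarith

end cost

/-! ### The environment -/

/-- A non-negative potential on `ℤ^d`. -/
abbrev Env (d : ℕ) := Site d → ℝ≥0

/-- The law of an i.i.d. potential with one-site law `ν`. -/
def envLaw (d : ℕ) (ν : Measure ℝ≥0) : Measure (Env d) := Measure.infinitePi fun _ => ν

/-- The environment seen from `z`. -/
def shiftEnv {d : ℕ} (z : Site d) (v : Env d) : Env d := fun x => v (x + z)

open Classical in
/-- The environment equal to `v` on `D` and to `v'` off `D`. -/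
def mixEnv {d : ℕ} (D : Set (Site d)) (v v' : Env d) : Env d := fun x => if x ∈ D then v x else v' x

section env

variable {d : ℕ}

lemma measurable_kill {w f : Env d → Site d → ℝ} (D : Set (Site d))
    (hw : ∀ x, Measurable fun v => w v x) (hf : ∀ x, Measurable fun v => f v x) (n : ℕ)
    (x : Site d) : Measurable fun v => kill D (w v) (f v) n x := by
  induction n generalizing x with
  | zero => exact hf x
  | succ n ih =>
    by_cases hx : x ∈ D
    · simp only [kill_of_mem hx]; exact hf x
    · simp only [kill_succ_of_notMem hx, avg]
      exact (hw x).mul ((Finset.measurable_sum _ fun s _ => ih _).const_mul _)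

lemma measurable_wt (x : Site d) : Measurable fun v : Env d => wt v x := by
  unfold wt; fun_prop

lemma measurable_greenN (D : Set (Site d)) (n : ℕ) (x : Site d) :
    Measurable fun v : Env d => greenN D v n x :=
  measurable_kill (f := fun _ => D.indicator 1) D measurable_wt (fun _ => measurable_const) n x

lemma measurable_green [NeZero d] (D : Set (Site d)) (x : Site d) :
    Measurable fun v : Env d => green D v x :=
  measurable_of_tendsto_metrizable (fun n => measurable_greenN D n x)
    (tendsto_pi_nhds.2 fun v => tendsto_greenN (D := D) (v := v) x)

lemma measurable_cost [NeZero d] (x y : Site d) : Measurable fun v : Env d => cost x y v :=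
  (Real.measurable_log.comp (measurable_green {y} x)).neg

lemma measurable_shiftEnv (z : Site d) : Measurable (shiftEnv z) :=
  measurable_pi_iff.2 fun x => measurable_pi_apply (x + z)

lemma greenN_shiftEnv_zero (y z : Site d) (v : Env d) (n : ℕ) :
    greenN {y} (shiftEnv z v) n 0 = greenN {z + y} v n z := by
  have := kill_comp_equiv (D := {z + y}) (w := wt v) (f := ({z + y} : Set (Site d)).indicator 1)
    (Equiv.addRight z) (Equiv.refl _)
    (fun y s => by simp only [Equiv.coe_addRight, Equiv.refl_apply]; abel) n 0
  simp only [Equiv.coe_addRight, zero_add] at this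
  rw [greenN, greenN, ← this]
  have e : (fun x : Site d => x + z) ⁻¹' {z + y} = {y} := by
    ext x; simp [add_comm z y]
  rw [e]
  congr 1
  funext x
  simp only [Set.indicator, Set.mem_singleton_iff, Function.comp_apply, add_comm z y, add_left_inj]
  rfl

lemma green_shiftEnv_zero (y z : Site d) (v : Env d) :
    green {y} (shiftEnv z v) 0 = green {z + y} v z := by
  unfold green
  simp only [greenN_shiftEnv_zero]

lemma green_neg (y : Site d) (v : Env d) :
    green {y} (fun x => v (-x)) 0 = green {-y} v 0 := by
  unfold green
  congr 1
  funext n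
  have := kill_comp_equiv (D := {-y}) (w := wt v) (f := ({-y} : Set (Site d)).indicator 1)
    (Equiv.neg _) ((Equiv.refl _).prodCongr Equiv.boolNot)
    (fun y s => by
      simp only [Equiv.neg_apply, Equiv.prodCongr_apply, neg_add]
      congr 1
      obtain ⟨i, b⟩ := s
      cases b <;> simp [stepVec, ← Pi.single_neg]) n 0
  simp only [Equiv.neg_apply, neg_zero] at this
  rw [greenN, greenN, ← this]
  have e : (Neg.neg : Site d → Site d) ⁻¹' {-y} = {y} := by
    ext x; simp
  rw [e]
  congr 1
  funext x
  simp only [Set.indicator, Set.mem_singleton_iff, Function.comp_apply, Equiv.neg_apply, neg_inj]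
  rfl

variable (ν : Measure ℝ≥0) [IsProbabilityMeasure ν]

instance : IsProbabilityMeasure (envLaw d ν) := by unfold envLaw; infer_instance

lemma measurePreserving_comp_equiv (σ : Site d ≃ Site d) :
    MeasurePreserving (fun v : Env d => fun x => v (σ x)) (envLaw d ν) (envLaw d ν) := by
  refine ⟨measurable_pi_iff.2 fun x => measurable_pi_apply (σ x), ?_⟩
  have h := Measure.infinitePi_map_piCongrLeft (fun _ : Site d => ν) σ.symm
  unfold envLaw
  convert h using 2
  funext v x
  simpa using (MeasurableEquiv.piCongrLeft_apply_apply (β := fun _ : Site d => ℝ≥0) σ.symm v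
    (σ x)).symm

lemma measurePreserving_shiftEnv (z : Site d) :
    MeasurePreserving (shiftEnv z) (envLaw d ν) (envLaw d ν) :=
  measurePreserving_comp_equiv ν (Equiv.addRight z)

lemma measurable_mixEnv (D : Set (Site d)) :
    Measurable fun p : Env d × Env d => mixEnv D p.1 p.2 := by
  classical
  refine measurable_pi_iff.2 fun x => ?_
  unfold mixEnv
  by_cases hx : x ∈ D <;> simp only [hx, if_true, if_false] <;> fun_prop

/-- Resampling the environment off `D` does not change its law. -/
lemma measurePreserving_mixEnv (D : Set (Site d)) :
    MeasurePreserving (fun p : Env d × Env d => mixEnv D p.1 p.2)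
      ((envLaw d ν).prod (envLaw d ν)) (envLaw d ν) := by
  refine ⟨measurable_mixEnv D, Measure.eq_infinitePi _ fun s t ht => ?_⟩
  classical
  have hpre : (fun p : Env d × Env d => mixEnv D p.1 p.2) ⁻¹' (Set.pi s t) =
      Set.pi ((s.filter (· ∈ D) : Finset (Site d)) : Set (Site d)) t ×ˢ
        Set.pi ((s.filter (· ∉ D) : Finset (Site d)) : Set (Site d)) t := by
    ext ⟨v, v'⟩
    simp only [Set.mem_preimage, Set.mem_pi, Finset.mem_coe, Set.mem_prod, Finset.mem_filter,
      mixEnv]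
    constructor
    · intro h
      exact ⟨fun i hi => by simpa [hi.2] using h i hi.1, fun i hi => by simpa [hi.2] using h i hi.1⟩
    · rintro ⟨h1, h2⟩ i hi
      split_ifs with hD
      exacts [h1 i ⟨hi, hD⟩, h2 i ⟨hi, hD⟩]
  rw [Measure.map_apply (measurable_mixEnv D)
    (MeasurableSet.pi s.countable_toSet fun i _ => ht i), hpre, Measure.prod_prod, envLaw,
    Measure.infinitePi_pi _ (fun i _ => ht i), Measure.infinitePi_pi _ (fun i _ => ht i),
    Finset.prod_filter_mul_prod_filter_not]

lemma measurePreserving_eval (x : Site d) :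
    MeasurePreserving (fun v : Env d => v x) (envLaw d ν) ν :=
  measurePreserving_eval_infinitePi (fun _ : Site d => ν) x

lemma integral_eval (x : Site d) {f : ℝ≥0 → ℝ} (hf : Measurable f) :
    ∫ v, f (v x) ∂(envLaw d ν) = ∫ t, f t ∂ν := by
  conv_rhs => rw [← (measurePreserving_eval ν x).map_eq]
  rw [integral_map (measurable_pi_apply x).aemeasurable
    hf.aestronglyMeasurable]

variable [NeZero d]

lemma cost_shiftEnv (y z : Site d) (v : Env d) :
    cost 0 y (shiftEnv z v) = cost z (z + y) v := by
  rw [cost, green_shiftEnv_zero, cost]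

/-- The mean cost of going from `0` to `z`. -/
def meanCost (ν : Measure ℝ≥0) (z : Site d) : ℝ := ∫ v, cost 0 z v ∂(envLaw d ν)

lemma meanCost_nonneg (z : Site d) : 0 ≤ meanCost ν z :=
  integral_nonneg fun v => cost_nonneg 0 z v

lemma integral_cost_translate (x z : Site d) :
    ∫ v, cost x (x + z) v ∂(envLaw d ν) = meanCost ν z := by
  rw [meanCost]
  conv_rhs => rw [← (measurePreserving_shiftEnv ν x).map_eq]
  rw [integral_map (measurable_shiftEnv x).aemeasurable
    (measurable_cost 0 z).aestronglyMeasurable]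
  simp only [cost_shiftEnv]

lemma integrable_cost_translate {x z : Site d} (h : Integrable (cost 0 z) (envLaw d ν)) :
    Integrable (cost x (x + z)) (envLaw d ν) := by
  have := (measurePreserving_shiftEnv ν x).integrable_comp_of_integrable h
  refine this.congr (Eventually.of_forall fun v => ?_)
  exact cost_shiftEnv z x v

lemma meanCost_neg (z : Site d) : meanCost ν (-z) = meanCost ν z := by
  rw [meanCost, meanCost]
  conv_rhs => rw [← (measurePreserving_comp_equiv ν (Equiv.neg (Site d))).map_eq]
  rw [integral_map (measurePreserving_comp_equiv ν (Equiv.neg (Site d))).measurable.aemeasurable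
    (measurable_cost 0 z).aestronglyMeasurable]
  simp only [cost, Equiv.neg_apply, green_neg]

variable {ν}

lemma integrable_eval (hν : Integrable (fun t : ℝ≥0 => (t : ℝ)) ν) (x : Site d) :
    Integrable (fun v : Env d => (v x : ℝ)) (envLaw d ν) :=
  (measurePreserving_eval ν x).integrable_comp_of_integrable hν

lemma integrable_cost (hν : Integrable (fun t : ℝ≥0 => (t : ℝ)) ν) (x y : Site d) :
    Integrable (cost x y) (envLaw d ν) := by
  have key : ∀ z : Site d, Integrable (cost 0 z) (envLaw d ν) := by
    refine site_induction ?_ ?_ ?_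
    · simp only [funext (cost_self (0 : Site d))]; exact integrable_const 0
    · intro s
      refine Integrable.mono' ((integrable_eval hν 0).add (integrable_const (Real.log (2 * d))))
        (measurable_cost _ _).aestronglyMeasurable (Eventually.of_forall fun v => ?_)
      rw [Real.norm_of_nonneg (cost_nonneg _ _ _)]
      simpa using cost_step_le 0 s v
    · intro z w hz hw
      refine Integrable.mono' (hz.add (integrable_cost_translate ν (x := z) hw))
        (measurable_cost _ _).aestronglyMeasurable (Eventually.of_forall fun v => ?_)
      rw [Real.norm_of_nonneg (cost_nonneg _ _ _)]
      exact cost_triangle 0 z (z + w) v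
  have := integrable_cost_translate ν (x := x) (key (y - x))
  simpa using this

lemma meanCost_add_le (hν : Integrable (fun t : ℝ≥0 => (t : ℝ)) ν) (z w : Site d) :
    meanCost ν (z + w) ≤ meanCost ν z + meanCost ν w := by
  rw [← integral_cost_translate ν z w, meanCost, meanCost,
    ← integral_add (integrable_cost hν _ _) (integrable_cost hν _ _)]
  exact integral_mono (integrable_cost hν _ _) ((integrable_cost hν _ _).add
    (integrable_cost hν _ _)) fun v => cost_triangle 0 z (z + w) v

lemma meanCost_zero : meanCost ν (0 : Site d) = 0 := by simp [meanCost, cost_self]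

lemma meanCost_step_le (hν : Integrable (fun t : ℝ≥0 => (t : ℝ)) ν) (s : Fin d × Bool) :
    meanCost ν (stepVec s) ≤ ∫ t, (t : ℝ) ∂ν + Real.log (2 * d) := by
  have h : ∫ v : Env d, ((v 0 : ℝ) + Real.log (2 * d)) ∂(envLaw d ν) =
      ∫ t, (t : ℝ) ∂ν + Real.log (2 * d) := by
    rw [integral_add (integrable_eval hν 0) (integrable_const _),
      integral_eval ν 0 (f := fun t => (t : ℝ)) (by fun_prop)]
    simp
  rw [← h]
  refine integral_mono (integrable_cost hν _ _) ((integrable_eval hν 0).add (integrable_const _))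
    fun v => ?_
  simpa using cost_step_le 0 s v

lemma meanCost_le_l1 (hν : Integrable (fun t : ℝ≥0 => (t : ℝ)) ν) (z : Site d) :
    meanCost ν z ≤ (∫ t, (t : ℝ) ∂ν + Real.log (2 * d)) * l1 z :=
  subadditive_le_l1 meanCost_zero.le (meanCost_step_le hν) (meanCost_add_le hν) z

end env

/-! ### Norms determined by their values on the lattice -/

section lattice

variable {d : ℕ}

lemma latticePoint_apply (z : Site d) (i : Fin d) : latticePoint z i = (z i : ℝ) := rfl

lemma latticePoint_nsmul (k : ℕ) (z : Site d) :
    latticePoint (k • z) = (k : ℝ) • latticePoint z := by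
  ext i; simp [latticePoint_apply]

lemma abs_apply_le_norm (x : EuclideanSpace ℝ (Fin d)) (i : Fin d) : |x i| ≤ ‖x‖ := by
  simpa using PiLp.norm_apply_le x i

lemma exists_seminorm_le (p : Seminorm ℝ (EuclideanSpace ℝ (Fin d))) :
    ∃ K, 0 ≤ K ∧ ∀ x, p x ≤ K * ∑ i, |x i| := by
  refine ⟨∑ i, p (EuclideanSpace.single i 1), Finset.sum_nonneg fun i _ => apply_nonneg p _,
    fun x => ?_⟩
  have hx : x = ∑ i, x i • EuclideanSpace.single i (1 : ℝ) := by
    ext j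
    simp [Finset.sum_apply, Pi.single_apply]
  calc p x = p (∑ i, x i • EuclideanSpace.single i (1 : ℝ)) := by rw [← hx]
    _ ≤ ∑ i, p (x i • EuclideanSpace.single i (1 : ℝ)) :=
        Finset.le_sum_of_subadditive p (map_zero p).le (map_add_le_add p) _ _
    _ = ∑ i, |x i| * p (EuclideanSpace.single i 1) := by
        simp only [map_smul_eq_mul, Real.norm_eq_abs]
    _ ≤ ∑ i, (∑ j, |x j|) * p (EuclideanSpace.single i 1) :=
        Finset.sum_le_sum fun i _ => mul_le_mul_of_nonneg_right
          (Finset.single_le_sum (f := fun j => |x j|) (fun j _ => abs_nonneg _)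
            (Finset.mem_univ i)) (apply_nonneg p _)
    _ = _ := by rw [← Finset.mul_sum, mul_comm]

/-- The lattice point below `n x`. -/
def floorPoint (n : ℕ) (x : EuclideanSpace ℝ (Fin d)) : Site d := fun i => ⌊(n : ℝ) * x i⌋

lemma abs_floorPoint_sub_le (n : ℕ) (x : EuclideanSpace ℝ (Fin d)) (i : Fin d) :
    |(floorPoint n x i : ℝ) - n * x i| ≤ 1 := by
  have h1 := Int.floor_le ((n : ℝ) * x i)
  have h2 := Int.lt_floor_add_one ((n : ℝ) * x i)
  rw [abs_le, floorPoint]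
  constructor <;> linarith

lemma sum_abs_floorPoint_sub_le (n : ℕ) (x : EuclideanSpace ℝ (Fin d)) :
    ∑ i, |(floorPoint n x i : ℝ) - n * x i| ≤ d := by
  refine (Finset.sum_le_sum fun i _ => abs_floorPoint_sub_le n x i).trans ?_
  simp

lemma tendsto_seminorm_floorPoint (p : Seminorm ℝ (EuclideanSpace ℝ (Fin d)))
    (x : EuclideanSpace ℝ (Fin d)) :
    Tendsto (fun n : ℕ => p (latticePoint (floorPoint n x)) / n) atTop (𝓝 (p x)) := by
  obtain ⟨K, hK, hp⟩ := exists_seminorm_le p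
  rw [tendsto_iff_norm_sub_tendsto_zero]
  refine squeeze_zero' (Eventually.of_forall fun _ => norm_nonneg _) ?_
    (tendsto_const_div_atTop_nhds_zero_nat (K * d))
  filter_upwards [eventually_gt_atTop 0] with n hn
  have hn' : (0 : ℝ) < n := Nat.cast_pos.2 hn
  have h1 : |p (latticePoint (floorPoint n x)) - p ((n : ℝ) • x)| ≤ K * d := by
    refine (abs_sub_map_le_sub p _ _).trans ((hp _).trans ?_)
    exact mul_le_mul_of_nonneg_left (sum_abs_floorPoint_sub_le n x) hK
  rw [map_smul_eq_mul, Real.norm_of_nonneg hn'.le] at h1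
  rw [Real.norm_eq_abs, le_div_iff₀ hn', ← abs_of_pos hn', ← abs_mul, abs_of_pos hn']
  rwa [sub_mul, div_mul_cancel₀ _ hn'.ne', mul_comm (p x)]

lemma seminorm_le_of_lattice {p q : Seminorm ℝ (EuclideanSpace ℝ (Fin d))}
    (h : ∀ z : Site d, p (latticePoint z) ≤ q (latticePoint z)) (x : EuclideanSpace ℝ (Fin d)) :
    p x ≤ q x :=
  le_of_tendsto_of_tendsto' (tendsto_seminorm_floorPoint p x) (tendsto_seminorm_floorPoint q x)
    fun n => div_le_div_of_nonneg_right (h _) (Nat.cast_nonneg n)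

lemma seminorm_ext_lattice {p q : Seminorm ℝ (EuclideanSpace ℝ (Fin d))}
    (h : ∀ z : Site d, p (latticePoint z) = q (latticePoint z)) : p = q :=
  Seminorm.ext fun x => le_antisymm (seminorm_le_of_lattice (fun z => (h z).le) x)
    (seminorm_le_of_lattice (fun z => (h z).ge) x)

lemma mul_norm_le_of_lattice {p : Seminorm ℝ (EuclideanSpace ℝ (Fin d))} {c : ℝ} (hc : 0 ≤ c)
    (h : ∀ z : Site d, c * ‖latticePoint z‖ ≤ p (latticePoint z))
    (x : EuclideanSpace ℝ (Fin d)) : c * ‖x‖ ≤ p x := by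
  lift c to ℝ≥0 using hc
  exact seminorm_le_of_lattice (p := c • normSeminorm ℝ (EuclideanSpace ℝ (Fin d))) h x

/-- A homogeneous subadditive even function on the lattice extends to a seminorm. -/
lemma exists_seminorm_extension {g : Site d → ℝ} (hadd : ∀ z w, g (z + w) ≤ g z + g w)
    (hneg : ∀ z, g (-z) = g z) (hsmul : ∀ (n : ℕ) z, g (n • z) = n * g z) :
    ∃ N : Seminorm ℝ (EuclideanSpace ℝ (Fin d)), ∀ z, N (latticePoint z) = g z := by
  obtain ⟨C, hC0, hC⟩ : ∃ C, 0 ≤ C ∧ ∀ z, g z ≤ C * l1 z := by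
    have h0 : g 0 ≤ 0 := by simpa using (hsmul 0 0).le
    refine ⟨∑ s : Fin d × Bool, |g (stepVec s)|, Finset.sum_nonneg fun _ _ => abs_nonneg _,
      subadditive_le_l1 h0 (fun s => ?_) hadd⟩
    exact (le_abs_self _).trans (Finset.single_le_sum (f := fun s => |g (stepVec s)|)
      (fun _ _ => abs_nonneg _) (Finset.mem_univ s))
  have hlip : ∀ z w, |g z - g w| ≤ C * l1 (z - w) := by
    intro z w
    have h1 := hadd (z - w) w
    have h2 := hadd (w - z) z
    rw [sub_add_cancel] at h1 h2
    have h3 := hneg (z - w)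
    rw [neg_sub] at h3
    rw [abs_le]
    constructor <;> linarith [hC (z - w)]
  have hcross : ∀ (n m : ℕ) (z w : Site d) (x : EuclideanSpace ℝ (Fin d)),
      |m * g z - n * g w| ≤ C * (m * ∑ i, |(z i : ℝ) - n * x i| + n * ∑ i, |(w i : ℝ) - m * x i|) := by
    intro n m z w x
    rw [← hsmul, ← hsmul]
    refine (hlip _ _).trans (mul_le_mul_of_nonneg_left ?_ hC0)
    rw [l1, Finset.mul_sum, Finset.mul_sum, ← Finset.sum_add_distrib]
    refine Finset.sum_le_sum fun i _ => ?_
    have e : (((m • z - n • w) i : ℤ) : ℝ) =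
        m * ((z i : ℝ) - n * x i) - n * ((w i : ℝ) - m * x i) := by
      simp; ring
    rw [e]
    refine (abs_sub _ _).trans ?_
    rw [abs_mul, abs_mul, Nat.abs_cast, Nat.abs_cast]
  have hex : ∀ x : EuclideanSpace ℝ (Fin d), ∃ L : ℝ, ∀ (n : ℕ) (z : Site d),
      |g z - n * L| ≤ C * ∑ i, |(z i : ℝ) - n * x i| := by
    intro x
    have hcau : CauchySeq fun n : ℕ => g (floorPoint (n + 1) x) / ((n + 1 : ℕ) : ℝ) := by
      refine cauchySeq_of_le_tendsto_0' (fun n : ℕ => 2 * (C * d) / ((n + 1 : ℕ) : ℝ)) ?_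
        ((tendsto_const_div_atTop_nhds_zero_nat _).comp (tendsto_add_atTop_nat 1))
      intro n m hnm
      have hn : (0 : ℝ) < ((n + 1 : ℕ) : ℝ) := by positivity
      have hm : (0 : ℝ) < ((m + 1 : ℕ) : ℝ) := by positivity
      have hnm' : ((n + 1 : ℕ) : ℝ) ≤ ((m + 1 : ℕ) : ℝ) := by exact_mod_cast Nat.succ_le_succ hnm
      have h1 := (hcross (n + 1) (m + 1) (floorPoint (n + 1) x) (floorPoint (m + 1) x) x).trans
        (mul_le_mul_of_nonneg_left (add_le_add
          (mul_le_mul_of_nonneg_left (sum_abs_floorPoint_sub_le (n + 1) x) hm.le)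
          (mul_le_mul_of_nonneg_left (sum_abs_floorPoint_sub_le (m + 1) x) hn.le)) hC0)
      rw [Real.dist_eq, div_sub_div _ _ hn.ne' hm.ne', abs_div, abs_of_pos (mul_pos hn hm),
        div_le_div_iff₀ (mul_pos hn hm) hn, mul_comm (g (floorPoint (n + 1) x))]
      refine (mul_le_mul_of_nonneg_right h1 hn.le).trans ?_
      have h2 := mul_le_mul_of_nonneg_right (mul_le_mul_of_nonneg_left hnm'
        (mul_nonneg hC0 (Nat.cast_nonneg d))) hn.le
      nlinarith [h2]
    obtain ⟨L, hL'⟩ := cauchySeq_tendsto_of_complete hcau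
    have hL : Tendsto (fun n : ℕ => g (floorPoint n x) / n) atTop (𝓝 L) :=
      (tendsto_add_atTop_iff_nat 1).1 hL'
    refine ⟨L, fun n z => ?_⟩
    have h1 : Tendsto (fun m : ℕ => |g z - n * (g (floorPoint m x) / m)|) atTop
        (𝓝 |g z - n * L|) := ((hL.const_mul _).const_sub _).abs
    have h2 : Tendsto (fun m : ℕ => C * (∑ i, |(z i : ℝ) - n * x i|) + C * (n * d) / (m : ℝ)) atTop
        (𝓝 (C * (∑ i, |(z i : ℝ) - n * x i|) + 0)) :=
      tendsto_const_nhds.add (tendsto_const_div_atTop_nhds_zero_nat _)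
    rw [add_zero] at h2
    refine le_of_tendsto_of_tendsto h1 h2 ?_
    filter_upwards [eventually_gt_atTop 0] with m hm
    have hm' : (0 : ℝ) < m := Nat.cast_pos.2 hm
    have h3 := (hcross n m z (floorPoint m x) x).trans (mul_le_mul_of_nonneg_left
      (add_le_add le_rfl (mul_le_mul_of_nonneg_left (sum_abs_floorPoint_sub_le m x)
        (Nat.cast_nonneg n))) hC0)
    have e1 : g z - n * (g (floorPoint m x) / m) = (m * g z - n * g (floorPoint m x)) / m := by
      field_simp
    rw [e1, abs_div, abs_of_pos hm', div_le_iff₀ hm']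
    refine h3.trans (le_of_eq ?_)
    field_simp
  choose N hN using hex
  have hbig : ∀ a b K : ℝ, (∀ n : ℕ, n * a ≤ n * b + K) → a ≤ b := by
    intro a b K h
    by_contra hab
    push Not at hab
    obtain ⟨n, hn⟩ := exists_nat_gt (K / (a - b))
    rw [div_lt_iff₀ (sub_pos.2 hab)] at hn
    linarith [h n]
  have hNf : ∀ (n : ℕ) x, |g (floorPoint n x) - n * N x| ≤ C * d := fun n x =>
    (hN x n _).trans (mul_le_mul_of_nonneg_left (sum_abs_floorPoint_sub_le n x) hC0)
  have hNadd : ∀ x y, N (x + y) ≤ N x + N y := by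
    intro x y
    refine hbig _ _ (4 * (C * d)) fun n => ?_
    have h1 := abs_le.1 (hNf n x)
    have h2 := abs_le.1 (hNf n y)
    have h3 := abs_le.1 (hN (x + y) n (floorPoint n x + floorPoint n y))
    have h4 : ∑ i, |(((floorPoint n x + floorPoint n y) i : ℤ) : ℝ) - n * (x + y) i| ≤
        (d : ℝ) + d := by
      refine le_trans (Finset.sum_le_sum fun i _ => ?_) ((Finset.sum_add_distrib (s := Finset.univ)
        (f := fun i => |(floorPoint n x i : ℝ) - n * x i|)
        (g := fun i => |(floorPoint n y i : ℝ) - n * y i|)).le.trans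
        (add_le_add (sum_abs_floorPoint_sub_le n x) (sum_abs_floorPoint_sub_le n y)))
      refine le_trans (le_of_eq ?_) (abs_add_le _ _)
      congr 1
      simp; ring
    have h5 := mul_le_mul_of_nonneg_left h4 hC0
    have h6 := hadd (floorPoint n x) (floorPoint n y)
    rw [mul_add]
    linarith [h1.1, h1.2, h2.1, h2.2, h3.1, h3.2]
  have hNneg : ∀ x, N (-x) ≤ N x := by
    intro x
    refine hbig _ _ (2 * (C * d)) fun n => ?_
    have h1 := abs_le.1 (hNf n x)
    have h3 := abs_le.1 (hN (-x) n (-floorPoint n x))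
    have h4 : ∑ i, |(((-floorPoint n x) i : ℤ) : ℝ) - n * (-x) i| ≤ (d : ℝ) := by
      refine le_trans (le_of_eq (Finset.sum_congr rfl fun i _ => ?_))
        (sum_abs_floorPoint_sub_le n x)
      rw [← abs_neg]
      congr 1
      simp; ring
    have h5 := mul_le_mul_of_nonneg_left h4 hC0
    rw [hneg] at h3
    linarith [h1.1, h1.2, h3.1, h3.2]
  have hNneg' : ∀ x, N (-x) = N x := fun x => le_antisymm (hNneg x) (by simpa using hNneg (-x))
  have hNpos : ∀ (r : ℝ) x, 0 ≤ r → N (r • x) = r * N x := by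
    intro r x hr
    have key : ∀ n : ℕ, |n * N (r • x) - n * (r * N x)| ≤
        C * (d + ∑ i, |x i|) + C * d + |N x| := by
      intro n
      set m := ⌊n * r⌋₊ with hm
      have hm1 : (m : ℝ) ≤ n * r := Nat.floor_le (by positivity)
      have hm2 : n * r < m + 1 := Nat.lt_floor_add_one _
      have h1 := hNf m x
      have h2 : |g (floorPoint m x) - n * N (r • x)| ≤ C * (d + ∑ i, |x i|) := by
        refine (hN (r • x) n _).trans (mul_le_mul_of_nonneg_left ?_ hC0)
        refine le_trans ?_ (add_le_add (sum_abs_floorPoint_sub_le m x) le_rfl)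
        rw [← Finset.sum_add_distrib]
        refine Finset.sum_le_sum fun i _ => ?_
        have e : (floorPoint m x i : ℝ) - n * (r • x) i =
            ((floorPoint m x i : ℝ) - m * x i) - (n * r - m) * x i := by
          simp; ring
        rw [e]
        refine (abs_sub _ _).trans (add_le_add le_rfl ?_)
        rw [abs_mul]
        refine mul_le_of_le_one_left (abs_nonneg _) ?_
        rw [abs_le]; constructor <;> linarith
      have h3 : |(n * r - m) * N x| ≤ |N x| := by
        rw [abs_mul]
        refine mul_le_of_le_one_left (abs_nonneg _) ?_
        rw [abs_le]; constructor <;> linarith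
      have h1' := abs_le.1 h1
      have h2' := abs_le.1 h2
      have h3' := abs_le.1 h3
      rw [abs_le]
      constructor <;> linarith [h1'.1, h1'.2, h2'.1, h2'.2, h3'.1, h3'.2]
    exact le_antisymm (hbig _ _ (C * (d + ∑ i, |x i|) + C * d + |N x|) fun n => by
        linarith [(abs_le.1 (key n)).2])
      (hbig _ _ (C * (d + ∑ i, |x i|) + C * d + |N x|) fun n => by
        linarith [(abs_le.1 (key n)).1])
  refine ⟨Seminorm.of N hNadd fun r x => ?_, fun z => ?_⟩
  · rcases le_total 0 r with hr | hr
    · rw [hNpos r x hr, Real.norm_of_nonneg hr]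
    · rw [Real.norm_of_nonpos hr, ← hNpos (-r) x (by linarith), neg_smul, hNneg']
  · have := hN (latticePoint z) 1 z
    simp only [latticePoint_apply, Nat.cast_one, one_mul, sub_self, abs_zero, Finset.sum_const_zero,
      mul_zero] at this
    have h := abs_nonpos_iff.1 this
    change N (latticePoint z) = g z
    linarith

/-- The norm obtained from a subadditive function on the lattice by homogenization. -/
theorem exists_homogenized_seminorm {f : Site d → ℝ} (h0 : ∀ z, 0 ≤ f z)
    (hadd : ∀ z w, f (z + w) ≤ f z + f w) (hneg : ∀ z, f (-z) = f z) :
    ∃ N : Seminorm ℝ (EuclideanSpace ℝ (Fin d)),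
      (∀ ℓ : Site d, Tendsto (fun k : ℕ => f (k • ℓ) / k) atTop (𝓝 (N (latticePoint ℓ)))) ∧
      ∀ z, N (latticePoint z) ≤ f z := by
  have hsub : ∀ z, Subadditive fun k : ℕ => f (k • z) := fun z m n => by
    simp only [add_smul]; exact hadd _ _
  have hbdd : ∀ z, BddBelow (Set.range fun n : ℕ => f (n • z) / n) := fun z =>
    ⟨0, by rintro _ ⟨n, rfl⟩; exact div_nonneg (h0 _) (Nat.cast_nonneg n)⟩
  have ht : ∀ z, Tendsto (fun k : ℕ => f (k • z) / k) atTop (𝓝 (hsub z).lim) :=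
    fun z => (hsub z).tendsto_lim (hbdd z)
  have hadd' : ∀ z w, (hsub (z + w)).lim ≤ (hsub z).lim + (hsub w).lim := by
    intro z w
    refine le_of_tendsto_of_tendsto' (ht (z + w)) ((ht z).add (ht w)) fun k => ?_
    rw [← add_div, smul_add]
    exact div_le_div_of_nonneg_right (hadd _ _) (Nat.cast_nonneg k)
  have hneg' : ∀ z, (hsub (-z)).lim = (hsub z).lim := by
    intro z
    refine tendsto_nhds_unique (ht (-z)) ((ht z).congr fun k => ?_)
    rw [smul_neg, hneg]
  have hsmul' : ∀ (n : ℕ) z, (hsub (n • z)).lim = n * (hsub z).lim := by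
    intro n z
    rcases Nat.eq_zero_or_pos n with rfl | hn
    · refine tendsto_nhds_unique (ht _) ?_
      simpa using tendsto_const_div_atTop_nhds_zero_nat (f 0)
    · refine tendsto_nhds_unique (ht (n • z)) ?_
      have h1 : Tendsto (fun k : ℕ => k * n) atTop atTop :=
        tendsto_id.atTop_mul_const' hn
      have h2 := ((ht z).comp h1).const_mul (n : ℝ)
      refine h2.congr' ?_
      filter_upwards [eventually_gt_atTop 0] with k hk
      have hk' : (k : ℝ) ≠ 0 := Nat.cast_ne_zero.2 hk.ne'
      have hn' : (n : ℝ) ≠ 0 := Nat.cast_ne_zero.2 hn.ne'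
      simp only [Function.comp_apply, mul_smul]
      push_cast
      field_simp
  obtain ⟨N, hN⟩ := exists_seminorm_extension (g := fun z => (hsub z).lim) hadd' hneg' hsmul'
  refine ⟨N, fun ℓ => ?_, fun z => ?_⟩
  · rw [hN]; exact ht ℓ
  · rw [hN]
    simpa using (hsub z).lim_le_div (hbdd z) one_ne_zero

end lattice

/-! ### Expansion over path histories -/

section hist

variable {d : ℕ}

open Classical in
/-- The expectation of `f` at the stopped walk times a functional `Ψ` of the list of the sites it
stepped from, starting at `x` with past `H`. -/
def histExp (D : Set (Site d)) (f : Site d → ℝ) (Ψ : List (Site d) → ℝ) :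
    ℕ → Site d → List (Site d) → ℝ
  | 0, x, H => f x * Ψ H
  | n + 1, x, H => if x ∈ D then f x * Ψ H else
      avg (fun z => histExp D f Ψ n z (x :: H)) x

variable {D : Set (Site d)} {f : Site d → ℝ} {Ψ Ψ' : List (Site d) → ℝ}

lemma histExp_of_mem {x : Site d} (hx : x ∈ D) (n : ℕ) (H : List (Site d)) :
    histExp D f Ψ n x H = f x * Ψ H := by
  cases n <;> simp [histExp, hx]

lemma histExp_succ_of_notMem {x : Site d} (hx : x ∉ D) (n : ℕ) (H : List (Site d)) :
    histExp D f Ψ (n + 1) x H = avg (fun z => histExp D f Ψ n z (x :: H)) x := by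
  simp [histExp, hx]

lemma histExp_mono (hf : ∀ x, 0 ≤ f x) (h : ∀ H, Ψ H ≤ Ψ' H) (n : ℕ) (x : Site d)
    (H : List (Site d)) : histExp D f Ψ n x H ≤ histExp D f Ψ' n x H := by
  induction n generalizing x H with
  | zero => exact mul_le_mul_of_nonneg_left (h H) (hf x)
  | succ n ih =>
    by_cases hx : x ∈ D
    · rw [histExp_of_mem hx, histExp_of_mem hx]
      exact mul_le_mul_of_nonneg_left (h H) (hf x)
    · rw [histExp_succ_of_notMem hx, histExp_succ_of_notMem hx]
      exact avg_mono (fun z => ih z _) x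

lemma histExp_mul_const (c : ℝ) (n : ℕ) (x : Site d) (H : List (Site d)) :
    histExp D f (fun H => Ψ H * c) n x H = histExp D f Ψ n x H * c := by
  induction n generalizing x H with
  | zero => simp only [histExp]; ring
  | succ n ih =>
    by_cases hx : x ∈ D
    · simp only [histExp_of_mem hx]; ring
    · simp only [histExp_succ_of_notMem hx, ih, avg_mul_right]

lemma histExp_add (n : ℕ) (x : Site d) (H : List (Site d)) :
    histExp D f (fun H => Ψ H + Ψ' H) n x H = histExp D f Ψ n x H + histExp D f Ψ' n x H := by
  induction n generalizing x H with
  | zero => simp only [histExp]; ring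
  | succ n ih =>
    by_cases hx : x ∈ D
    · simp only [histExp_of_mem hx]; ring
    · simp only [histExp_succ_of_notMem hx, ih, avg_add]

lemma integrable_histExp {Ω : Type*} [MeasurableSpace Ω] {P : Measure Ω}
    {F : Ω → List (Site d) → ℝ} (hF : ∀ H, Integrable (fun ω => F ω H) P) (n : ℕ) (x : Site d)
    (H : List (Site d)) : Integrable (fun ω => histExp D f (F ω) n x H) P := by
  induction n generalizing x H with
  | zero => exact (hF H).const_mul _
  | succ n ih =>
    by_cases hx : x ∈ D
    · simp only [histExp_of_mem hx]; exact (hF H).const_mul _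
    · simp only [histExp_succ_of_notMem hx, avg]
      exact (integrable_finsetSum _ fun s _ => ih _ _).const_mul _

lemma integral_histExp {Ω : Type*} [MeasurableSpace Ω] {P : Measure Ω}
    {F : Ω → List (Site d) → ℝ} (hF : ∀ H, Integrable (fun ω => F ω H) P) (n : ℕ) (x : Site d)
    (H : List (Site d)) :
    ∫ ω, histExp D f (F ω) n x H ∂P = histExp D f (fun H => ∫ ω, F ω H ∂P) n x H := by
  induction n generalizing x H with
  | zero => simp only [histExp, integral_const_mul]
  | succ n ih =>
    by_cases hx : x ∈ D
    · simp only [histExp_of_mem hx, integral_const_mul]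
    · simp only [histExp_succ_of_notMem hx, avg, integral_const_mul]
      rw [integral_finsetSum _ fun s _ => integrable_histExp hF _ _ _]
      simp only [ih]

/-- The sum of a potential over a list of sites. -/
def histSum (u : Site d → ℝ) (H : List (Site d)) : ℝ := (H.map u).sum

lemma histSum_nil (u : Site d → ℝ) : histSum u [] = 0 := rfl

lemma histSum_cons (u : Site d → ℝ) (x : Site d) (H : List (Site d)) :
    histSum u (x :: H) = u x + histSum u H := by simp [histSum]

lemma histSum_nonneg {u : Site d → ℝ} (hu : ∀ x, 0 ≤ u x) (H : List (Site d)) :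
    0 ≤ histSum u H := by
  induction H with
  | nil => exact le_rfl
  | cons x H ih => rw [histSum_cons]; exact add_nonneg (hu x) ih

lemma kill_mul_exp_histSum (u : Site d → ℝ) (n : ℕ) (x : Site d) (H : List (Site d)) :
    kill D (fun x => Real.exp (-u x)) f n x * Real.exp (-histSum u H) =
      histExp D f (fun H => Real.exp (-histSum u H)) n x H := by
  induction n generalizing x H with
  | zero => rfl
  | succ n ih =>
    by_cases hx : x ∈ D
    · rw [kill_of_mem hx, histExp_of_mem hx]
    · rw [kill_succ_of_notMem hx, histExp_succ_of_notMem hx]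
      simp only [← ih, avg_mul_right, histSum_cons, neg_add, Real.exp_add]
      ring

lemma kill_eq_histExp (u : Site d → ℝ) (n : ℕ) (x : Site d) :
    kill D (fun x => Real.exp (-u x)) f n x =
      histExp D f (fun H => Real.exp (-histSum u H)) n x [] := by
  rw [← kill_mul_exp_histSum, histSum_nil]; simp

lemma greenN_eq_histExp (v : Env d) (n : ℕ) (x : Site d) :
    greenN D v n x = histExp D (D.indicator 1)
      (fun H => Real.exp (-histSum (fun z => (v z : ℝ)) H)) n x [] :=
  kill_eq_histExp (fun z => (v z : ℝ)) n x

end hist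

/-! ### Positive correlations and the annealed cost -/

section annealed

variable {d : ℕ}

lemma integral_mul_integral_le_of_antitone {ν : Measure ℝ≥0} [IsProbabilityMeasure ν]
    {f g : ℝ≥0 → ℝ} (hf : Antitone f) (hg : Antitone g) (hfi : Integrable f ν)
    (hgi : Integrable g ν) (hfg : Integrable (fun t => f t * g t) ν) :
    (∫ t, f t ∂ν) * ∫ t, g t ∂ν ≤ ∫ t, f t * g t ∂ν := by
  have h1 : ∀ t, 0 ≤ ∫ s, f s * g s ∂ν - f t * ∫ s, g s ∂ν - (∫ s, f s ∂ν) * g t + f t * g t := by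
    intro t
    have h : ∫ s, (f s - f t) * (g s - g t) ∂ν =
        ∫ s, f s * g s ∂ν - f t * ∫ s, g s ∂ν - (∫ s, f s ∂ν) * g t + f t * g t := by
      have e : ∀ s, (f s - f t) * (g s - g t) = f s * g s - f t * g s - f s * g t + f t * g t :=
        fun s => by ring
      simp only [e]
      have i1 : Integrable (fun s => f s * g s - f t * g s) ν := hfg.sub (hgi.const_mul _)
      have i2 : Integrable (fun s => f s * g s - f t * g s - f s * g t) ν :=
        i1.sub (hfi.mul_const _)
      rw [integral_add i2 (integrable_const _), integral_sub i1 (hfi.mul_const _),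
        integral_sub hfg (hgi.const_mul _), integral_const_mul, integral_mul_const]
      simp
    rw [← h]
    refine integral_nonneg fun s => ?_
    rcases le_total s t with hst | hst
    · exact mul_nonneg (sub_nonneg.2 (hf hst)) (sub_nonneg.2 (hg hst))
    · exact mul_nonneg_of_nonpos_of_nonpos (sub_nonpos.2 (hf hst)) (sub_nonpos.2 (hg hst))
  have h2 := integral_nonneg (μ := ν) (f := fun t => ∫ s, f s * g s ∂ν - f t * ∫ s, g s ∂ν
    - (∫ s, f s ∂ν) * g t + f t * g t) h1
  have i1 : Integrable (fun t => ∫ s, f s * g s ∂ν - f t * ∫ s, g s ∂ν) ν :=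
    (integrable_const _).sub (hfi.mul_const _)
  have i2 : Integrable (fun t => ∫ s, f s * g s ∂ν - f t * ∫ s, g s ∂ν
      - (∫ s, f s ∂ν) * g t) ν := i1.sub (hgi.const_mul _)
  rw [integral_add i2 hfg, integral_sub i1 (hgi.const_mul _),
    integral_sub (integrable_const _) (hfi.mul_const _), integral_const_mul, integral_mul_const]
    at h2
  simp at h2
  linarith

lemma integrable_of_mem_Icc {Ω : Type*} [MeasurableSpace Ω] {P : Measure Ω} [IsFiniteMeasure P]
    {f : Ω → ℝ} (hf : Measurable f) (h0 : ∀ ω, 0 ≤ f ω) (h1 : ∀ ω, f ω ≤ 1) : Integrable f P :=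
  Integrable.of_bound hf.aestronglyMeasurable 1 (Eventually.of_forall fun ω => by
    rw [Real.norm_of_nonneg (h0 ω)]; exact h1 ω)

variable (ν : Measure ℝ≥0) [IsProbabilityMeasure ν]

lemma integral_prod_eval (s : Finset (Site d)) (g : Site d → ℝ≥0 → ℝ)
    (hg : ∀ x, Measurable (g x)) :
    ∫ v, ∏ x ∈ s, g x (v x) ∂(envLaw d ν) = ∏ x ∈ s, ∫ t, g x t ∂ν := by
  have h1 : ∀ v : Env d, ∏ x ∈ s, g x (v x) =
      (fun y : (s → ℝ≥0) => ∏ x : s, g x (y x)) (s.restrict v) := fun v =>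
    (Finset.prod_coe_sort s fun x => g x (v x)).symm
  have hm : Measurable fun y : (s → ℝ≥0) => ∏ x : s, g x (y x) :=
    Finset.measurable_prod _ fun x _ => (hg x).comp (measurable_pi_apply x)
  have h2 := integral_restrict_infinitePi (μ := fun _ : Site d => ν) (s := s)
    (f := fun y : (s → ℝ≥0) => ∏ x : s, g x (y x)) hm.aestronglyMeasurable
  rw [envLaw, integral_congr_ae (Eventually.of_forall h1)]
  refine h2.trans ?_
  rw [integral_fintype_prod_eq_prod (fun x : s => g x)]
  exact Finset.prod_coe_sort s fun x => ∫ t, g x t ∂ν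

lemma measurable_histSum (H : List (Site d)) :
    Measurable fun v : Env d => histSum (fun z => (v z : ℝ)) H := by
  induction H with
  | nil => simp only [histSum_nil]; exact measurable_const
  | cons x H ih => simp only [histSum_cons]; exact Measurable.add (by fun_prop) ih

lemma integrable_exp_histSum (H : List (Site d)) :
    Integrable (fun v : Env d => Real.exp (-histSum (fun z => (v z : ℝ)) H)) (envLaw d ν) :=
  integrable_of_mem_Icc (Real.measurable_exp.comp (measurable_histSum H).neg)
    (fun _ => (Real.exp_pos _).le)
    (fun v => Real.exp_le_one_iff.2 (neg_nonpos.2 (histSum_nonneg (fun z => (v z).2) H)))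

lemma exp_histSum_eq_prod (v : Env d) {H : List (Site d)} {s : Finset (Site d)}
    (hs : ∀ x ∈ H, x ∈ s) :
    Real.exp (-histSum (fun z => (v z : ℝ)) H) =
      ∏ x ∈ s, Real.exp (-(H.count x * (v x : ℝ))) := by
  rw [← Real.exp_sum, Finset.sum_neg_distrib]
  congr 2
  rw [histSum, Finset.sum_list_map_count]
  simp only [nsmul_eq_mul]
  refine Finset.sum_subset (fun x hx => hs x (List.mem_toFinset.1 hx)) fun x _ hx => ?_
  rw [List.mem_toFinset] at hx
  rw [List.count_eq_zero.2 hx]; simp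

lemma integral_exp_histSum_append_le (H H' : List (Site d)) :
    (∫ v : Env d, Real.exp (-histSum (fun z => (v z : ℝ)) H) ∂(envLaw d ν)) *
        ∫ v : Env d, Real.exp (-histSum (fun z => (v z : ℝ)) H') ∂(envLaw d ν) ≤
      ∫ v : Env d, Real.exp (-histSum (fun z => (v z : ℝ)) H) *
        Real.exp (-histSum (fun z => (v z : ℝ)) H') ∂(envLaw d ν) := by
  set s : Finset (Site d) := (H ++ H').toFinset
  have hs : ∀ x ∈ H, x ∈ s := fun x hx => by simp [s, hx]
  have hs' : ∀ x ∈ H', x ∈ s := fun x hx => by simp [s, hx]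
  simp only [fun v => exp_histSum_eq_prod v hs, fun v => exp_histSum_eq_prod v hs',
    ← Finset.prod_mul_distrib]
  have hm : ∀ k : ℕ, Measurable fun t : ℝ≥0 => Real.exp (-(k * (t : ℝ))) := fun k => by fun_prop
  have hi : ∀ k : ℕ, Integrable (fun t : ℝ≥0 => Real.exp (-(k * (t : ℝ)))) ν := fun k =>
    integrable_of_mem_Icc (hm k) (fun _ => (Real.exp_pos _).le)
      (fun t => Real.exp_le_one_iff.2 (neg_nonpos.2 (by positivity)))
  have ha : ∀ k : ℕ, Antitone fun t : ℝ≥0 => Real.exp (-(k * (t : ℝ))) := fun k s t hst =>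
    Real.exp_le_exp.2 (neg_le_neg (mul_le_mul_of_nonneg_left (by exact_mod_cast hst)
      (Nat.cast_nonneg k)))
  rw [integral_prod_eval ν s (fun x t => Real.exp (-(H.count x * (t : ℝ)))) fun x => hm _,
    integral_prod_eval ν s (fun x t => Real.exp (-(H'.count x * (t : ℝ)))) fun x => hm _,
    integral_prod_eval ν s (fun x t => Real.exp (-(H.count x * (t : ℝ))) *
      Real.exp (-(H'.count x * (t : ℝ)))) fun x => (hm _).mul (hm _), ← Finset.prod_mul_distrib]
  refine Finset.prod_le_prod (fun x _ => mul_nonneg (integral_nonneg fun _ => (Real.exp_pos _).le)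
    (integral_nonneg fun _ => (Real.exp_pos _).le)) fun x _ => ?_
  refine integral_mul_integral_le_of_antitone (ha _) (ha _) (hi _) (hi _) ?_
  have := hi (H.count x + H'.count x)
  refine this.congr (Eventually.of_forall fun t => ?_)
  simp only [← Real.exp_add]
  congr 1
  push_cast; ring

lemma integral_greenN_mul_le {D D' : Set (Site d)} (n : ℕ) (x y : Site d) :
    (∫ v, greenN D v n x ∂(envLaw d ν)) * ∫ v, greenN D' v n y ∂(envLaw d ν) ≤
      ∫ v, greenN D v n x * greenN D' v n y ∂(envLaw d ν) := by
  simp only [greenN_eq_histExp, ← histExp_mul_const]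
  have hF := integrable_exp_histSum (d := d) ν
  have hprod : ∀ H H' : List (Site d), Integrable (fun v : Env d =>
      Real.exp (-histSum (fun z => (v z : ℝ)) H') * Real.exp (-histSum (fun z => (v z : ℝ)) H))
      (envLaw d ν) := fun H H' => by
    refine (hF (H' ++ H)).congr (Eventually.of_forall fun v => ?_)
    simp only [← Real.exp_add, histSum, List.map_append, List.sum_append]
    congr 1; ring
  have e : ∀ (v : Env d) (H : List (Site d)),
      Real.exp (-histSum (fun z => (v z : ℝ)) H) * histExp D' (D'.indicator 1)
        (fun H => Real.exp (-histSum (fun z => (v z : ℝ)) H)) n y [] =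
      histExp D' (D'.indicator 1) (fun H' => Real.exp (-histSum (fun z => (v z : ℝ)) H') *
        Real.exp (-histSum (fun z => (v z : ℝ)) H)) n y [] := fun v H => by
    rw [histExp_mul_const, mul_comm]
  simp only [e]
  rw [integral_histExp hF, integral_histExp hF, integral_histExp
    (fun H => integrable_histExp (hprod H) n y []), ← histExp_mul_const]
  refine histExp_mono indicator_one_nonneg (fun H => ?_) n x []
  rw [integral_histExp (hprod H), mul_comm, ← histExp_mul_const]
  exact histExp_mono indicator_one_nonneg (fun H' => integral_exp_histSum_append_le ν H' H) n y []

variable [NeZero d]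

lemma integrable_green (D : Set (Site d)) (x : Site d) :
    Integrable (fun v => green D v x) (envLaw d ν) :=
  integrable_of_mem_Icc (measurable_green D x) (fun _ => green_nonneg x)
    (fun _ => green_le_one x)

lemma tendsto_integral_greenN (D : Set (Site d)) (x : Site d) :
    Tendsto (fun n => ∫ v, greenN D v n x ∂(envLaw d ν)) atTop
      (𝓝 (∫ v, green D v x ∂(envLaw d ν))) :=
  tendsto_integral_of_dominated_convergence (fun _ => 1)
    (fun n => (measurable_greenN D n x).aestronglyMeasurable) (integrable_const 1)
    (fun n => Eventually.of_forall fun v => by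
      rw [Real.norm_of_nonneg (greenN_nonneg n x)]; exact greenN_le_one n x)
    (Eventually.of_forall fun v => tendsto_greenN x)

/-- The annealed passage probability. -/
def annealed (ν : Measure ℝ≥0) (y : Site d) : ℝ := ∫ v, green {y} v 0 ∂(envLaw d ν)

lemma annealed_pos (y : Site d) : 0 < annealed ν y := by
  rw [annealed, integral_pos_iff_support_of_nonneg (fun v => green_nonneg 0)
    (integrable_green ν {y} 0)]
  have : Function.support (fun v : Env d => green {y} v 0) = Set.univ :=
    Set.eq_univ_of_forall fun v => (green_pos 0 y v).ne'
  rw [this]; simp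

lemma annealed_le_one (y : Site d) : annealed ν y ≤ 1 := by
  have := integral_mono (integrable_green ν {y} 0) (integrable_const 1)
    (fun v => green_le_one (D := {y}) (v := v) 0)
  simpa [annealed] using this

lemma annealed_mul_le (z w : Site d) :
    annealed ν z * annealed ν w ≤ annealed ν (z + w) := by
  have hw : annealed ν w = ∫ v, green {z + w} v z ∂(envLaw d ν) := by
    rw [annealed, ← (measurePreserving_shiftEnv ν z).map_eq]
    rw [integral_map (measurable_shiftEnv z).aemeasurable
      (measurable_green _ _).aestronglyMeasurable]
    simp only [green_shiftEnv_zero]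
    rw [(measurePreserving_shiftEnv ν z).map_eq]
  rw [hw]
  refine le_of_tendsto ((tendsto_integral_greenN ν {z} 0).mul
    (tendsto_integral_greenN ν {z + w} z)) (Eventually.of_forall fun n => ?_)
  refine (integral_greenN_mul_le ν n 0 z).trans ?_
  refine integral_mono_of_nonneg (Eventually.of_forall fun v =>
    mul_nonneg (greenN_nonneg _ _) (greenN_nonneg _ _)) (integrable_green ν _ _)
    (Eventually.of_forall fun v => ?_)
  exact (mul_le_mul (greenN_le_green n 0) (greenN_le_green n z) (greenN_nonneg _ _)
    (green_nonneg _)).trans (green_mul_green_le 0 z)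

lemma annealed_neg (y : Site d) : annealed ν (-y) = annealed ν y := by
  rw [annealed, annealed]
  conv_rhs => rw [← (measurePreserving_comp_equiv ν (Equiv.neg (Site d))).map_eq]
  rw [integral_map (measurePreserving_comp_equiv ν (Equiv.neg (Site d))).measurable.aemeasurable
    (measurable_green _ _).aestronglyMeasurable]
  simp only [Equiv.neg_apply, green_neg]

/-- The annealed cost `-ln 𝔼[e(0, y, V)]`. -/
def annealedCost (ν : Measure ℝ≥0) (y : Site d) : ℝ := -Real.log (annealed ν y)

lemma annealedCost_nonneg (y : Site d) : 0 ≤ annealedCost ν y :=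
  neg_nonneg.2 (Real.log_nonpos (annealed_pos ν y).le (annealed_le_one ν y))

lemma annealedCost_add_le (z w : Site d) :
    annealedCost ν (z + w) ≤ annealedCost ν z + annealedCost ν w := by
  have h := Real.log_le_log (mul_pos (annealed_pos ν z) (annealed_pos ν w)) (annealed_mul_le ν z w)
  rw [Real.log_mul (annealed_pos ν z).ne' (annealed_pos ν w).ne'] at h
  simp only [annealedCost]; linarith

lemma annealedCost_neg (y : Site d) : annealedCost ν (-y) = annealedCost ν y := by
  rw [annealedCost, annealed_neg, annealedCost]

/-- The annealed cost is at most the mean quenched cost. -/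
lemma annealedCost_le_meanCost {ν : Measure ℝ≥0} [IsProbabilityMeasure ν]
    (hν : Integrable (fun t : ℝ≥0 => (t : ℝ)) ν) (y : Site d) :
    annealedCost ν y ≤ meanCost ν y := by
  have hq := annealed_pos ν y
  have h : ∀ v : Env d, annealedCost ν y + (1 - green {y} v 0 / annealed ν y) ≤ cost 0 y v := by
    intro v
    have h1 := Real.log_le_sub_one_of_pos (div_pos (green_pos 0 y v) hq)
    rw [Real.log_div (green_pos 0 y v).ne' hq.ne'] at h1
    simp only [annealedCost, cost]; linarith
  have hi : Integrable (fun v => 1 - green {y} v 0 / annealed ν y) (envLaw d ν) :=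
    (integrable_const 1).sub ((integrable_green ν {y} 0).div_const _)
  have h2 := integral_mono ((integrable_const (annealedCost ν y)).add hi) (integrable_cost hν 0 y) h
  rw [integral_add' (integrable_const _) hi, integral_sub (integrable_const _)
    ((integrable_green ν {y} 0).div_const _), integral_div] at h2
  change _ ≤ meanCost ν y at h2
  rw [show ∫ v, green {y} v 0 ∂(envLaw d ν) = annealed ν y from rfl, div_self hq.ne'] at h2
  simpa using h2

end annealed

/-! ### Decoupling across slabs -/

section slab

variable {d : ℕ}

lemma integrable_kill {Ω : Type*} [MeasurableSpace Ω] {P : Measure Ω} {D : Set (Site d)}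
    {w : Site d → ℝ} {F : Ω → Site d → ℝ} (hF : ∀ x, Integrable (fun ω => F ω x) P) (n : ℕ)
    (x : Site d) : Integrable (fun ω => kill D w (F ω) n x) P := by
  induction n generalizing x with
  | zero => exact hF x
  | succ n ih =>
    by_cases hx : x ∈ D
    · simp only [kill_of_mem hx]; exact hF x
    · simp only [kill_succ_of_notMem hx, avg]
      exact ((integrable_finsetSum _ fun s _ => ih _).const_mul _).const_mul _

lemma integral_kill {Ω : Type*} [MeasurableSpace Ω] {P : Measure Ω} {D : Set (Site d)}
    {w : Site d → ℝ} {F : Ω → Site d → ℝ} (hF : ∀ x, Integrable (fun ω => F ω x) P) (n : ℕ)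
    (x : Site d) : ∫ ω, kill D w (F ω) n x ∂P = kill D w (fun z => ∫ ω, F ω z ∂P) n x := by
  induction n generalizing x with
  | zero => rfl
  | succ n ih =>
    by_cases hx : x ∈ D
    · simp only [kill_of_mem hx]
    · simp only [kill_succ_of_notMem hx, avg, integral_const_mul]
      rw [integral_finsetSum _ fun s _ => integrable_kill hF _ _]
      simp only [ih]

/-- The points of height at least `a`. -/
def upper (h : Site d → ℝ) (a : ℝ) : Set (Site d) := {x | a ≤ h x}

lemma mem_upper {h : Site d → ℝ} {a : ℝ} {x : Site d} : x ∈ upper h a ↔ a ≤ h x := Iff.rfl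

lemma upper_anti (h : Site d → ℝ) {a b : ℝ} (hab : a ≤ b) : upper h b ⊆ upper h a :=
  fun _ hx => hab.trans hx

lemma kill_upper_le {h : Site d → ℝ} (hstep : ∀ x s, h (x + stepVec s) ≤ h x + 1) {b c : ℝ}
    {w f g : Site d → ℝ} (hw : ∀ x, 0 ≤ w x) (hfg : ∀ x, h x ≤ b + 1 → f x ≤ c * g x) (n : ℕ)
    {x : Site d} (hx : h x ≤ b + 1) :
    kill (upper h b) w f n x ≤ c * kill (upper h b) w g n x := by
  induction n generalizing x with
  | zero => exact hfg x hx
  | succ n ih =>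
    by_cases hxD : x ∈ upper h b
    · rw [kill_of_mem hxD, kill_of_mem hxD]; exact hfg x hx
    · rw [kill_succ_of_notMem hxD, kill_succ_of_notMem hxD, mul_left_comm,
        ← avg_mul_left c]
      refine mul_le_mul_of_nonneg_left (avg_mono_at (f := kill (upper h b) w f n)
        (g := fun z => c * kill (upper h b) w g n z) fun s => ih ?_) (hw x)
      rw [mem_upper, not_le] at hxD
      linarith [hstep x s]

variable [NeZero d]

lemma greenN_le_kill {D E : Set (Site d)} (hDE : D ⊆ E) {v v' : Env d} (hv : ∀ x, v' x ≤ v x)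
    (n : ℕ) (x : Site d) :
    greenN D v n x ≤ kill E (wt v) (E.indicator (green D v')) n x := by
  have hf0 : ∀ x, 0 ≤ E.indicator (green D v') x :=
    fun x => Set.indicator_nonneg (fun y _ => green_nonneg y) x
  have hfle : ∀ x, E.indicator (green D v') x ≤ green D v' x :=
    fun x => Set.indicator_le_self' (fun _ _ => green_nonneg _) x
  have hle : ∀ n x, kill E (wt v) (E.indicator (green D v')) n x ≤ green D v' x := by
    refine kill_le_of_super (U := fun _ => green D v') (wt_nonneg v) hfle (fun _ x _ => hfle x)
      (fun _ x hx => ?_)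
    rw [green_of_notMem (fun h => hx (hDE h))]
    exact mul_le_mul_of_nonneg_right (wt_anti (hv x)) (avg_nonneg green_nonneg x)
  have hD : ∀ x ∈ D, E.indicator (green D v') x = 1 := fun x hx => by
    rw [Set.indicator_of_mem (hDE hx), green_of_mem hx]
  refine kill_le_of_super (U := kill E (wt v) (E.indicator (green D v'))) (wt_nonneg v)
    (fun x => ?_) (fun n x hx => ?_) (fun n x hx => ?_) n x
  · rw [kill_zero]
    by_cases hx : x ∈ D
    · rw [hD x hx]; simp [hx]
    · simpa [hx] using hf0 x
  · rw [kill_of_mem (hDE hx), hD x hx]; simp [hx]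
  · by_cases hxE : x ∈ E
    · rw [kill_of_mem hxE, Set.indicator_of_mem hxE, green_of_notMem hx]
      exact mul_le_mul (wt_anti (hv x)) (avg_mono (hle n) x)
        (avg_nonneg (kill_nonneg (wt_nonneg v) hf0 n) x) (wt_nonneg _ x)
    · rw [kill_succ_of_notMem hxE]

lemma integrable_green_comp (ν : Measure ℝ≥0) [IsProbabilityMeasure ν] (D : Set (Site d))
    (x : Site d) {φ : Env d → Env d} (hφ : Measurable φ) :
    Integrable (fun v => green D (φ v) x) (envLaw d ν) :=
  integrable_of_mem_Icc ((measurable_green D x).comp hφ) (fun _ => green_nonneg x)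
    (fun _ => green_le_one x)

lemma measurable_indicatorEnv (S : Set (Site d)) : Measurable fun v : Env d => S.indicator v := by
  classical
  refine measurable_pi_iff.2 fun x => ?_
  by_cases hx : x ∈ S <;> simp only [hx, Set.indicator_of_mem, Set.indicator_of_notMem,
    not_false_eq_true] <;> fun_prop

/-- If crossing one slab of width `r` has annealed probability at most `ρ`, then crossing `k`
consecutive slabs has annealed probability at most `ρ ^ k`. -/
theorem integral_green_slabs_le (ν : Measure ℝ≥0) [IsProbabilityMeasure ν] {h : Site d → ℝ}
    (hstep : ∀ x s, h (x + stepVec s) ≤ h x + 1) {r ρ : ℝ} (hr : 0 ≤ r) (hρ0 : 0 ≤ ρ)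
    (hρ : ∀ a x, a ≤ h x → h x ≤ a + 1 →
      ∫ v, green (upper h (a + r)) ((upper h a).indicator v) x ∂(envLaw d ν) ≤ ρ)
    (k : ℕ) (a : ℝ) (x : Site d) (hax : a ≤ h x) (hxa : h x ≤ a + 1) :
    ∫ v, green (upper h (a + k * r)) ((upper h a).indicator v) x ∂(envLaw d ν) ≤ ρ ^ k := by
  induction k generalizing a x with
  | zero =>
    have : x ∈ upper h (a + (0 : ℕ) * r) := by simpa [mem_upper] using hax
    simp only [green_of_mem this]
    simp
  | succ k ih =>
    set D := upper h (a + (k + 1 : ℕ) * r) with hDdef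
    set E := upper h (a + r) with hEdef
    have hDE : D ⊆ E := upper_anti h (by push_cast; nlinarith [Nat.cast_nonneg (α := ℝ) k])
    have hDeq : D = upper h (a + r + k * r) := by rw [hDdef]; congr 1; push_cast; ring
    set f : Env d → Site d → ℝ := fun v => E.indicator (green D (E.indicator v)) with hf
    have hfm : ∀ z, Measurable fun v => f v z := fun z => by
      by_cases hz : z ∈ E
      · simp only [hf, Set.indicator_of_mem hz]
        exact (measurable_green D z).comp (measurable_indicatorEnv E)
      · simp only [hf, Set.indicator_of_notMem hz]; exact measurable_const
    have hf0 : ∀ v z, 0 ≤ f v z := fun v z => Set.indicator_nonneg (fun y _ => green_nonneg y) z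
    have hf1 : ∀ v z, f v z ≤ 1 := fun v z =>
      (Set.indicator_le_self' (fun _ _ => green_nonneg _) z).trans (green_le_one z)
    have hfi : ∀ z, Integrable (fun v => f v z) (envLaw d ν) := fun z =>
      integrable_of_mem_Icc (hfm z) (fun v => hf0 v z) (fun v => hf1 v z)
    set G : Env d → Env d → ℕ → ℝ := fun v v' n =>
      kill E (wt ((upper h a).indicator v')) (f v) n x with hG
    have hGm : ∀ n, Measurable fun p : Env d × Env d => G p.1 p.2 n := by
      intro n
      have : ∀ z, Measurable fun p : Env d × Env d =>
          kill E (wt ((upper h a).indicator p.2)) (f p.1) n z := by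
        induction n with
        | zero => exact fun z => (hfm z).comp measurable_fst
        | succ n ihn =>
          intro z
          by_cases hz : z ∈ E
          · simp only [kill_of_mem hz]; exact (hfm z).comp measurable_fst
          · simp only [kill_succ_of_notMem hz, avg]
            exact (((measurable_wt z).comp (measurable_indicatorEnv _)).comp measurable_snd).mul
              ((Finset.measurable_sum _ fun s _ => ihn _).const_mul _)
      exact this x
    have hG0 : ∀ v v' n, 0 ≤ G v v' n := fun v v' n => kill_nonneg (wt_nonneg _) (hf0 v) n x
    have hG1 : ∀ v v' n, G v v' n ≤ 1 := fun v v' n =>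
      kill_le_one (wt_nonneg _) (wt_le_one _) (hf1 v) n x
    have hGmix : ∀ v v' n, G (mixEnv E v v') (mixEnv E v v') n = G v v' n := by
      intro v v' n
      have e1 : f (mixEnv E v v') = f v := by
        simp only [hf]
        congr 2
        funext z
        by_cases hz : z ∈ E <;> simp [hz, mixEnv]
      simp only [hG, e1]
      refine kill_congr (fun z hz => ?_) n x
      simp only [wt, Set.indicator, mixEnv, hz, if_false]
    have hstep1 : ∀ n, ∫ v, greenN D ((upper h a).indicator v) n x ∂(envLaw d ν) ≤ ρ ^ (k + 1) := by
      intro n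
      have hb1 : ∫ v, greenN D ((upper h a).indicator v) n x ∂(envLaw d ν) ≤
          ∫ v, G v v n ∂(envLaw d ν) := by
        refine integral_mono_of_nonneg (Eventually.of_forall fun v => greenN_nonneg n x)
          (integrable_of_mem_Icc ((hGm n).comp (measurable_id.prodMk measurable_id))
            (fun v => hG0 v v n) (fun v => hG1 v v n)) (Eventually.of_forall fun v => ?_)
        refine greenN_le_kill hDE (fun z => ?_) n x
        exact Set.indicator_le_indicator_of_subset (upper_anti h (by linarith))
          (fun _ => zero_le) z
      have hb2 : ∫ v, G v v n ∂(envLaw d ν) = ∫ v', ∫ v, G v v' n ∂(envLaw d ν) ∂(envLaw d ν) := by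
        rw [← integral_prod_symm (fun p : Env d × Env d => G p.1 p.2 n)
          (integrable_of_mem_Icc (hGm n) (fun p => hG0 _ _ n) (fun p => hG1 _ _ n))]
        conv_lhs => rw [← (measurePreserving_mixEnv ν E).map_eq]
        rw [integral_map (f := fun v => G v v n) (measurable_mixEnv E).aemeasurable
          ((hGm n).comp (measurable_id.prodMk measurable_id)).aestronglyMeasurable]
        simp only [hGmix]
      have hb3 : ∀ v', ∫ v, G v v' n ∂(envLaw d ν) ≤
          ρ ^ k * greenN E ((upper h a).indicator v') n x := by
        intro v'
        simp only [hG]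
        rw [integral_kill hfi]
        refine kill_upper_le hstep (wt_nonneg _) (fun z hz => ?_) n (by linarith)
        by_cases hzE : z ∈ E
        · simp only [hf, Set.indicator_of_mem hzE, Pi.one_apply, mul_one]
          rw [hDeq]
          exact ih (a + r) z hzE hz
        · simp [hf, hzE]
      refine hb1.trans (hb2.le.trans ?_)
      have hinteg : Integrable (fun v' => ρ ^ k * greenN E ((upper h a).indicator v') n x)
          (envLaw d ν) := (integrable_of_mem_Icc ((measurable_greenN E n x).comp
            (measurable_indicatorEnv _)) (fun v => greenN_nonneg n x)
            (fun v => greenN_le_one n x)).const_mul _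
      refine (integral_mono_of_nonneg (Eventually.of_forall fun v' =>
        integral_nonneg fun v => hG0 v v' n) hinteg (Eventually.of_forall hb3)).trans ?_
      rw [integral_const_mul, pow_succ]
      refine mul_le_mul_of_nonneg_left (le_trans ?_ (hρ a x hax hxa)) (pow_nonneg hρ0 k)
      exact integral_mono_of_nonneg (Eventually.of_forall fun v => greenN_nonneg n x)
        (integrable_green_comp ν E x (measurable_indicatorEnv _))
        (Eventually.of_forall fun v => greenN_le_green n x)
    have hlim : Tendsto (fun n => ∫ v, greenN D ((upper h a).indicator v) n x ∂(envLaw d ν)) atTop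
        (𝓝 (∫ v, green D ((upper h a).indicator v) x ∂(envLaw d ν))) :=
      tendsto_integral_of_dominated_convergence (fun _ => 1)
        (fun n => ((measurable_greenN D n x).comp
          (measurable_indicatorEnv _)).aestronglyMeasurable) (integrable_const 1)
        (fun n => Eventually.of_forall fun v => by
          rw [Real.norm_of_nonneg (greenN_nonneg n x)]; exact greenN_le_one n x)
        (Eventually.of_forall fun v => tendsto_greenN x)
    exact le_of_tendsto hlim (Eventually.of_forall hstep1)

lemma annealed_le_pow (ν : Measure ℝ≥0) [IsProbabilityMeasure ν] {h : Site d → ℝ} (h0 : h 0 = 0)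
    (hstep : ∀ x s, h (x + stepVec s) ≤ h x + 1) {r ρ : ℝ} (hr : 0 ≤ r) (hρ0 : 0 ≤ ρ)
    (hρ : ∀ a x, a ≤ h x → h x ≤ a + 1 →
      ∫ v, green (upper h (a + r)) ((upper h a).indicator v) x ∂(envLaw d ν) ≤ ρ)
    (k : ℕ) {y : Site d} (hy : k * r ≤ h y) : annealed ν y ≤ ρ ^ k := by
  refine le_trans ?_ (integral_green_slabs_le ν hstep hr hρ0 hρ k 0 0 h0.ge (by simp [h0]))
  refine integral_mono (integrable_green ν _ _)
    (integrable_green_comp ν _ _ (measurable_indicatorEnv _)) fun v => ?_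
  refine (green_mono_set (D' := upper h (0 + k * r)) ?_ 0).trans (green_anti (fun x _ => ?_) 0)
  · simpa [mem_upper] using hy
  · exact Set.indicator_le_self' (fun _ _ => zero_le) x

end slab

/-! ### Almost sure convergence of subadditive processes -/

/-- Covering an interval by good blocks of length at most `N` and bad unit blocks. -/
lemma subadditive_covering {a : ℕ → ℕ → ℝ} (ha0 : ∀ k n, 0 ≤ a k n) (hz : ∀ k, a k 0 = 0)
    (hsub : ∀ k m n, a k (m + n) ≤ a k m + a (k + m) n) {N : ℕ} {K : ℝ} {c : ℕ → ℝ}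
    (hK : 0 ≤ K) (hc : ∀ k, 0 ≤ c k)
    (hgood : ∀ k, (∃ l, 1 ≤ l ∧ l ≤ N ∧ a k l ≤ l * K) ∨ a k 1 ≤ c k) (n k : ℕ) :
    a k n ≤ n * K + ∑ j ∈ Finset.Ico k (k + n), c j +
      ∑ j ∈ Finset.Ico (k + n - N) (k + n), a j 1 := by
  induction n using Nat.strong_induction_on generalizing k with
  | _ n ih =>
    have hunit : ∀ m k, a k m ≤ ∑ j ∈ Finset.Ico k (k + m), a j 1 := by
      intro m
      induction m with
      | zero => intro k; simp [hz]
      | succ m ihm =>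
        intro k
        rw [← add_assoc, Finset.sum_Ico_succ_top (by omega)]
        exact (hsub k m 1).trans (add_le_add (ihm k) le_rfl)
    by_cases hnN : n ≤ N
    · have h1 : ∑ j ∈ Finset.Ico k (k + n), a j 1 ≤
          ∑ j ∈ Finset.Ico (k + n - N) (k + n), a j 1 :=
        Finset.sum_le_sum_of_subset_of_nonneg
          (Finset.Ico_subset_Ico (by omega) le_rfl) (fun _ _ _ => ha0 _ _)
      have h2 : 0 ≤ ∑ j ∈ Finset.Ico k (k + n), c j := Finset.sum_nonneg fun _ _ => hc _
      have h3 : 0 ≤ (n : ℝ) * K := by positivity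
      linarith [hunit n k]
    · push Not at hnN
      have hstep : ∀ l, 1 ≤ l → l ≤ n → a k l ≤ l * K + ∑ j ∈ Finset.Ico k (k + l), c j →
          a k n ≤ n * K + ∑ j ∈ Finset.Ico k (k + n), c j +
            ∑ j ∈ Finset.Ico (k + n - N) (k + n), a j 1 := by
        intro l hl1 hln hl
        have h1 := ih (n - l) (by omega) (k + l)
        have h2 := hsub k l (n - l)
        rw [show k + l + (n - l) = k + n by omega] at h1
        rw [Nat.add_sub_cancel' hln] at h2
        rw [← Finset.sum_Ico_consecutive c (show k ≤ k + l by omega) (show k + l ≤ k + n by omega)]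
        rw [Nat.cast_sub hln] at h1
        linarith
      rcases hgood k with ⟨l, hl1, hlN, hl⟩ | hbad
      · refine hstep l hl1 (by omega) ?_
        have : 0 ≤ ∑ j ∈ Finset.Ico k (k + l), c j := Finset.sum_nonneg fun _ _ => hc _
        linarith
      · refine hstep 1 le_rfl (by omega) ?_
        simp only [Nat.Ico_succ_singleton, Finset.sum_singleton, Nat.cast_one, one_mul]
        linarith

section kingman

variable {Ω : Type*} [MeasurableSpace Ω] {P : Measure Ω} [IsProbabilityMeasure P] {T : Ω → Ω}
  {g : ℕ → Ω → ℝ}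

/-- The lower growth rate of a non-negative process. -/
def lowerRate (g : ℕ → Ω → ℝ) (ω : Ω) : ℝ≥0∞ :=
  liminf (fun n : ℕ => ENNReal.ofReal (g n ω / n)) atTop

lemma measurable_lowerRate (hm : ∀ n, Measurable (g n)) : Measurable (lowerRate g) :=
  Measurable.liminf fun n => ((hm n).div_const _).ennreal_ofReal

lemma lowerRate_le_comp (hg0 : ∀ n ω, 0 ≤ g n ω)
    (hsub : ∀ m n ω, g (m + n) ω ≤ g m ω + g n (T^[m] ω)) (ω : Ω) :
    lowerRate g ω ≤ lowerRate g (T ω) := by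
  have h1 : lowerRate g ω = liminf (fun n : ℕ => ENNReal.ofReal (g (n + 1) ω / ((n + 1 : ℕ) : ℝ)))
      atTop := (liminf_nat_add (fun n : ℕ => ENNReal.ofReal (g n ω / n)) 1).symm
  rw [h1]
  refine ENNReal.le_of_forall_pos_le_add fun ε hε _ => ?_
  have hlim : Tendsto (fun n : ℕ => g 1 ω / n) atTop (𝓝 0) :=
    tendsto_const_div_atTop_nhds_zero_nat _
  have hev : ∀ᶠ n : ℕ in atTop, ENNReal.ofReal (g (n + 1) ω / ((n + 1 : ℕ) : ℝ)) ≤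
      ENNReal.ofReal (g n (T ω) / n) + ε := by
    filter_upwards [hlim.eventually_lt_const (show (0 : ℝ) < ε from hε), eventually_gt_atTop 0]
      with n hn hn0
    have hn' : (0 : ℝ) < n := Nat.cast_pos.2 hn0
    have h2 := hsub 1 n ω
    rw [add_comm 1 n, Function.iterate_one] at h2
    rw [← ENNReal.ofReal_coe_nnreal (p := ε), ← ENNReal.ofReal_add
      (div_nonneg (hg0 _ _) hn'.le) ε.coe_nonneg]
    refine ENNReal.ofReal_le_ofReal ?_
    calc g (n + 1) ω / ((n + 1 : ℕ) : ℝ) ≤ g (n + 1) ω / n :=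
          div_le_div_of_nonneg_left (hg0 _ _) hn' (by push_cast; linarith)
      _ ≤ (g 1 ω + g n (T ω)) / n := div_le_div_of_nonneg_right h2 hn'.le
      _ ≤ g n (T ω) / n + ε := by rw [add_div]; linarith
  calc liminf (fun n : ℕ => ENNReal.ofReal (g (n + 1) ω / ((n + 1 : ℕ) : ℝ))) atTop
      ≤ liminf (fun n : ℕ => ENNReal.ofReal (g n (T ω) / n) + ε) atTop := liminf_le_liminf hev
    _ ≤ lowerRate g (T ω) + ε := by
        rw [lowerRate]
        refine le_of_eq ?_
        have hmono : Monotone fun x : ℝ≥0∞ => x + ε := fun x y h => add_le_add h le_rfl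
        exact (Monotone.map_liminf_of_continuousAt (F := atTop) (f := fun x : ℝ≥0∞ => x + ε) hmono
          (fun n : ℕ => ENNReal.ofReal (g n (T ω) / n))
          (continuous_add_const _).continuousAt).symm

/-- The lower half of the subadditive ergodic theorem. -/
theorem le_integral_lowerRate (hT : MeasurePreserving T P P) (hg0 : ∀ n ω, 0 ≤ g n ω)
    (hz : ∀ ω, g 0 ω = 0) (hm : ∀ n, Measurable (g n)) (hi : ∀ n, Integrable (g n) P)
    (hsub : ∀ m n ω, g (m + n) ω ≤ g m ω + g n (T^[m] ω)) {α : ℝ}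
    (hα : ∀ n : ℕ, n * α ≤ ∫ ω, g n ω ∂P) (hle : ∀ᵐ ω ∂P, lowerRate g ω ≤ ENNReal.ofReal α) :
    α ≤ ∫ ω, (lowerRate g ω).toReal ∂P := by
  set G : Ω → ℝ := fun ω => (lowerRate g ω).toReal with hG
  have hGm : Measurable G := (measurable_lowerRate hm).ennreal_toReal
  have hG0 : ∀ ω, 0 ≤ G ω := fun ω => ENNReal.toReal_nonneg
  have hinv1 : ∀ᵐ ω ∂P, lowerRate g ω = lowerRate g (T ω) := by
    refine ae_eq_of_ae_le_of_lintegral_le (Eventually.of_forall (lowerRate_le_comp hg0 hsub)) ?_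
      ((measurable_lowerRate hm).comp hT.measurable).aemeasurable ?_
    · refine ne_top_of_le_ne_top ?_ (lintegral_mono_ae hle)
      simp
    · exact (hT.lintegral_comp (measurable_lowerRate hm)).le
  have hinv : ∀ᵐ ω ∂P, ∀ k : ℕ, lowerRate g (T^[k] ω) = lowerRate g ω := by
    have : ∀ᵐ ω ∂P, ∀ k : ℕ, lowerRate g (T^[k] ω) = lowerRate g (T (T^[k] ω)) :=
      ae_all_iff.2 fun k => (hT.iterate k).quasiMeasurePreserving.ae hinv1
    filter_upwards [this] with ω hω k
    induction k with
    | zero => rfl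
    | succ k ih => rw [Function.iterate_succ_apply', ← hω k, ih]
  have hGi : Integrable G P := by
    refine Integrable.of_bound hGm.aestronglyMeasurable |α| ?_
    filter_upwards [hle] with ω hω
    rw [Real.norm_of_nonneg (hG0 ω)]
    refine ENNReal.toReal_le_of_le_ofReal (abs_nonneg _) (hω.trans ?_)
    exact ENNReal.ofReal_le_ofReal (le_abs_self α)
  refine le_of_forall_pos_le_add fun ε hε => ?_
  set B : ℕ → Set Ω := fun N => {ω | ∀ l, 1 ≤ l → l ≤ N → l * (G ω + ε) < g l ω} with hB
  have hBm : ∀ N, MeasurableSet (B N) := by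
    intro N
    simp only [hB, Set.ofPred_forall]
    refine MeasurableSet.iInter fun l => MeasurableSet.iInter fun _ => MeasurableSet.iInter fun _ =>
      measurableSet_lt ((hGm.add_const ε).const_mul _) (hm l)
  have hmain : ∀ N n : ℕ, 0 < n → α ≤ ∫ ω, G ω ∂P + ε + ∫ ω, (B N).indicator (g 1) ω ∂P +
      (N * ∫ ω, g 1 ω ∂P) / n := by
    intro N n hn
    have hn' : (0 : ℝ) < n := Nat.cast_pos.2 hn
    have hpt : ∀ᵐ ω ∂P, g n ω ≤ n * (G ω + ε) +
        ∑ j ∈ Finset.Ico 0 (0 + n), (B N).indicator (g 1) (T^[j] ω) +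
        ∑ j ∈ Finset.Ico (0 + n - N) (0 + n), g 1 (T^[j] ω) := by
      filter_upwards [hinv] with ω hω
      refine subadditive_covering (a := fun k n => g n (T^[k] ω)) (fun _ _ => hg0 _ _)
        (fun _ => hz _) (fun k m n => ?_) (add_nonneg (hG0 ω) hε.le)
        (c := fun k => (B N).indicator (g 1) (T^[k] ω))
        (fun k => Set.indicator_nonneg (fun _ _ => hg0 _ _) _) (fun k => ?_) n 0
      · rw [add_comm k m, Function.iterate_add_apply]; exact hsub _ _ _
      · by_cases hk : T^[k] ω ∈ B N
        · right; simp only [Set.indicator_of_mem hk, le_refl]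
        · left
          simp only [hB, Set.mem_ofPred_eq, not_forall, not_lt] at hk
          obtain ⟨l, h1, h2, h3⟩ := hk
          refine ⟨l, h1, h2, ?_⟩
          simpa only [hG, hω k] using h3
    have hcomp : ∀ (φ : Ω → ℝ) (j : ℕ), Measurable φ → ∫ ω, φ (T^[j] ω) ∂P = ∫ ω, φ ω ∂P := by
      intro φ j hφ
      conv_rhs => rw [← (hT.iterate j).map_eq]
      rw [integral_map (hT.iterate j).measurable.aemeasurable hφ.aestronglyMeasurable]
    have hcompi : ∀ (φ : Ω → ℝ) (j : ℕ), Integrable φ P → Integrable (fun ω => φ (T^[j] ω)) P :=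
      fun φ j hφ => (hT.iterate j).integrable_comp_of_integrable hφ
    have hBi : Integrable ((B N).indicator (g 1)) P := (hi 1).indicator (hBm N)
    have i1 : Integrable (fun ω => n * (G ω + ε)) P := (hGi.add (integrable_const ε)).const_mul _
    have i2 : Integrable (fun ω => ∑ j ∈ Finset.Ico 0 (0 + n),
        (B N).indicator (g 1) (T^[j] ω)) P := integrable_finsetSum _ fun j _ => hcompi _ j hBi
    have i3 : Integrable (fun ω => ∑ j ∈ Finset.Ico (0 + n - N) (0 + n), g 1 (T^[j] ω)) P :=
      integrable_finsetSum _ fun j _ => hcompi _ j (hi 1)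
    have h1 := integral_mono_ae (hi n) ((i1.add i2).add i3) hpt
    rw [integral_add' (i1.add i2) i3, integral_add' i1 i2, integral_const_mul,
      integral_add hGi (integrable_const ε), integral_finsetSum _ fun j _ => hcompi _ j hBi,
      integral_finsetSum _ fun j _ => hcompi _ j (hi 1)] at h1
    simp only [hcomp _ _ (hm 1), hcomp _ _ ((hm 1).indicator (hBm N)), Finset.sum_const,
      Nat.card_Ico, nsmul_eq_mul, integral_const, probReal_univ, one_smul, zero_add,
      Nat.sub_zero] at h1
    have h2 : ((n - (n - N) : ℕ) : ℝ) * ∫ ω, g 1 ω ∂P ≤ N * ∫ ω, g 1 ω ∂P :=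
      mul_le_mul_of_nonneg_right (by exact_mod_cast (by omega : n - (n - N) ≤ N))
        (integral_nonneg (hg0 1))
    have h3 := (hα n).trans h1
    rw [← sub_le_iff_le_add', le_div_iff₀ hn']
    linarith
  have hN : ∀ N : ℕ, α ≤ ∫ ω, G ω ∂P + ε + ∫ ω, (B N).indicator (g 1) ω ∂P := by
    intro N
    have hlim : Tendsto (fun n : ℕ => ∫ ω, G ω ∂P + ε + ∫ ω, (B N).indicator (g 1) ω ∂P +
        (N * ∫ ω, g 1 ω ∂P) / n) atTop
        (𝓝 (∫ ω, G ω ∂P + ε + ∫ ω, (B N).indicator (g 1) ω ∂P + 0)) :=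
      tendsto_const_nhds.add (tendsto_const_div_atTop_nhds_zero_nat _)
    rw [add_zero] at hlim
    exact ge_of_tendsto hlim ((eventually_gt_atTop 0).mono fun n hn => hmain N n hn)
  have hlimB : Tendsto (fun N : ℕ => ∫ ω, (B N).indicator (g 1) ω ∂P) atTop (𝓝 0) := by
    have hz : ∫ _ω : Ω, (0 : ℝ) ∂P = 0 := by simp
    rw [← hz]
    refine tendsto_integral_of_dominated_convergence (g 1)
      (fun N => ((hm 1).indicator (hBm N)).aestronglyMeasurable) (hi 1)
      (fun N => Eventually.of_forall fun ω => ?_) ?_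
    · rw [Real.norm_of_nonneg (Set.indicator_nonneg (fun _ _ => hg0 _ _) _)]
      exact Set.indicator_le_self' (fun _ _ => hg0 _ _) _
    · filter_upwards [hle] with ω hω
      have hfin : lowerRate g ω ≠ ∞ := ne_top_of_le_ne_top ENNReal.ofReal_ne_top hω
      have hlt : lowerRate g ω < lowerRate g ω + ENNReal.ofReal ε :=
        ENNReal.lt_add_right hfin (by simpa using hε)
      have hfreq := frequently_lt_of_liminf_lt (by isBoundedDefault) hlt
      obtain ⟨n, hn, hn1⟩ := (hfreq.and_eventually (eventually_ge_atTop 1)).exists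
      have hn' : (0 : ℝ) < n := Nat.cast_pos.2 hn1
      refine tendsto_const_nhds.congr' ?_
      filter_upwards [eventually_ge_atTop n] with N hN
      rw [Set.indicator_of_notMem]
      intro hmem
      have h1 := hmem n hn1 hN
      rw [← ENNReal.ofReal_toReal hfin, ← ENNReal.ofReal_add (hG0 ω) hε.le,
        ENNReal.ofReal_lt_ofReal_iff_of_nonneg (div_nonneg (hg0 _ _) hn'.le), div_lt_iff₀ hn'] at hn
      change g n ω < (G ω + ε) * n at hn
      linarith
  have := ge_of_tendsto (tendsto_const_nhds.add hlimB) (Eventually.of_forall hN)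
  simpa using this

/-- A subadditive process whose upper growth rate is at most its mean growth rate converges. -/
theorem ae_tendsto_of_subadditive (hT : MeasurePreserving T P P) (hg0 : ∀ n ω, 0 ≤ g n ω)
    (hz : ∀ ω, g 0 ω = 0) (hm : ∀ n, Measurable (g n)) (hi : ∀ n, Integrable (g n) P)
    (hsub : ∀ m n ω, g (m + n) ω ≤ g m ω + g n (T^[m] ω)) {α : ℝ} (hα0 : 0 ≤ α)
    (hα : ∀ n : ℕ, n * α ≤ ∫ ω, g n ω ∂P)
    (hup : ∀ ε > 0, ∀ᵐ ω ∂P, ∀ᶠ n : ℕ in atTop, g n ω / n ≤ α + ε) :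
    ∀ᵐ ω ∂P, Tendsto (fun n : ℕ => g n ω / n) atTop (𝓝 α) := by
  have hlimsup : ∀ᵐ ω ∂P, limsup (fun n : ℕ => ENNReal.ofReal (g n ω / n)) atTop ≤
      ENNReal.ofReal α := by
    have h1 : ∀ᵐ ω ∂P, ∀ k : ℕ, ∀ᶠ n : ℕ in atTop, g n ω / n ≤ α + 1 / ((k : ℝ) + 1) :=
      ae_all_iff.2 fun k => hup _ (by positivity)
    filter_upwards [h1] with ω hω
    have h2 : Tendsto (fun k : ℕ => ENNReal.ofReal (α + 1 / ((k : ℝ) + 1))) atTop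
        (𝓝 (ENNReal.ofReal (α + 0))) :=
      (ENNReal.continuous_ofReal.tendsto _).comp
        (tendsto_const_nhds.add tendsto_one_div_add_atTop_nhds_zero_nat)
    rw [add_zero] at h2
    refine ge_of_tendsto h2 (Eventually.of_forall fun k => ?_)
    exact limsup_le_of_le (by isBoundedDefault)
      ((hω k).mono fun n hn => ENNReal.ofReal_le_ofReal hn)
  have hle : ∀ᵐ ω ∂P, lowerRate g ω ≤ ENNReal.ofReal α := by
    filter_upwards [hlimsup] with ω hω
    exact (liminf_le_limsup (by isBoundedDefault) (by isBoundedDefault)).trans hω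
  have hmean := le_integral_lowerRate hT hg0 hz hm hi hsub hα hle
  have hreal : ∀ᵐ ω ∂P, (lowerRate g ω).toReal ≤ α := by
    filter_upwards [hle] with ω hω
    exact ENNReal.toReal_le_of_le_ofReal hα0 hω
  have hGi : Integrable (fun ω => (lowerRate g ω).toReal) P := by
    refine Integrable.of_bound (measurable_lowerRate hm).ennreal_toReal.aestronglyMeasurable α ?_
    filter_upwards [hreal] with ω hω
    rwa [Real.norm_of_nonneg ENNReal.toReal_nonneg]
  have heq : ∀ᵐ ω ∂P, (lowerRate g ω).toReal = α := by
    have h1 : 0 ≤ᵐ[P] fun ω => α - (lowerRate g ω).toReal := by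
      filter_upwards [hreal] with ω hω
      exact sub_nonneg.2 hω
    have h2 : ∫ ω, (α - (lowerRate g ω).toReal) ∂P = 0 := by
      refine le_antisymm ?_ (integral_nonneg_of_ae h1)
      rw [integral_sub (integrable_const _) hGi]
      simpa using hmean
    have h3 := (integral_eq_zero_iff_of_nonneg_ae h1 ((integrable_const α).sub hGi)).1 h2
    filter_upwards [h3] with ω hω
    exact (sub_eq_zero.1 hω).symm
  filter_upwards [hlimsup, hle, heq] with ω h1 h2 h3
  have hfin : lowerRate g ω ≠ ∞ := ne_top_of_le_ne_top ENNReal.ofReal_ne_top h2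
  have h4 : ENNReal.ofReal α ≤ lowerRate g ω := by rw [← h3, ENNReal.ofReal_toReal hfin]
  have h5 : Tendsto (fun n : ℕ => ENNReal.ofReal (g n ω / n)) atTop (𝓝 (ENNReal.ofReal α)) :=
    tendsto_of_le_liminf_of_limsup_le h4 h1
  have h6 := (ENNReal.tendsto_toReal ENNReal.ofReal_ne_top).comp h5
  rw [ENNReal.toReal_ofReal hα0] at h6
  refine h6.congr fun n => ?_
  exact ENNReal.toReal_ofReal (div_nonneg (hg0 n ω) (Nat.cast_nonneg n))

/-- Along the orbit of a measure preserving map an integrable observable grows sublinearly. -/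
lemma ae_tendsto_comp_iterate_div (hT : MeasurePreserving T P P) {φ : Ω → ℝ} (hφ0 : ∀ ω, 0 ≤ φ ω)
    (hφm : Measurable φ) (hφ : Integrable φ P) :
    ∀ᵐ ω ∂P, Tendsto (fun n : ℕ => φ (T^[n] ω) / n) atTop (𝓝 0) := by
  have hε : ∀ ε > 0, ∀ᵐ ω ∂P, ∀ᶠ n : ℕ in atTop, φ (T^[n] ω) ≤ ε * n := by
    intro ε hε
    have h1 : ∑' n : ℕ, P {ω | φ (T^[n] ω) / ε ∈ Set.Ioi (n : ℝ)} ≠ ∞ := by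
      have h2 : ∑' n : ℕ, P {ω | φ ω / ε ∈ Set.Ioi (n : ℝ)} < ∞ := by
        let _ : MeasureSpace Ω := ⟨P⟩
        exact tsum_prob_mem_Ioi_lt_top (hφ.div_const ε) fun ω => div_nonneg (hφ0 ω) hε.le
      refine ne_of_lt (lt_of_le_of_lt (ENNReal.tsum_le_tsum fun n => ?_) h2)
      refine le_of_eq ?_
      exact (hT.iterate n).measure_preimage
        ((hφm.div_const ε) measurableSet_Ioi).nullMeasurableSet
    filter_upwards [ae_eventually_notMem h1] with ω hω
    filter_upwards [hω] with n hn
    simp only [Set.mem_Ioi, not_lt] at hn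
    rwa [div_le_iff₀ hε, mul_comm] at hn
  have h1 : ∀ᵐ ω ∂P, ∀ k : ℕ, ∀ᶠ n : ℕ in atTop, φ (T^[n] ω) ≤ 1 / ((k : ℝ) + 1) * n :=
    ae_all_iff.2 fun k => hε _ (by positivity)
  filter_upwards [h1] with ω hω
  refine tendsto_order.2 ⟨fun a ha => Eventually.of_forall fun n => lt_of_lt_of_le ha
    (div_nonneg (hφ0 _) (Nat.cast_nonneg n)), fun a ha => ?_⟩
  obtain ⟨k, hk⟩ := exists_nat_one_div_lt ha
  filter_upwards [hω k, eventually_gt_atTop 0] with n hn hn0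
  have hn' : (0 : ℝ) < n := Nat.cast_pos.2 hn0
  rw [div_lt_iff₀ hn']
  exact hn.trans_lt (mul_lt_mul_of_pos_right hk hn')

end kingman

section kingman

variable {Ω : Type*} [MeasurableSpace Ω] {P : Measure Ω} [IsProbabilityMeasure P] {T : Ω → Ω}
  {g : ℕ → Ω → ℝ}

/-- Upper bounds on the growth along multiples of `M` extend to all times. -/
lemma ae_eventually_of_multiples (hT : MeasurePreserving T P P) (hg0 : ∀ n ω, 0 ≤ g n ω)
    (hz : ∀ ω, g 0 ω = 0) (hm : Measurable (g 1)) (hi : Integrable (g 1) P)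
    (hsub : ∀ m n ω, g (m + n) ω ≤ g m ω + g n (T^[m] ω)) {M : ℕ} (hM : 0 < M) {α : ℝ}
    (hα : 0 ≤ α) (h : ∀ᵐ ω ∂P, ∀ᶠ J : ℕ in atTop, g (J * M) ω ≤ J * M * α) {ε : ℝ} (hε : 0 < ε) :
    ∀ᵐ ω ∂P, ∀ᶠ n : ℕ in atTop, g n ω / n ≤ α + ε := by
  set φ : Ω → ℝ := fun ω => ∑ i ∈ Finset.range M, g 1 (T^[i] ω) with hφ
  have hφ0 : ∀ ω, 0 ≤ φ ω := fun ω => Finset.sum_nonneg fun _ _ => hg0 _ _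
  have hφm : Measurable φ :=
    Finset.measurable_sum _ fun i _ => hm.comp (hT.iterate i).measurable
  have hφi : Integrable φ P :=
    integrable_finsetSum _ fun i _ => (hT.iterate i).integrable_comp_of_integrable hi
  have hle : ∀ r ω, g r ω ≤ ∑ i ∈ Finset.range r, g 1 (T^[i] ω) := by
    intro r ω
    induction r with
    | zero => simp [hz]
    | succ r ih =>
      rw [Finset.sum_range_succ]
      exact (hsub r 1 ω).trans (add_le_add ih le_rfl)
  filter_upwards [h, ae_tendsto_comp_iterate_div hT hφ0 hφm hφi] with ω h1 h2
  have hdiv : Tendsto (fun n : ℕ => n / M) atTop atTop := Nat.tendsto_div_const_atTop hM.ne'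
  have hmul : Tendsto (fun n : ℕ => n / M * M) atTop atTop := hdiv.atTop_mul_const' hM
  filter_upwards [hdiv.eventually h1, hmul.eventually (h2.eventually_lt_const hε),
    hmul.eventually (eventually_gt_atTop 0), eventually_gt_atTop 0] with n hn1 hn2 hn3 hn4
  have hn' : (0 : ℝ) < n := Nat.cast_pos.2 hn4
  have hk' : (0 : ℝ) < ((n / M * M : ℕ) : ℝ) := Nat.cast_pos.2 hn3
  have hkn : ((n / M * M : ℕ) : ℝ) ≤ n := by exact_mod_cast Nat.div_mul_le_self n M
  have hsplit : g n ω ≤ g (n / M * M) ω + φ (T^[n / M * M] ω) := by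
    have e : n = n / M * M + n % M := (Nat.div_add_mod' n M).symm
    calc g n ω = g (n / M * M + n % M) ω := by rw [← e]
      _ ≤ g (n / M * M) ω + g (n % M) (T^[n / M * M] ω) := hsub _ _ _
      _ ≤ _ := by
        refine add_le_add le_rfl ((hle _ _).trans ?_)
        exact Finset.sum_le_sum_of_subset_of_nonneg
          (Finset.range_subset_range.2 (Nat.mod_lt n hM).le) fun _ _ _ => hg0 _ _
  rw [div_lt_iff₀ hk'] at hn2
  rw [div_le_iff₀ hn']
  have h3 : ((n / M : ℕ) : ℝ) * M * α = ((n / M * M : ℕ) : ℝ) * α := by push_cast; ring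
  have h4 := mul_le_mul_of_nonneg_right hkn (add_nonneg hα hε.le)
  linarith

end kingman

/-! ### Almost sure convergence of the quenched cost -/

section quenched

variable {d : ℕ}

lemma greenN_congr {D : Set (Site d)} {v v' : Env d} {i : Fin d} {n : ℕ} {x : Site d}
    (h : ∀ z : Site d, |z i - x i| ≤ n → v z = v' z) : greenN D v n x = greenN D v' n x := by
  induction n generalizing x with
  | zero => rfl
  | succ n ih =>
    by_cases hx : x ∈ D
    · rw [greenN_of_mem hx, greenN_of_mem hx]
    · rw [greenN_succ_of_notMem hx, greenN_succ_of_notMem hx, avg, avg]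
      have h1 : wt v x = wt v' x := by rw [wt, wt, h x (by simp; positivity)]
      rw [h1]
      congr 2
      refine Finset.sum_congr rfl fun s _ => ih fun z hz => h z ?_
      have h2 : |stepVec s i| ≤ 1 := by
        by_cases hs : s.1 = i
        · subst hs; cases hb : s.2 <;> simp [stepVec, hb]
        · simp [stepVec, Ne.symm hs]
      have h3 : z i - x i = (z i - (x + stepVec s) i) + stepVec s i := by simp; ring
      rw [h3]
      refine (abs_add_le _ _).trans ?_
      push_cast
      linarith

lemma greenN_mul_greenN_le {D : Set (Site d)} [NeZero d] {v : Env d} (n m : ℕ) (x y : Site d) :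
    greenN {y} v n x * greenN D v m y ≤ greenN D v (n + m) x := by
  induction n generalizing x with
  | zero =>
    rw [zero_add]
    by_cases hx : x = y
    · subst hx; rw [greenN_of_mem (Set.mem_singleton x), one_mul]
    · rw [greenN_zero_of_notMem (by simpa using hx), zero_mul]; exact greenN_nonneg _ _
  | succ n ih =>
    by_cases hx : x = y
    · subst hx; rw [greenN_of_mem (Set.mem_singleton x), one_mul]
      exact greenN_monotone x (by omega)
    · by_cases hD : x ∈ D
      · rw [greenN_of_mem hD]
        exact mul_le_one₀ (greenN_le_one _ _) (greenN_nonneg _ _) (greenN_le_one _ _)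
      · rw [greenN_succ_of_notMem (by simpa using hx), show n + 1 + m = n + m + 1 by omega,
          greenN_succ_of_notMem hD, mul_assoc, ← avg_mul_right]
        exact mul_le_mul_of_nonneg_left (avg_mono ih x) (wt_nonneg v x)

variable (ν : Measure ℝ≥0) [IsProbabilityMeasure ν]

lemma indepFun_of_mixEnv {X Y : Env d → ℝ} (hXm : Measurable X) (hYm : Measurable Y)
    (D : Set (Site d)) (hX : ∀ v v', X (mixEnv D v v') = X v)
    (hY : ∀ v v', Y (mixEnv D v v') = Y v') : IndepFun X Y (envLaw d ν) := by
  rw [indepFun_iff_map_prod_eq_prod_map_map hXm.aemeasurable hYm.aemeasurable]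
  conv_lhs => rw [← (measurePreserving_mixEnv ν D).map_eq]
  rw [Measure.map_map (hXm.prodMk hYm) (measurable_mixEnv D)]
  have e : ((fun v => (X v, Y v)) ∘ fun p : Env d × Env d => mixEnv D p.1 p.2) =
      Prod.map X Y := by
    funext p
    simp only [Function.comp_apply, hX, hY, Prod.map]
  rw [e, Measure.map_prod_map _ _ hXm hYm]

variable [NeZero d]

/-- The cost of reaching `y` from `x` within `n` steps. -/
def costN (n : ℕ) (x y : Site d) (v : Env d) : ℝ := -Real.log (greenN {y} v n x)

lemma measurable_costN (n : ℕ) (x y : Site d) : Measurable fun v : Env d => costN n x y v :=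
  (Real.measurable_log.comp (measurable_greenN {y} n x)).neg

lemma costN_nonneg (n : ℕ) (x y : Site d) (v : Env d) : 0 ≤ costN n x y v :=
  neg_nonneg.2 (Real.log_nonpos (greenN_nonneg n x) (greenN_le_one n x))

lemma costN_shiftEnv (n : ℕ) (y z : Site d) (v : Env d) :
    costN n 0 y (shiftEnv z v) = costN n z (z + y) v := by
  rw [costN, greenN_shiftEnv_zero, costN]

variable {ν}

lemma exists_integrable_costN (hν : Integrable (fun t : ℝ≥0 => (t : ℝ)) ν) (z : Site d) :
    ∃ n, (∀ v : Env d, 0 < greenN {z} v n 0) ∧ Integrable (costN n 0 z) (envLaw d ν) := by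
  have hd : (0 : ℝ) < d := Nat.cast_pos.2 (NeZero.pos d)
  refine site_induction (p := fun z => ∃ n, (∀ v : Env d, 0 < greenN {z} v n 0) ∧
    Integrable (costN n 0 z) (envLaw d ν)) ?_ ?_ ?_ z
  · refine ⟨0, fun v => by rw [greenN_of_mem (by simp)]; exact one_pos, ?_⟩
    have : costN 0 (0 : Site d) 0 = fun _ => 0 := by
      funext v; rw [costN, greenN_of_mem (by simp), Real.log_one, neg_zero]
    rw [this]; exact integrable_const 0
  · intro s
    have hne : (0 : Site d) ∉ ({stepVec s} : Set (Site d)) := by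
      intro h
      have := congrFun (Set.mem_singleton_iff.1 h) s.1
      cases hb : s.2 <;> simp [stepVec, hb] at this
    have hlow : ∀ v : Env d, wt v 0 * (2 * d : ℝ)⁻¹ ≤ greenN {stepVec s} v 1 0 := by
      intro v
      rw [greenN_succ_of_notMem hne, avg]
      refine mul_le_mul_of_nonneg_left (le_mul_of_one_le_right (by positivity) ?_) (wt_nonneg v 0)
      have := Finset.single_le_sum (f := fun s' => greenN {stepVec s} v 0 (0 + stepVec s'))
        (fun s' _ => greenN_nonneg _ _) (Finset.mem_univ s)
      rwa [greenN_of_mem (by simp)] at this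
    have hpos : ∀ v : Env d, 0 < wt v 0 * (2 * d : ℝ)⁻¹ := fun v =>
      mul_pos (wt_pos v 0) (by positivity)
    refine ⟨1, fun v => (hpos v).trans_le (hlow v), ?_⟩
    refine Integrable.mono' ((integrable_eval hν 0).add (integrable_const (Real.log (2 * d))))
      (measurable_costN _ _ _).aestronglyMeasurable (Eventually.of_forall fun v => ?_)
    rw [Real.norm_of_nonneg (costN_nonneg _ _ _ _)]
    have h2 := Real.log_le_log (hpos v) (hlow v)
    rw [Real.log_mul (wt_pos v 0).ne' (by positivity), Real.log_inv, wt, Real.log_exp] at h2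
    simp only [costN, Pi.add_apply]; linarith
  · rintro z w ⟨n, hn, hni⟩ ⟨m, hm, hmi⟩
    have hm' : ∀ v : Env d, 0 < greenN {z + w} v m z := fun v => by
      rw [← greenN_shiftEnv_zero]; exact hm _
    have hmi' : Integrable (costN m z (z + w)) (envLaw d ν) :=
      ((measurePreserving_shiftEnv ν z).integrable_comp_of_integrable hmi).congr
        (Eventually.of_forall fun v => costN_shiftEnv m w z v)
    have hle : ∀ v : Env d, greenN {z} v n 0 * greenN {z + w} v m z ≤
        greenN {z + w} v (n + m) 0 := fun v => greenN_mul_greenN_le n m 0 z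
    refine ⟨n + m, fun v => (mul_pos (hn v) (hm' v)).trans_le (hle v), ?_⟩
    refine Integrable.mono' (hni.add hmi') (measurable_costN _ _ _).aestronglyMeasurable
      (Eventually.of_forall fun v => ?_)
    rw [Real.norm_of_nonneg (costN_nonneg _ _ _ _)]
    have h2 := Real.log_le_log (mul_pos (hn v) (hm' v)) (hle v)
    rw [Real.log_mul (hn v).ne' (hm' v).ne'] at h2
    simp only [costN, Pi.add_apply]; linarith

/-- The mean cost is approximated by that of reaching the target in a bounded number of steps. -/
lemma exists_integral_costN_lt (hν : Integrable (fun t : ℝ≥0 => (t : ℝ)) ν) (z : Site d) {b : ℝ}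
    (hb : meanCost ν z < b) :
    ∃ n, (∀ v : Env d, 0 < greenN {z} v n 0) ∧ Integrable (costN n 0 z) (envLaw d ν) ∧
      ∫ v, costN n 0 z v ∂(envLaw d ν) < b := by
  obtain ⟨n₀, hpos, hinteg⟩ := exists_integrable_costN hν z
  have hpos' : ∀ k (v : Env d), 0 < greenN {z} v (k + n₀) 0 := fun k v =>
    (hpos v).trans_le (greenN_monotone 0 (Nat.le_add_left _ _))
  have hdom : ∀ k (v : Env d), ‖costN (k + n₀) 0 z v‖ ≤ costN n₀ 0 z v := fun k v => by
    rw [Real.norm_of_nonneg (costN_nonneg _ _ _ _)]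
    exact neg_le_neg (Real.log_le_log (hpos v) (greenN_monotone 0 (Nat.le_add_left _ _)))
  have hlim : Tendsto (fun k => ∫ v, costN (k + n₀) 0 z v ∂(envLaw d ν)) atTop
      (𝓝 (meanCost ν z)) := by
    refine tendsto_integral_of_dominated_convergence (costN n₀ 0 z)
      (fun k => (measurable_costN _ _ _).aestronglyMeasurable) hinteg
      (fun k => Eventually.of_forall (hdom k)) (Eventually.of_forall fun v => ?_)
    exact (((tendsto_greenN (D := {z}) (v := v) 0).comp (tendsto_add_atTop_nat n₀)).log
      (green_pos 0 z v).ne').neg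
  obtain ⟨k, hk⟩ := (hlim.eventually_lt_const hb).exists
  refine ⟨k + n₀, hpos' k, hinteg.mono' (measurable_costN _ _ _).aestronglyMeasurable
    (Eventually.of_forall (hdom k)), hk⟩

lemma shiftEnv_shiftEnv (z w : Site d) (v : Env d) :
    shiftEnv z (shiftEnv w v) = shiftEnv (z + w) v := by
  funext x; simp [shiftEnv, add_assoc]

lemma shiftEnv_iterate (ℓ : Site d) (n : ℕ) (v : Env d) :
    (shiftEnv ℓ)^[n] v = shiftEnv (n • ℓ) v := by
  induction n with
  | zero => funext x; simp [shiftEnv]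
  | succ n ih => rw [Function.iterate_succ_apply', ih, shiftEnv_shiftEnv, succ_nsmul']

/-- The law of large numbers for the finite-range costs along a direction. -/
lemma ae_tendsto_average_costN {n : ℕ} {z ℓ : Site d} (hℓ : ℓ ≠ 0)
    (hinteg : Integrable (costN n 0 z) (envLaw d ν)) (i : ℕ) :
    ∀ᵐ v ∂(envLaw d ν), Tendsto (fun J : ℕ => (∑ j ∈ Finset.range J,
      costN n 0 z (shiftEnv (((2 * n + 1) * j + i) • ℓ) v)) / J) atTop
      (𝓝 (∫ v, costN n 0 z v ∂(envLaw d ν))) := by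
  obtain ⟨e, he⟩ : ∃ e, ℓ e ≠ 0 := Function.ne_iff.1 hℓ
  set X : ℕ → Env d → ℝ := fun j v => costN n 0 z (shiftEnv (((2 * n + 1) * j + i) • ℓ) v) with hX
  have hXm : ∀ j, Measurable (X j) := fun j =>
    (measurable_costN n 0 z).comp (measurable_shiftEnv _)
  have hlaw : ∀ j, IdentDistrib (X j) (costN n 0 z) (envLaw d ν) (envLaw d ν) := fun j =>
    ⟨(hXm j).aemeasurable, (measurable_costN n 0 z).aemeasurable, by
      have := (measurePreserving_shiftEnv ν (((2 * n + 1) * j + i) • ℓ)).map_eq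
      conv_rhs => rw [← this]
      rw [Measure.map_map (measurable_costN n 0 z) (measurable_shiftEnv _)]
      rfl⟩
  have hdep : ∀ j (v v' : Env d), (∀ y : Site d,
      |y e - ((((2 * n + 1) * j + i) • ℓ) e)| ≤ n → v y = v' y) → X j v = X j v' := by
    intro j v v' h
    simp only [hX, costN]
    rw [greenN_congr (v := shiftEnv (((2 * n + 1) * j + i) • ℓ) v)
      (v' := shiftEnv (((2 * n + 1) * j + i) • ℓ) v') (i := e)]
    intro y hy
    refine h _ ?_
    simpa using hy
  have hind : Pairwise (Function.onFun (fun f g => IndepFun f g (envLaw d ν)) X) := by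
    intro j k hjk
    refine indepFun_of_mixEnv ν (hXm j) (hXm k)
      {y | |y e - ((((2 * n + 1) * j + i) • ℓ) e)| ≤ n} (fun v v' => hdep j _ _ fun y hy => ?_)
      (fun v v' => hdep k _ _ fun y hy => ?_)
    · exact if_pos hy
    · refine if_neg fun hy' => ?_
      change |y e - ((((2 * n + 1) * j + i) • ℓ) e)| ≤ n at hy'
      have h1 : |((((2 * n + 1) * j + i) • ℓ) e) - ((((2 * n + 1) * k + i) • ℓ) e)| ≤ 2 * n := by
        have := abs_sub_le ((((2 * n + 1) * j + i) • ℓ) e) (y e) ((((2 * n + 1) * k + i) • ℓ) e)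
        rw [abs_sub_comm _ (y e)] at this
        linarith
      have h2 : ((((2 * n + 1) * j + i) • ℓ) e) - ((((2 * n + 1) * k + i) • ℓ) e) =
          (2 * n + 1) * (((j : ℤ) - k) * ℓ e) := by
        simp; ring
      rw [h2, abs_mul, abs_of_nonneg (by positivity)] at h1
      have h3 : 1 ≤ |((j : ℤ) - k) * ℓ e| := Int.one_le_abs
        (mul_ne_zero (sub_ne_zero.2 (by exact_mod_cast hjk)) he)
      nlinarith
  have h := strong_law_ae_real X ((hlaw 0).integrable_iff.2 hinteg) hind
    (fun j => (hlaw j).trans (hlaw 0).symm)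
  rw [(hlaw 0).integral_eq] at h
  exact h

/-- Existence of the quenched exponent in a lattice direction. -/
theorem ae_tendsto_cost (hν : Integrable (fun t : ℝ≥0 => (t : ℝ)) ν) (ℓ : Site d) {α : ℝ}
    (hα0 : 0 ≤ α) (hα : ∀ n : ℕ, n * α ≤ meanCost ν (n • ℓ))
    (hlim : Tendsto (fun k : ℕ => meanCost ν (k • ℓ) / k) atTop (𝓝 α)) :
    ∀ᵐ v ∂(envLaw d ν), Tendsto (fun k : ℕ => cost 0 (k • ℓ) v / k) atTop (𝓝 α) := by
  by_cases hℓ : ℓ = 0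
  · subst hℓ
    simp only [smul_zero, meanCost_zero, zero_div] at hlim
    rw [tendsto_nhds_unique hlim tendsto_const_nhds]
    simp [cost_self]
  have hT := measurePreserving_shiftEnv ν ℓ
  have hsub : ∀ (m n : ℕ) (v : Env d), cost 0 ((m + n) • ℓ) v ≤
      cost 0 (m • ℓ) v + cost 0 (n • ℓ) ((shiftEnv ℓ)^[m] v) := fun m n v => by
    rw [shiftEnv_iterate, cost_shiftEnv, ← add_nsmul]
    exact cost_triangle _ _ _ _
  have hz : ∀ v : Env d, cost 0 (0 • ℓ) v = 0 := fun v => by rw [zero_smul, cost_self]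
  refine ae_tendsto_of_subadditive (g := fun n v => cost 0 (n • ℓ) v) hT
    (fun _ _ => cost_nonneg _ _ _) hz (fun n => measurable_cost _ _)
    (fun n => integrable_cost hν _ _) hsub hα0 hα fun ε hε => ?_
  obtain ⟨m, hm, hm0⟩ := ((hlim.eventually_lt_const (show α < α + ε / 2 by linarith)).and
    (eventually_gt_atTop 0)).exists
  have hm' : (0 : ℝ) < m := Nat.cast_pos.2 hm0
  rw [div_lt_iff₀ hm'] at hm
  obtain ⟨n, hpos, hinteg, hlt⟩ := exists_integral_costN_lt hν (m • ℓ) hm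
  have hle : ∀ v : Env d, cost 0 (m • ℓ) v ≤ costN n 0 (m • ℓ) v := fun v =>
    neg_le_neg (Real.log_le_log (hpos v) (greenN_le_green n 0))
  set q := 2 * n + 1 with hq
  have hmℓ : m • ℓ ≠ 0 := smul_ne_zero hm0.ne' hℓ
  have hblock : ∀ (k : ℕ) (v : Env d), cost 0 ((k * m) • ℓ) v ≤
      ∑ i ∈ Finset.range k, costN n 0 (m • ℓ) (shiftEnv (i • (m • ℓ)) v) := by
    intro k v
    induction k with
    | zero => simp [cost_self]
    | succ k ih =>
      rw [Finset.sum_range_succ, add_mul, one_mul]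
      refine (hsub (k * m) m v).trans (add_le_add ih ?_)
      rw [shiftEnv_iterate, mul_smul]
      exact hle _
  have hblocks : ∀ (J : ℕ) (v : Env d), cost 0 ((J * (q * m)) • ℓ) v ≤
      ∑ i ∈ Finset.range q, ∑ j ∈ Finset.range J,
        costN n 0 (m • ℓ) (shiftEnv ((q * j + i) • (m • ℓ)) v) := by
    intro J v
    rw [Finset.sum_comm]
    induction J with
    | zero => simp [cost_self]
    | succ J ih =>
      rw [Finset.sum_range_succ, add_mul, one_mul]
      refine (hsub (J * (q * m)) (q * m) v).trans (add_le_add ih ((hblock q _).trans (le_of_eq ?_)))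
      refine Finset.sum_congr rfl fun i _ => ?_
      rw [shiftEnv_iterate, shiftEnv_shiftEnv, show J * (q * m) = (q * J) * m by ring, mul_smul,
        ← add_smul, add_comm i]
  have hmult : ∀ᵐ v ∂(envLaw d ν), ∀ᶠ J : ℕ in atTop,
      cost 0 ((J * (q * m)) • ℓ) v ≤ J * ((q * m : ℕ) : ℝ) * (α + ε / 2) := by
    have h1 : ∀ᵐ v ∂(envLaw d ν), ∀ i : ℕ, Tendsto (fun J : ℕ => (∑ j ∈ Finset.range J,
        costN n 0 (m • ℓ) (shiftEnv ((q * j + i) • (m • ℓ)) v)) / J) atTop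
        (𝓝 (∫ v, costN n 0 (m • ℓ) v ∂(envLaw d ν))) :=
      ae_all_iff.2 fun i => ae_tendsto_average_costN hmℓ hinteg i
    filter_upwards [h1] with v hv
    have h2 : Tendsto (fun J : ℕ => ∑ i ∈ Finset.range q, (∑ j ∈ Finset.range J,
        costN n 0 (m • ℓ) (shiftEnv ((q * j + i) • (m • ℓ)) v)) / J) atTop
        (𝓝 (∑ i ∈ Finset.range q, ∫ v, costN n 0 (m • ℓ) v ∂(envLaw d ν))) :=
      tendsto_finsetSum _ fun i _ => hv i
    have hq0 : (0 : ℝ) < q := by rw [hq]; positivity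
    have h3 : ∑ i ∈ Finset.range q, ∫ v, costN n 0 (m • ℓ) v ∂(envLaw d ν) <
        q * ((α + ε / 2) * m) := by
      rw [Finset.sum_const, Finset.card_range, nsmul_eq_mul]
      exact mul_lt_mul_of_pos_left hlt hq0
    filter_upwards [h2.eventually_lt_const h3, eventually_gt_atTop 0] with J hJ hJ0
    have hJ' : (0 : ℝ) < J := Nat.cast_pos.2 hJ0
    rw [← Finset.sum_div, div_lt_iff₀ hJ'] at hJ
    refine (hblocks J v).trans (hJ.le.trans (le_of_eq ?_))
    push_cast; ring
  have := ae_eventually_of_multiples (g := fun n v => cost 0 (n • ℓ) v) hT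
    (fun _ _ => cost_nonneg _ _ _) hz (measurable_cost _ _) (integrable_cost hν _ _) hsub
    (M := q * m) (Nat.mul_pos (by omega) hm0) (by linarith : (0 : ℝ) ≤ α + ε / 2) hmult
    (half_pos hε)
  filter_upwards [this] with v hv
  filter_upwards [hv] with k hk
  linarith

end quenched

/-! ### The upper bound by a walk with drift -/

section upperBound

variable {d : ℕ} [NeZero d]

lemma card_steps_pos : (0 : ℝ) < 2 * d := by
  have : (0 : ℝ) < d := Nat.cast_pos.2 (NeZero.pos d)
  linarith

/-- Jensen's inequality for a change of the step distribution. -/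
lemma sum_mul_log_le {q a : Fin d × Bool → ℝ} (hq : ∀ s, 0 < q s) (hq1 : ∑ s, q s = 1)
    (ha : ∀ s, 0 < a s) :
    ∑ s, q s * (Real.log (a s) - Real.log (2 * d * q s)) ≤
      Real.log ((2 * d : ℝ)⁻¹ * ∑ s, a s) := by
  have hd := card_steps_pos (d := d)
  have h := strictConcaveOn_log_Ioi.concaveOn.le_map_sum (t := Finset.univ) (w := q)
    (p := fun s => a s / (2 * d * q s)) (fun s _ => (hq s).le) hq1
    (fun s _ => Set.mem_Ioi.2 (div_pos (ha s) (mul_pos hd (hq s))))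
  simp only [smul_eq_mul] at h
  refine le_trans (le_of_eq (Finset.sum_congr rfl fun s _ => ?_)) (h.trans (le_of_eq ?_))
  · rw [Real.log_div (ha s).ne' (mul_pos hd (hq s)).ne']
  · rw [Finset.mul_sum]
    congr 1
    refine Finset.sum_congr rfl fun s _ => ?_
    have := (hq s).ne'
    field_simp

/-- The relative entropy of a step distribution with respect to the uniform one. -/
def stepEntropy (q : Fin d × Bool → ℝ) : ℝ := ∑ s, q s * Real.log (2 * d * q s)

lemma cost_le_of_stepDist {q : Fin d × Bool → ℝ} (hq : ∀ s, 0 < q s) (hq1 : ∑ s, q s = 1)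
    (z : Site d) (v : Env d) :
    cost 0 z v ≤ v 0 + stepEntropy q + ∑ s, q s * cost (stepVec s) z v := by
  by_cases hz : 0 = z
  · subst hz
    rw [cost_self]
    have h1 := sum_mul_log_le hq hq1 (a := fun _ => 1) fun _ => one_pos
    have h2 : Real.log ((2 * d : ℝ)⁻¹ * ∑ _s : Fin d × Bool, (1 : ℝ)) = 0 := by
      have h3 : (2 * d : ℝ)⁻¹ * ∑ _s : Fin d × Bool, (1 : ℝ) = 1 := by
        have := avg_const (d := d) 1 0
        simpa [avg] using this
      rw [h3, Real.log_one]
    rw [h2] at h1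
    simp only [Real.log_one, zero_sub, mul_neg, Finset.sum_neg_distrib] at h1
    have h4 : 0 ≤ ∑ s, q s * cost (stepVec s) 0 v :=
      Finset.sum_nonneg fun s _ => mul_nonneg (hq s).le (cost_nonneg _ _ _)
    have h5 : (0 : ℝ) ≤ v 0 := (v 0).2
    simp only [stepEntropy]
    linarith
  · have h1 := sum_mul_log_le hq hq1 (a := fun s => green {z} v (0 + stepVec s))
      fun s => green_pos _ _ _
    have h2 : green {z} v 0 = wt v 0 * ((2 * d : ℝ)⁻¹ * ∑ s, green {z} v (0 + stepVec s)) :=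
      green_of_notMem (by simpa using hz)
    have hpos : 0 < (2 * d : ℝ)⁻¹ * ∑ s, green {z} v (0 + stepVec s) := by
      have := green_pos 0 z v
      rw [h2] at this
      exact pos_of_mul_pos_right this (wt_nonneg v 0)
    have h3 : cost 0 z v = v 0 - Real.log ((2 * d : ℝ)⁻¹ * ∑ s, green {z} v (0 + stepVec s)) := by
      rw [cost, h2, Real.log_mul (wt_pos v 0).ne' hpos.ne', wt, Real.log_exp]
      ring
    rw [h3]
    have h4 : ∑ s, q s * (Real.log (green {z} v (0 + stepVec s)) - Real.log (2 * d * q s)) =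
        -(∑ s, q s * cost (stepVec s) z v) - stepEntropy q := by
      rw [stepEntropy, ← Finset.sum_neg_distrib, ← Finset.sum_sub_distrib]
      refine Finset.sum_congr rfl fun s _ => ?_
      simp only [cost, zero_add]; ring
    rw [h4] at h1
    linarith

variable {ν : Measure ℝ≥0} [IsProbabilityMeasure ν]

lemma meanCost_le_of_stepDist (hν : Integrable (fun t : ℝ≥0 => (t : ℝ)) ν)
    {q : Fin d × Bool → ℝ} (hq : ∀ s, 0 < q s) (hq1 : ∑ s, q s = 1) (z : Site d) :
    meanCost ν z ≤ ∫ t, (t : ℝ) ∂ν + stepEntropy q + ∑ s, q s * meanCost ν (z - stepVec s) := by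
  have i1 : Integrable (fun v : Env d => (v 0 : ℝ) + stepEntropy q) (envLaw d ν) :=
    (integrable_eval hν 0).add (integrable_const _)
  have i2 : Integrable (fun v : Env d => ∑ s, q s * cost (stepVec s) z v) (envLaw d ν) :=
    integrable_finsetSum _ fun s _ => (integrable_cost hν _ _).const_mul _
  have h := integral_mono (integrable_cost hν 0 z) (i1.add i2) (cost_le_of_stepDist hq hq1 z)
  rw [integral_add' i1 i2, integral_add (integrable_eval hν 0) (integrable_const _),
    integral_finsetSum _ fun s _ => (integrable_cost hν _ _).const_mul _,
    integral_eval ν 0 (f := fun t => (t : ℝ)) (by fun_prop)] at h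
  simp only [integral_const_mul, integral_const, probReal_univ, one_smul] at h
  refine h.trans (le_of_eq ?_)
  congr 1
  refine Finset.sum_congr rfl fun s _ => ?_
  rw [← integral_cost_translate ν (stepVec s) (z - stepVec s), add_sub_cancel]

lemma meanCost_le_drift (hν : Integrable (fun t : ℝ≥0 => (t : ℝ)) ν)
    {q : Fin d × Bool → ℝ} (hq : ∀ s, 0 < q s) (hq1 : ∑ s, q s = 1) {m : Fin d → ℝ}
    (hm : ∀ i, m i = ∑ s, q s * (stepVec s i : ℝ)) {L : ℝ} (hL : 0 < L) (n : ℕ) (z : Site d) :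
    meanCost ν z ≤ n * (∫ t, (t : ℝ) ∂ν + stepEntropy q) +
      (∫ t, (t : ℝ) ∂ν + Real.log (2 * d)) *
        ∑ i, ((((z i : ℝ) - n * m i) ^ 2 + n) / L + L) / 2 := by
  set C := ∫ t, (t : ℝ) ∂ν + Real.log (2 * d) with hC
  have hC0 : 0 ≤ C := add_nonneg (integral_nonneg fun t => t.2) (Real.log_nonneg (by
    have : (1 : ℝ) ≤ d := by exact_mod_cast NeZero.one_le
    linarith))
  induction n generalizing z with
  | zero =>
    refine (meanCost_le_l1 hν z).trans ?_
    simp only [Nat.cast_zero, zero_mul, zero_add, sub_zero, add_zero]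
    refine mul_le_mul_of_nonneg_left (Finset.sum_le_sum fun i _ => ?_) hC0
    rw [le_div_iff₀ two_pos, div_add' _ _ _ hL.ne', le_div_iff₀ hL]
    nlinarith [sq_nonneg (|(z i : ℝ)| - L), sq_abs (z i : ℝ)]
  | succ n ih =>
    have h1 := meanCost_le_of_stepDist hν hq hq1 z
    have h2 : ∑ s, q s * meanCost ν (z - stepVec s) ≤
        ∑ s, q s * (n * (∫ t, (t : ℝ) ∂ν + stepEntropy q) +
          C * ∑ i, (((((z - stepVec s) i : ℤ) : ℝ) - n * m i) ^ 2 + n) / L / 2 + C * (d * (L / 2))) := by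
      refine Finset.sum_le_sum fun s _ => mul_le_mul_of_nonneg_left ((ih _).trans (le_of_eq ?_))
        (hq s).le
      rw [add_assoc, ← mul_add]
      congr 2
      simp only [add_div, Finset.sum_add_distrib]
      simp
    have h3 : ∀ i, ∑ s, q s * ((((z - stepVec s) i : ℤ) : ℝ) - n * m i) ^ 2 ≤
        ((z i : ℝ) - ((n + 1 : ℕ) : ℝ) * m i) ^ 2 + 1 := by
      intro i
      have e : ∀ s, q s * ((((z - stepVec s) i : ℤ) : ℝ) - n * m i) ^ 2 =
          ((z i : ℝ) - n * m i) ^ 2 * q s - 2 * ((z i : ℝ) - n * m i) * (q s * (stepVec s i : ℝ)) +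
            q s * (stepVec s i : ℝ) ^ 2 := fun s => by
        simp only [Pi.sub_apply, Int.cast_sub]; ring
      have hsq : ∑ s, q s * (stepVec s i : ℝ) ^ 2 ≤ 1 := by
        rw [← hq1]
        refine Finset.sum_le_sum fun s _ => mul_le_of_le_one_right (hq s).le ?_
        by_cases hs : i = s.1
        · subst hs; cases hb : s.2 <;> simp [stepVec, hb]
        · simp [stepVec, hs]
      rw [Finset.sum_congr rfl fun s _ => e s, Finset.sum_add_distrib, Finset.sum_sub_distrib,
        ← Finset.mul_sum, ← Finset.mul_sum, hq1, ← hm i]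
      push_cast
      nlinarith [sq_nonneg (m i)]
    have h4 : ∑ s, q s * (n * (∫ t, (t : ℝ) ∂ν + stepEntropy q) +
          C * ∑ i, (((((z - stepVec s) i : ℤ) : ℝ) - n * m i) ^ 2 + n) / L / 2 + C * (d * (L / 2)))
        = n * (∫ t, (t : ℝ) ∂ν + stepEntropy q) + C * ∑ i,
          ((∑ s, q s * ((((z - stepVec s) i : ℤ) : ℝ) - n * m i) ^ 2) + n) / L / 2 +
          C * (d * (L / 2)) := by
      simp only [mul_add, Finset.sum_add_distrib, ← Finset.sum_mul, hq1, one_mul]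
      congr 2
      have e : ∀ s, q s * (C * ∑ i, (((((z - stepVec s) i : ℤ) : ℝ) - n * m i) ^ 2 + n) / L / 2) =
          ∑ i, C / L / 2 * (q s * ((((z - stepVec s) i : ℤ) : ℝ) - n * m i) ^ 2 + q s * n) := by
        intro s
        rw [Finset.mul_sum, Finset.mul_sum]
        exact Finset.sum_congr rfl fun i _ => by ring
      rw [Finset.sum_congr rfl fun s _ => e s, Finset.sum_comm, Finset.mul_sum]
      refine Finset.sum_congr rfl fun i _ => ?_
      rw [← Finset.mul_sum, Finset.sum_add_distrib, ← Finset.sum_mul, hq1]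
      ring
    rw [h4] at h2
    have h5 : ∑ i, ((∑ s, q s * ((((z - stepVec s) i : ℤ) : ℝ) - n * m i) ^ 2) + n) / L / 2 ≤
        ∑ i, (((z i : ℝ) - ((n + 1 : ℕ) : ℝ) * m i) ^ 2 + ((n + 1 : ℕ) : ℝ)) / L / 2 := by
      refine Finset.sum_le_sum fun i _ => ?_
      have := h3 i
      gcongr ?_ / L / 2
      push_cast at this ⊢
      linarith
    have h6 := mul_le_mul_of_nonneg_left h5 hC0
    have h7 : ∑ i, ((((z i : ℝ) - ((n + 1 : ℕ) : ℝ) * m i) ^ 2 + ((n + 1 : ℕ) : ℝ)) / L + L) / 2 =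
        ∑ i, (((z i : ℝ) - ((n + 1 : ℕ) : ℝ) * m i) ^ 2 + ((n + 1 : ℕ) : ℝ)) / L / 2 +
          d * (L / 2) := by
      simp only [add_div _ L 2, Finset.sum_add_distrib]
      simp
    rw [h7, mul_add]
    push_cast at *
    linarith

/-- The exponent at the drift of a step distribution is at most the mean potential plus the
entropy. -/
lemma seminorm_drift_le (hν : Integrable (fun t : ℝ≥0 => (t : ℝ)) ν)
    {N : Seminorm ℝ (EuclideanSpace ℝ (Fin d))} (hN : ∀ z, N (latticePoint z) ≤ meanCost ν z)
    {q : Fin d × Bool → ℝ} (hq : ∀ s, 0 < q s) (hq1 : ∑ s, q s = 1)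
    {m : EuclideanSpace ℝ (Fin d)} (hm : ∀ i, m i = ∑ s, q s * (stepVec s i : ℝ)) :
    N m ≤ ∫ t, (t : ℝ) ∂ν + stepEntropy q := by
  set C := ∫ t, (t : ℝ) ∂ν + Real.log (2 * d) with hC
  have hC0 : 0 ≤ C := add_nonneg (integral_nonneg fun t => t.2) (Real.log_nonneg (by
    have : (1 : ℝ) ≤ d := by exact_mod_cast NeZero.one_le
    linarith))
  have hlim : Tendsto (fun n : ℕ => ∫ t, (t : ℝ) ∂ν + stepEntropy q +
      C * (d * (3 / 2)) * (√(n : ℝ))⁻¹) atTop (𝓝 (∫ t, (t : ℝ) ∂ν + stepEntropy q +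
      C * (d * (3 / 2)) * 0)) :=
    tendsto_const_nhds.add (tendsto_const_nhds.mul
      (tendsto_inv_atTop_zero.comp (Real.tendsto_sqrt_atTop.comp tendsto_natCast_atTop_atTop)))
  rw [mul_zero, add_zero] at hlim
  refine le_of_tendsto_of_tendsto (tendsto_seminorm_floorPoint N m) hlim ?_
  filter_upwards [eventually_gt_atTop 0] with n hn
  have hn' : (0 : ℝ) < n := Nat.cast_pos.2 hn
  have hn1 : (1 : ℝ) ≤ n := by exact_mod_cast hn
  have hs : 0 < √(n : ℝ) := Real.sqrt_pos.2 hn'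
  have hss : √(n : ℝ) * √(n : ℝ) = n := Real.mul_self_sqrt hn'.le
  have h1 := (hN _).trans (meanCost_le_drift hν hq hq1 hm hs n (floorPoint n m))
  have h2 : ∑ i, ((((floorPoint n m i : ℝ) - n * m i) ^ 2 + n) / √(n : ℝ) + √(n : ℝ)) / 2 ≤
      ∑ _i : Fin d, 3 / 2 * √(n : ℝ) := by
    refine Finset.sum_le_sum fun i _ => ?_
    have h3 := abs_floorPoint_sub_le n m i
    have h4 : ((floorPoint n m i : ℝ) - n * m i) ^ 2 ≤ 1 := by
      rw [← sq_abs]; exact pow_le_one₀ (abs_nonneg _) h3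
    have h5 : (((floorPoint n m i : ℝ) - n * m i) ^ 2 + n) / √(n : ℝ) ≤ 2 * √(n : ℝ) := by
      rw [div_le_iff₀ hs, mul_assoc, hss]; linarith
    linarith
  have h3 := mul_le_mul_of_nonneg_left h2 hC0
  rw [Finset.sum_const, Finset.card_univ, Fintype.card_fin, nsmul_eq_mul] at h3
  rw [div_le_iff₀ hn']
  have h4 : (∫ t, (t : ℝ) ∂ν + stepEntropy q + C * (d * (3 / 2)) * (√(n : ℝ))⁻¹) * n =
      n * (∫ t, (t : ℝ) ∂ν + stepEntropy q) + C * (d * (3 / 2 * √(n : ℝ))) := by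
    have : (√(n : ℝ))⁻¹ * n = √(n : ℝ) := by
      rw [inv_mul_eq_div, div_eq_iff hs.ne', hss]
    linear_combination (C * (d * (3 / 2))) * this
  rw [h4]
  linarith

lemma mul_log_add_mul_log_le {p : ℝ} (hp : |p| ≤ 1 / 2) :
    (1 + p) * Real.log (1 + p) + (1 - p) * Real.log (1 - p) ≤ p ^ 2 + 4 * |p| ^ 3 := by
  have hlog : ∀ x : ℝ, |x| ≤ 1 / 2 → Real.log (1 - x) ≤ -x - x ^ 2 / 2 + 2 * |x| ^ 3 := by
    intro x hx
    have h1 := Real.abs_log_sub_add_sum_range_le (show |x| < 1 by linarith) 2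
    have h2 := (abs_le.1 h1).2
    simp only [Finset.sum_range_succ, Finset.sum_range_zero] at h2
    have h3 : |x| ^ (2 + 1) / (1 - |x|) ≤ 2 * |x| ^ 3 := by
      rw [div_le_iff₀ (by linarith)]
      have h4 : 0 ≤ |x| ^ 3 := by positivity
      have h5 := mul_nonneg h4 (show 0 ≤ 1 - 2 * |x| by linarith)
      norm_num
      linarith
    norm_num at h2 h3
    linarith
  have h1 := hlog p hp
  have h2 := hlog (-p) (by rwa [abs_neg])
  rw [sub_neg_eq_add, abs_neg] at h2
  have hp' := abs_le.1 hp
  have h3 := mul_le_mul_of_nonneg_left h1 (show (0 : ℝ) ≤ 1 - p by linarith)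
  have h4 := mul_le_mul_of_nonneg_left h2 (show (0 : ℝ) ≤ 1 + p by linarith)
  nlinarith

/-- The upper bound on the quenched exponent in terms of the mean potential. -/
theorem seminorm_le_sqrt_mean (hν : Integrable (fun t : ℝ≥0 => (t : ℝ)) ν)
    {N : Seminorm ℝ (EuclideanSpace ℝ (Fin d))} (hN : ∀ z, N (latticePoint z) ≤ meanCost ν z)
    {σ : ℝ} (hσ0 : 0 < σ) (hσ : σ ^ 2 = 2 * d * ∫ t, (t : ℝ) ∂ν) (hσ1 : σ ≤ 1 / 2)
    (x : EuclideanSpace ℝ (Fin d)) : N x ≤ σ * (1 + 2 * σ) * ‖x‖ := by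
  by_cases hx : x = 0
  · subst hx; simp
  have hxn : 0 < ‖x‖ := norm_pos_iff.2 hx
  have hd : (0 : ℝ) < d := Nat.cast_pos.2 (NeZero.pos d)
  set p : Fin d → ℝ := fun i => σ * (x i / ‖x‖) with hp
  have hxi : ∀ i, |x i / ‖x‖| ≤ 1 := fun i => by
    rw [abs_div, abs_of_pos hxn]; exact div_le_one_of_le₀ (abs_apply_le_norm x i) hxn.le
  have hpσ : ∀ i, |p i| ≤ σ := fun i => by
    simp only [hp]; rw [abs_mul, abs_of_pos hσ0]
    exact mul_le_of_le_one_right hσ0.le (hxi i)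
  have hp1 : ∀ i, |p i| ≤ 1 / 2 := fun i => (hpσ i).trans hσ1
  have hpsq : ∑ i, p i ^ 2 = σ ^ 2 := by
    have h1 : ∑ i, x i ^ 2 = ‖x‖ ^ 2 := by
      rw [EuclideanSpace.norm_sq_eq]; simp
    simp only [hp, mul_pow, div_pow, ← Finset.mul_sum, ← Finset.sum_div, h1]
    field_simp
  set q : Fin d × Bool → ℝ := fun s => (1 + if s.2 then p s.1 else -p s.1) / (2 * d) with hq
  have hqpos : ∀ s, 0 < q s := fun s => by
    have := abs_le.1 (hp1 s.1)
    simp only [hq]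
    refine div_pos ?_ (by linarith)
    split_ifs <;> linarith [this.1, this.2]
  have hq1 : ∑ s, q s = 1 := by
    simp only [hq, Fintype.sum_prod_type, Fintype.sum_bool]
    have : ∀ i : Fin d, (1 + p i) / (2 * d : ℝ) + (1 + -p i) / (2 * d : ℝ) = (d : ℝ)⁻¹ :=
      fun i => by field_simp; ring
    simp [this, hd.ne']
  have hm : ∀ i, ((σ / (d * ‖x‖)) • x) i = ∑ s, q s * (stepVec s i : ℝ) := by
    intro i
    simp only [hq, Fintype.sum_prod_type, Fintype.sum_bool, stepVec]
    have h1 : ∀ j : Fin d, (1 + p j) / (2 * d : ℝ) * (((Pi.single j 1 : Site d) i : ℤ) : ℝ) +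
        (1 + -p j) / (2 * d : ℝ) * (((Pi.single j (-1) : Site d) i : ℤ) : ℝ) =
        if i = j then p j / d else 0 := by
      intro j
      by_cases hij : i = j
      · subst hij; simp; field_simp; ring
      · simp [hij]
    simp only [if_true, Bool.false_eq_true, if_false, h1, Finset.sum_ite_eq, Finset.mem_univ]
    simp only [hp, PiLp.smul_apply, smul_eq_mul]
    field_simp
  have hent : stepEntropy q ≤ (σ ^ 2 + 4 * σ ^ 3) / (2 * d) := by
    have e : stepEntropy q = ∑ i, ((1 + p i) * Real.log (1 + p i) +
        (1 - p i) * Real.log (1 - p i)) / (2 * d) := by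
      simp only [stepEntropy, hq, Fintype.sum_prod_type, Fintype.sum_bool]
      refine Finset.sum_congr rfl fun i _ => ?_
      simp only [if_true, Bool.false_eq_true, if_false]
      rw [mul_div_cancel₀ _ card_steps_pos.ne', mul_div_cancel₀ _ card_steps_pos.ne']
      ring_nf
    rw [e, ← Finset.sum_div]
    refine div_le_div_of_nonneg_right ?_ card_steps_pos.le
    calc ∑ i, ((1 + p i) * Real.log (1 + p i) + (1 - p i) * Real.log (1 - p i))
        ≤ ∑ i, (p i ^ 2 + 4 * σ * p i ^ 2) := by
          refine Finset.sum_le_sum fun i _ => (mul_log_add_mul_log_le (hp1 i)).trans ?_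
          have : |p i| ^ 3 ≤ σ * p i ^ 2 := by
            rw [pow_succ', ← sq_abs (p i)]
            exact mul_le_mul_of_nonneg_right (hpσ i) (by positivity)
          linarith
      _ = σ ^ 2 + 4 * σ ^ 3 := by
          rw [Finset.sum_add_distrib, ← Finset.mul_sum, hpsq]; ring
  have h := seminorm_drift_le hν hN hqpos hq1 hm
  rw [map_smul_eq_mul, Real.norm_of_nonneg (by positivity)] at h
  have hc : ∫ t, (t : ℝ) ∂ν = σ ^ 2 / (2 * d) := by rw [hσ]; field_simp
  rw [hc] at h
  have h2 : σ / (d * ‖x‖) * N x ≤ σ / (d * ‖x‖) * (σ * (1 + 2 * σ) * ‖x‖) := by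
    refine h.trans ((add_le_add le_rfl hent).trans (le_of_eq ?_))
    field_simp
    ring
  exact le_of_mul_le_mul_left h2 (by positivity)

end upperBound

/-! ### Self-intersections of the walk -/

section intersections

variable {d : ℕ}

/-- The number of ordered pairs of equal entries of a list of sites. -/
def pairCount : List (Site d) → ℝ
  | [] => 0
  | x :: H => pairCount H + 1 + 2 * H.count x

lemma avg_coord [NeZero d] (φ : ℤ → ℝ) (x : Site d) :
    avg (fun z => φ (z 0)) x =
      φ (x 0) + (2 * d : ℝ)⁻¹ * (φ (x 0 + 1) + φ (x 0 - 1) - 2 * φ (x 0)) := by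
  have hd : (d : ℝ) ≠ 0 := Nat.cast_ne_zero.2 (NeZero.ne d)
  have h : ∀ i : Fin d, φ ((x + Pi.single i 1 : Site d) 0) + φ ((x + Pi.single i (-1) : Site d) 0) =
      2 * φ (x 0) + if i = 0 then φ (x 0 + 1) + φ (x 0 - 1) - 2 * φ (x 0) else 0 := by
    intro i
    by_cases hi : i = 0
    · subst hi; simp [sub_eq_add_neg]
    · simp [hi, Ne.symm hi]; ring
  rw [avg_eq_sum, Finset.sum_congr rfl fun i _ => h i, Finset.sum_add_distrib]
  simp
  field_simp

/-- A bound on the expected number of visits during `n` steps to the hyperplane at distance `t`. -/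
def visitBound (d : ℕ) (L : ℝ) (n : ℕ) (t : ℤ) : ℝ :=
  (d * (t : ℝ) ^ 2 + n) / (2 * L) + d * L / 2 - d * |(t : ℝ)|

lemma visitBound_nonneg {L : ℝ} (hL : 0 < L) (n : ℕ) (t : ℤ) : 0 ≤ visitBound d L n t := by
  have h1 : visitBound d L n t = d * (|(t : ℝ)| - L) ^ 2 / (2 * L) + n / (2 * L) := by
    rw [visitBound, sub_sq, sq_abs]; field_simp; ring
  rw [h1]; positivity

lemma avg_visitBound [NeZero d] {L : ℝ} (hL : 0 < L) (n : ℕ) (x z : Site d) :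
    avg (fun y => visitBound d L n (y 0 - z 0)) x =
      visitBound d L (n + 1) (x 0 - z 0) - if x 0 = z 0 then 1 else 0 := by
  have hd : (d : ℝ) ≠ 0 := Nat.cast_ne_zero.2 (NeZero.ne d)
  rw [avg_coord fun k => visitBound d L n (k - z 0)]
  have habs : |((x 0 + 1 - z 0 : ℤ) : ℝ)| + |((x 0 - 1 - z 0 : ℤ) : ℝ)| - 2 * |((x 0 - z 0 : ℤ) : ℝ)|
      = if x 0 = z 0 then 2 else 0 := by
    have key : |x 0 + 1 - z 0| + |x 0 - 1 - z 0| - 2 * |x 0 - z 0| = if x 0 = z 0 then 2 else 0 := by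
      split_ifs with h
      · rw [h]; simp
      · rcases lt_or_gt_of_ne h with h | h
        · rw [abs_of_nonpos (by omega), abs_of_nonpos (by omega), abs_of_nonpos (by omega)]; ring
        · rw [abs_of_nonneg (by omega), abs_of_nonneg (by omega), abs_of_nonneg (by omega)]; ring
    have := congrArg (Int.cast : ℤ → ℝ) key
    push_cast at this ⊢
    exact this
  have h2 : (d : ℝ) * (|((x 0 + 1 - z 0 : ℤ) : ℝ)| + |((x 0 - 1 - z 0 : ℤ) : ℝ)|
      - 2 * |((x 0 - z 0 : ℤ) : ℝ)|) = (2 * d) * if x 0 = z 0 then 1 else 0 := by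
    rw [habs]; split_ifs <;> ring
  have h3 : (if x 0 = z 0 then (1 : ℝ) else 0) = (2 * d : ℝ)⁻¹ *
      (d * (|((x 0 + 1 - z 0 : ℤ) : ℝ)| + |((x 0 - 1 - z 0 : ℤ) : ℝ)|
      - 2 * |((x 0 - z 0 : ℤ) : ℝ)|)) := by
    rw [h2]; field_simp
  rw [h3]
  simp only [visitBound]
  push_cast
  field_simp
  ring

lemma histExp_pairCount_le [NeZero d] {D : Set (Site d)} {L : ℝ} (hL : 0 < L) {N n : ℕ}
    (hn : n ≤ N) (x : Site d) (H : List (Site d)) :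
    histExp D (fun _ => 1) pairCount n x H ≤ pairCount H +
      2 * histSum (fun z => visitBound d L n (x 0 - z 0)) H +
        n * (1 + 2 * visitBound d L N 0) := by
  have hbase : ∀ n : ℕ, 1 * pairCount H ≤ pairCount H +
      2 * histSum (fun z => visitBound d L n (x 0 - z 0)) H +
        n * (1 + 2 * visitBound d L N 0) := by
    intro n
    have h1 := histSum_nonneg (fun z => visitBound_nonneg (d := d) hL n (x 0 - z 0)) H
    have h2 := visitBound_nonneg (d := d) hL N 0
    have h3 : 0 ≤ (n : ℝ) * (1 + 2 * visitBound d L N 0) := by positivity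
    linarith
  induction n generalizing x H with
  | zero => exact hbase 0
  | succ n ih =>
    by_cases hx : x ∈ D
    · rw [histExp_of_mem hx]; exact hbase _
    · rw [histExp_succ_of_notMem hx]
      refine (avg_mono (fun z => ih (by omega) z (x :: H) ?_) x).trans ?_
      · intro m
        have h1 := histSum_nonneg (fun w => visitBound_nonneg (d := d) hL m (z 0 - w 0)) (x :: H)
        have h2 := visitBound_nonneg (d := d) hL N 0
        have h3 : 0 ≤ (m : ℝ) * (1 + 2 * visitBound d L N 0) := by positivity
        linarith
      have hsum : ∀ H : List (Site d), avg (fun z =>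
          histSum (fun w => visitBound d L n (z 0 - w 0)) H) x + H.count x ≤
          histSum (fun w => visitBound d L (n + 1) (x 0 - w 0)) H := by
        intro H
        induction H with
        | nil => simp [histSum_nil, avg_const]
        | cons w H ihH =>
          simp only [histSum_cons, avg_add, avg_visitBound hL, List.count_cons]
          have : (((if (w == x) = true then 1 else 0 : ℕ)) : ℝ) ≤ if x 0 = w 0 then 1 else 0 := by
            by_cases hwx : w = x
            · subst hwx; simp
            · simp only [beq_iff_eq, hwx, if_false, Nat.cast_zero]; positivity
          push_cast at this ⊢
          linarith
      have h1 := hsum H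
      have h2 : avg (fun z => visitBound d L n (z 0 - x 0)) x ≤ visitBound d L N 0 - 1 := by
        rw [avg_visitBound hL, if_pos rfl, sub_self, visitBound, visitBound]
        have h5 : ((n + 1 : ℕ) : ℝ) ≤ N := by exact_mod_cast hn
        gcongr
      simp only [histSum_cons, avg_add, avg_mul_left, avg_const, pairCount]
      push_cast
      linarith

lemma histExp_pairCount_le_rpow [NeZero d] {D : Set (Site d)} {N : ℕ} (hN : 0 < N) (x : Site d) :
    histExp D (fun _ => 1) pairCount N x [] ≤ 3 * d * (N * √(N : ℝ)) := by
  have hN' : (1 : ℝ) ≤ N := by exact_mod_cast hN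
  have hd : (1 : ℝ) ≤ d := by exact_mod_cast NeZero.one_le
  have hs : 1 ≤ √(N : ℝ) := Real.one_le_sqrt.2 hN'
  have hss : √(N : ℝ) * √(N : ℝ) = N := Real.mul_self_sqrt (by linarith)
  have h := histExp_pairCount_le (D := D) (L := √(N : ℝ)) (N := N) (n := N) (by linarith) le_rfl x []
  have hv : visitBound d (√(N : ℝ)) N 0 = (1 + d) * √(N : ℝ) / 2 := by
    have h0 : √(N : ℝ) ≠ 0 := by linarith
    have h1 : (N : ℝ) / (2 * √(N : ℝ)) = √(N : ℝ) / 2 := by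
      rw [div_eq_div_iff (by positivity) two_ne_zero]; linear_combination (-2) * hss
    simp only [visitBound, Int.cast_zero, abs_zero]
    norm_num
    rw [h1]; ring
  simp only [pairCount, histSum_nil, hv] at h
  refine h.trans ?_
  have h1 : 1 + (1 + d) * √(N : ℝ) ≤ 3 * d * √(N : ℝ) := by nlinarith
  have h2 := mul_le_mul_of_nonneg_left h1 (by linarith : (0 : ℝ) ≤ N)
  linarith

end intersections

/-! ### Averaging a bounded potential along a path -/

section variance

variable {d : ℕ} (ν : Measure ℝ≥0) [IsProbabilityMeasure ν]

lemma exp_neg_le_taylor {X A : ℝ} (hX : 0 ≤ X) (hA : 0 ≤ A) :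
    Real.exp (-X) ≤ Real.exp (-A) - Real.exp (-A) * (X - A) + (X - A) ^ 2 := by
  have hA1 : Real.exp (-A) ≤ 1 := Real.exp_le_one_iff.2 (by linarith)
  have hA0 := Real.exp_pos (-A)
  rcases le_total A X with h | h
  · obtain ⟨t, rfl⟩ : ∃ t, X = A + t := ⟨X - A, by ring⟩
    have ht : 0 ≤ t := by linarith
    have h1 : Real.exp (-t) * (1 + t) ≤ 1 := by
      rw [Real.exp_neg, inv_mul_le_iff₀ (Real.exp_pos t), mul_one]
      linarith [Real.add_one_le_exp t]
    have h3 : Real.exp (-t) - 1 + t ≤ t ^ 2 := by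
      nlinarith [Real.exp_pos (-t), sq_nonneg t]
    have h4 := Real.add_one_le_exp (-t)
    rw [neg_add, Real.exp_add]
    nlinarith
  · obtain ⟨s, rfl⟩ : ∃ s, A = X + s := ⟨A - X, by ring⟩
    have hs : 0 ≤ s := by linarith
    have hX1 : Real.exp (-X) ≤ 1 := Real.exp_le_one_iff.2 (by linarith)
    have h1 := Real.add_one_le_exp (-s)
    have h2 : 1 - (1 + s) * Real.exp (-s) ≤ s ^ 2 := by nlinarith
    have h3 : 0 ≤ 1 - (1 + s) * Real.exp (-s) := by
      have : Real.exp (-s) * Real.exp s = 1 := by rw [← Real.exp_add]; simp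
      nlinarith [Real.add_one_le_exp s, Real.exp_pos (-s)]
    rw [neg_add, Real.exp_add]
    nlinarith [Real.exp_pos (-X)]

/-- The mean of the potential truncated at `B`. -/
def truncMean (ν : Measure ℝ≥0) (B : ℝ≥0) : ℝ := ∫ t, ((min t B : ℝ≥0) : ℝ) ∂ν

lemma integrable_trunc (B : ℝ≥0) : Integrable (fun t : ℝ≥0 => ((min t B : ℝ≥0) : ℝ)) ν :=
  Integrable.of_bound (by fun_prop) B (Eventually.of_forall fun t => by
    rw [Real.norm_of_nonneg (NNReal.coe_nonneg _)]; exact_mod_cast min_le_right _ _)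

lemma truncMean_nonneg (B : ℝ≥0) : 0 ≤ truncMean ν B := integral_nonneg fun _ => NNReal.coe_nonneg _

lemma truncMean_le (B : ℝ≥0) : truncMean ν B ≤ B := by
  have := integral_mono (integrable_trunc ν B) (integrable_const (B : ℝ))
    (fun t => by exact_mod_cast min_le_right t B)
  simpa [truncMean] using this

open Classical in
/-- The centred truncated potential on `S`. -/
def centred (ν : Measure ℝ≥0) (B : ℝ≥0) (S : Set (Site d)) (v : Env d) (x : Site d) : ℝ :=
  if x ∈ S then ((min (v x) B : ℝ≥0) : ℝ) - truncMean ν B else 0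

lemma measurable_centred (B : ℝ≥0) (S : Set (Site d)) (x : Site d) :
    Measurable fun v => centred ν B S v x := by
  unfold centred
  split_ifs
  · fun_prop
  · exact measurable_const

lemma abs_centred_le (B : ℝ≥0) (S : Set (Site d)) (v : Env d) (x : Site d) :
    |centred ν B S v x| ≤ B := by
  unfold centred
  split_ifs
  · have h1 : ((min (v x) B : ℝ≥0) : ℝ) ≤ B := by exact_mod_cast min_le_right _ _
    have h2 : (0 : ℝ) ≤ ((min (v x) B : ℝ≥0) : ℝ) := NNReal.coe_nonneg _
    rw [abs_le]
    constructor <;> linarith [truncMean_nonneg ν B, truncMean_le ν B]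
  · simp

lemma integral_centred (B : ℝ≥0) (S : Set (Site d)) (x : Site d) :
    ∫ v, centred ν B S v x ∂(envLaw d ν) = 0 := by
  unfold centred
  split_ifs
  · rw [integral_eval ν x (f := fun t => ((min t B : ℝ≥0) : ℝ) - truncMean ν B) (by fun_prop),
      integral_sub (integrable_trunc ν B) (integrable_const _)]
    simp [truncMean]
  · simp

lemma integral_centred_mul_le (B : ℝ≥0) (S : Set (Site d)) (x y : Site d) :
    ∫ v, centred ν B S v x * centred ν B S v y ∂(envLaw d ν) ≤
      if y = x then (B : ℝ) ^ 2 else 0 := by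
  split_ifs with hxy
  · subst hxy
    have hb : ∀ v : Env d, ‖centred ν B S v y * centred ν B S v y‖ ≤ (B : ℝ) ^ 2 := fun v => by
      rw [norm_mul, Real.norm_eq_abs, ← sq]
      exact pow_le_pow_left₀ (abs_nonneg _) (abs_centred_le ν B S v y) 2
    have := integral_mono (μ := envLaw d ν) (Integrable.of_bound
      ((measurable_centred ν B S y).mul (measurable_centred ν B S y)).aestronglyMeasurable _
      (Eventually.of_forall hb)) (integrable_const ((B : ℝ) ^ 2))
      (fun v => (le_abs_self _).trans (hb v))
    simpa using this
  · have hind : IndepFun (fun v => centred ν B S v x) (fun v => centred ν B S v y)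
        (envLaw d ν) := by
      refine indepFun_of_mixEnv ν (measurable_centred ν B S x) (measurable_centred ν B S y) {x}
        (fun v v' => ?_) (fun v v' => ?_)
      · simp [centred, mixEnv]
      · simp [centred, mixEnv, hxy]
    rw [hind.integral_fun_mul_eq_mul_integral (measurable_centred ν B S x).aestronglyMeasurable
      (measurable_centred ν B S y).aestronglyMeasurable, integral_centred, zero_mul]

lemma measurable_histSum_centred (B : ℝ≥0) (S : Set (Site d)) (H : List (Site d)) :
    Measurable fun v => histSum (centred ν B S v) H := by
  induction H with
  | nil => simp only [histSum_nil]; exact measurable_const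
  | cons x H ih => simp only [histSum_cons]; exact (measurable_centred ν B S x).add ih

lemma abs_histSum_centred_le (B : ℝ≥0) (S : Set (Site d)) (H : List (Site d)) (v : Env d) :
    |histSum (centred ν B S v) H| ≤ H.length * B := by
  induction H with
  | nil => simp [histSum_nil]
  | cons x H ih =>
    rw [histSum_cons]
    refine (abs_add_le _ _).trans ?_
    have := abs_centred_le ν B S v x
    push_cast [List.length_cons]
    linarith

lemma integrable_histSum_centred (B : ℝ≥0) (S : Set (Site d)) (H : List (Site d)) :
    Integrable (fun v => histSum (centred ν B S v) H) (envLaw d ν) :=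
  Integrable.of_bound (measurable_histSum_centred ν B S H).aestronglyMeasurable _
    (Eventually.of_forall (abs_histSum_centred_le ν B S H))

lemma integrable_centred_mul_histSum (B : ℝ≥0) (S : Set (Site d)) (x : Site d)
    (H : List (Site d)) :
    Integrable (fun v => centred ν B S v x * histSum (centred ν B S v) H) (envLaw d ν) :=
  (integrable_histSum_centred ν B S H).bdd_mul
    (measurable_centred ν B S x).aestronglyMeasurable
    (Eventually.of_forall fun v => abs_centred_le ν B S v x)

lemma integrable_histSum_centred_sq (B : ℝ≥0) (S : Set (Site d)) (H : List (Site d)) :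
    Integrable (fun v => histSum (centred ν B S v) H ^ 2) (envLaw d ν) :=
  Integrable.of_bound ((measurable_histSum_centred ν B S H).pow_const 2).aestronglyMeasurable
    ((H.length * B) ^ 2) (Eventually.of_forall fun v => by
      rw [norm_pow, Real.norm_eq_abs]
      exact pow_le_pow_left₀ (abs_nonneg _) (abs_histSum_centred_le ν B S H v) 2)

lemma integral_histSum_centred (B : ℝ≥0) (S : Set (Site d)) (H : List (Site d)) :
    ∫ v, histSum (centred ν B S v) H ∂(envLaw d ν) = 0 := by
  induction H with
  | nil => simp [histSum_nil]
  | cons x H ih =>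
    simp only [histSum_cons]
    rw [integral_add (Integrable.of_bound (measurable_centred ν B S x).aestronglyMeasurable _
      (Eventually.of_forall fun v => abs_centred_le ν B S v x))
      (integrable_histSum_centred ν B S H), ih, integral_centred, add_zero]

lemma integral_centred_mul_histSum_le (B : ℝ≥0) (S : Set (Site d)) (x : Site d)
    (H : List (Site d)) :
    ∫ v, centred ν B S v x * histSum (centred ν B S v) H ∂(envLaw d ν) ≤
      (B : ℝ) ^ 2 * H.count x := by
  induction H with
  | nil => simp [histSum_nil]
  | cons y H ih =>
    simp only [histSum_cons, mul_add]
    have hi : Integrable (fun v => centred ν B S v x * centred ν B S v y) (envLaw d ν) := by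
      simpa [histSum] using integrable_centred_mul_histSum ν B S x [y]
    rw [integral_add hi (integrable_centred_mul_histSum ν B S x H)]
    refine (add_le_add (integral_centred_mul_le ν B S x y) ih).trans (le_of_eq ?_)
    rw [List.count_cons]
    by_cases hxy : y = x
    · simp [hxy]; ring
    · simp [hxy]

lemma integral_histSum_centred_sq_le (B : ℝ≥0) (S : Set (Site d)) (H : List (Site d)) :
    ∫ v, histSum (centred ν B S v) H ^ 2 ∂(envLaw d ν) ≤ (B : ℝ) ^ 2 * pairCount H := by
  induction H with
  | nil => simp [histSum_nil, pairCount]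
  | cons x H ih =>
    have e : ∀ v : Env d, histSum (centred ν B S v) (x :: H) ^ 2 =
        centred ν B S v x * centred ν B S v x +
          2 * (centred ν B S v x * histSum (centred ν B S v) H) +
          histSum (centred ν B S v) H ^ 2 := fun v => by rw [histSum_cons]; ring
    have hi : Integrable (fun v => centred ν B S v x * centred ν B S v x) (envLaw d ν) := by
      simpa [histSum] using integrable_centred_mul_histSum ν B S x [x]
    have hi2 := (integrable_centred_mul_histSum ν B S x H).const_mul 2
    simp only [e]
    have hi3 : Integrable (fun v => centred ν B S v x * centred ν B S v x +
        2 * (centred ν B S v x * histSum (centred ν B S v) H)) (envLaw d ν) := hi.add hi2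
    rw [integral_add hi3 (integrable_histSum_centred_sq ν B S H), integral_add hi hi2,
      integral_const_mul, pairCount]
    have h1 := integral_centred_mul_le ν B S x x
    rw [if_pos rfl] at h1
    have h2 := integral_centred_mul_histSum_le ν B S x H
    linarith

open Classical in
/-- Along a fixed path a truncated potential may be replaced by its mean. -/
lemma integral_exp_histSum_le (B : ℝ≥0) (S : Set (Site d)) (H : List (Site d)) :
    ∫ v : Env d, Real.exp (-histSum (S.indicator fun z => ((min (v z) B : ℝ≥0) : ℝ)) H)
        ∂(envLaw d ν) ≤
      Real.exp (-histSum (S.indicator fun _ => truncMean ν B) H) + (B : ℝ) ^ 2 * pairCount H := by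
  set A := histSum (S.indicator fun _ => truncMean ν B) H with hA
  have hdiff : ∀ v : Env d, histSum (S.indicator fun z => ((min (v z) B : ℝ≥0) : ℝ)) H - A =
      histSum (centred ν B S v) H := by
    intro v
    rw [hA]
    clear hA A
    induction H with
    | nil => simp [histSum_nil]
    | cons x H ih =>
      simp only [histSum_cons] at ih ⊢
      rw [← ih]
      by_cases hx : x ∈ S <;> simp [centred, hx] <;> ring
  have hle : ∀ v : Env d,
      Real.exp (-histSum (S.indicator fun z => ((min (v z) B : ℝ≥0) : ℝ)) H) ≤
      Real.exp (-A) - Real.exp (-A) * histSum (centred ν B S v) H +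
        histSum (centred ν B S v) H ^ 2 := by
    intro v
    rw [← hdiff v]
    exact exp_neg_le_taylor (histSum_nonneg (fun z =>
      Set.indicator_nonneg (fun _ _ => NNReal.coe_nonneg _) z) H)
      (histSum_nonneg (fun z => Set.indicator_nonneg (fun _ _ => truncMean_nonneg ν B) z) H)
  have i1 : Integrable (fun v => Real.exp (-A) - Real.exp (-A) * histSum (centred ν B S v) H)
      (envLaw d ν) :=
    (integrable_const _).sub ((integrable_histSum_centred ν B S H).const_mul _)
  have h := integral_mono_of_nonneg (Eventually.of_forall fun v => (Real.exp_pos _).le)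
    (i1.add (integrable_histSum_centred_sq ν B S H)) (Eventually.of_forall hle)
  rw [integral_add' i1 (integrable_histSum_centred_sq ν B S H), integral_sub (integrable_const _)
    ((integrable_histSum_centred ν B S H).const_mul _), integral_const_mul,
    integral_histSum_centred] at h
  simp only [integral_const, probReal_univ, one_smul, mul_zero, sub_zero] at h
  exact h.trans (add_le_add le_rfl (integral_histSum_centred_sq_le ν B S H))

lemma integrable_exp_histSum_trunc (B : ℝ≥0) (S : Set (Site d)) (H : List (Site d)) :
    Integrable (fun v : Env d =>
      Real.exp (-histSum (S.indicator fun z => ((min (v z) B : ℝ≥0) : ℝ)) H)) (envLaw d ν) := by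
  have hm : ∀ H : List (Site d), Measurable fun v : Env d =>
      histSum (S.indicator fun z => ((min (v z) B : ℝ≥0) : ℝ)) H := by
    intro H
    induction H with
    | nil => simp only [histSum_nil]; exact measurable_const
    | cons y H ih =>
      simp only [histSum_cons]
      refine Measurable.add ?_ ih
      by_cases hy : y ∈ S
      · simp only [Set.indicator_of_mem hy]; fun_prop
      · simp only [Set.indicator_of_notMem hy]; exact measurable_const
  exact integrable_of_mem_Icc (Real.measurable_exp.comp (hm H).neg)
      (fun _ => (Real.exp_pos _).le) (fun v => Real.exp_le_one_iff.2 (neg_nonpos.2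
        (histSum_nonneg (fun z => Set.indicator_nonneg (fun _ _ => NNReal.coe_nonneg _) z) H)))

lemma integrable_kill_trunc [NeZero d] (B : ℝ≥0) (S D : Set (Site d)) (N : ℕ) (x : Site d) :
    Integrable (fun v : Env d =>
      kill D (fun z => Real.exp (-S.indicator (fun z => ((min (v z) B : ℝ≥0) : ℝ)) z))
        (fun _ => 1) N x) (envLaw d ν) := by
  simp only [kill_eq_histExp]
  exact integrable_histExp (integrable_exp_histSum_trunc ν B S) N x []

lemma integral_kill_trunc_le [NeZero d] (B : ℝ≥0) (S D : Set (Site d)) {N : ℕ} (hN : 0 < N)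
    (x : Site d) :
    ∫ v : Env d, kill D (fun z => Real.exp (-S.indicator (fun z => ((min (v z) B : ℝ≥0) : ℝ)) z))
        (fun _ => 1) N x ∂(envLaw d ν) ≤
      kill D (fun z => Real.exp (-S.indicator (fun _ => truncMean ν B) z)) (fun _ => 1) N x +
        (B : ℝ) ^ 2 * (3 * d * (N * √(N : ℝ))) := by
  simp only [kill_eq_histExp]
  rw [integral_histExp (integrable_exp_histSum_trunc ν B S)]
  refine (histExp_mono (fun _ => zero_le_one) (integral_exp_histSum_le ν B S) N x []).trans ?_
  rw [histExp_add]
  refine add_le_add le_rfl ?_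
  simp only [mul_comm ((B : ℝ) ^ 2), histExp_mul_const]
  exact mul_le_mul_of_nonneg_right (histExp_pairCount_le_rpow hN x) (sq_nonneg _)

end variance

/-! ### Crossing one slab -/

section slab

variable {d : ℕ}

/-- The height of a lattice point in direction `u`. -/
def height (u : Fin d → ℝ) (x : Site d) : ℝ := ∑ i, u i * (x i : ℝ)

lemma height_zero (u : Fin d → ℝ) : height u 0 = 0 := by simp [height]

lemma height_add_single (u : Fin d → ℝ) (x : Site d) (i : Fin d) (k : ℤ) :
    height u (x + Pi.single i k) = height u x + u i * k := by
  simp only [height, Pi.add_apply, Int.cast_add, mul_add, Finset.sum_add_distrib]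
  congr 1
  rw [Finset.sum_eq_single i]
  · simp
  · intro j _ hj; simp [hj]
  · simp

lemma avg_height (u : Fin d → ℝ) (φ : ℝ → ℝ) (x : Site d) :
    avg (fun z => φ (height u z)) x =
      (2 * d : ℝ)⁻¹ * ∑ i, (φ (height u x + u i) + φ (height u x - u i)) := by
  rw [avg_eq_sum]
  congr 1
  refine Finset.sum_congr rfl fun i _ => ?_
  rw [height_add_single, height_add_single]
  simp [sub_eq_add_neg]

lemma abs_le_one_of_sum_sq {u : Fin d → ℝ} (hu : ∑ i, u i ^ 2 = 1) (i : Fin d) : |u i| ≤ 1 := by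
  rw [← sq_le_one_iff_abs_le_one, ← hu]
  exact Finset.single_le_sum (f := fun i => u i ^ 2) (fun i _ => sq_nonneg _) (Finset.mem_univ i)

lemma height_step_le {u : Fin d → ℝ} (hu : ∑ i, u i ^ 2 = 1) (x : Site d) (s : Fin d × Bool) :
    height u (x + stepVec s) ≤ height u x + 1 := by
  rw [stepVec, height_add_single]
  have := abs_le.1 (abs_le_one_of_sum_sq hu s.1)
  cases s.2 <;> simp <;> linarith

lemma one_add_sq_half_le_cosh (y : ℝ) : 1 + y ^ 2 / 2 ≤ Real.cosh y := by
  rw [← Real.cosh_abs, ← sq_abs]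
  have h0 := abs_nonneg y
  have h1 : Real.cosh |y| = 1 + 2 * Real.sinh (|y| / 2) ^ 2 := by
    have h2 := Real.cosh_two_mul (|y| / 2)
    have h3 := Real.cosh_sq (|y| / 2)
    rw [mul_div_cancel₀ _ two_ne_zero] at h2
    linarith
  have h2 : |y| / 2 ≤ Real.sinh (|y| / 2) := Real.self_le_sinh_iff.2 (by positivity)
  rw [h1]
  nlinarith

variable [NeZero d]

lemma sum_cosh_le {u : Fin d → ℝ} (hu : ∑ i, u i ^ 2 = 1) {c l : ℝ} (hl0 : 0 ≤ l) (hl1 : l ≤ 1)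
    (hl : l ^ 2 * (1 + l ^ 2) ≤ 2 * d * c) :
    (2 * d : ℝ)⁻¹ * ∑ i, (2 * Real.cosh (l * u i)) ≤ Real.exp c := by
  have hd := card_steps_pos (d := d)
  have h1 : ∀ i, Real.cosh (l * u i) ≤ 1 + (l ^ 2 / 2 + l ^ 4 / 4) * u i ^ 2 := by
    intro i
    have hu1 : u i ^ 2 ≤ 1 := (sq_le_one_iff_abs_le_one _).2 (abs_le_one_of_sum_sq hu i)
    have hl2 : l ^ 2 ≤ 1 := pow_le_one₀ hl0 hl1
    have hy0 : 0 ≤ (l * u i) ^ 2 / 2 := by positivity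
    have hy1 : (l * u i) ^ 2 / 2 ≤ 1 := by
      rw [mul_pow]; nlinarith [sq_nonneg (u i), sq_nonneg l]
    have h2 := (abs_le.1 (Real.abs_exp_sub_one_sub_id_le
      (show |(l * u i) ^ 2 / 2| ≤ 1 by rwa [abs_of_nonneg hy0]))).2
    have h3 := Real.cosh_le_exp_half_sq (l * u i)
    have h4 : ((l * u i) ^ 2 / 2) ^ 2 ≤ l ^ 4 / 4 * u i ^ 2 := by
      have : ((l * u i) ^ 2 / 2) ^ 2 = l ^ 4 / 4 * u i ^ 2 * u i ^ 2 := by ring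
      rw [this]
      exact mul_le_of_le_one_right (by positivity) hu1
    have h5 : (l * u i) ^ 2 / 2 = l ^ 2 / 2 * u i ^ 2 := by ring
    linarith
  have h2 : ∑ i, (2 * Real.cosh (l * u i)) ≤ 2 * d + (l ^ 2 + l ^ 4 / 2) := by
    calc ∑ i, (2 * Real.cosh (l * u i)) ≤ ∑ i, (2 + (l ^ 2 + l ^ 4 / 2) * u i ^ 2) :=
          Finset.sum_le_sum fun i _ => by have := h1 i; linarith
      _ = 2 * d + (l ^ 2 + l ^ 4 / 2) := by
          rw [Finset.sum_add_distrib, ← Finset.mul_sum, hu]; simp; ring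
  rw [inv_mul_le_iff₀ hd]
  have h3 := Real.add_one_le_exp c
  have h4 := mul_le_mul_of_nonneg_left h3 hd.le
  nlinarith [sq_nonneg (l ^ 2)]

lemma le_sum_cosh {u : Fin d → ℝ} (hu : ∑ i, u i ^ 2 = 1) (θ : ℝ) :
    1 + θ ^ 2 / (2 * d) ≤ (2 * d : ℝ)⁻¹ * ∑ i, (2 * Real.cosh (θ * u i)) := by
  have hd := card_steps_pos (d := d)
  have h : 2 * d + θ ^ 2 ≤ ∑ i, (2 * Real.cosh (θ * u i)) := by
    calc 2 * d + θ ^ 2 = ∑ i, (2 + θ ^ 2 * u i ^ 2) := by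
          rw [Finset.sum_add_distrib, ← Finset.mul_sum, hu]; simp; ring
      _ ≤ _ := Finset.sum_le_sum fun i _ => by
          have := one_add_sq_half_le_cosh (θ * u i)
          rw [mul_pow] at this
          linarith
  rw [le_inv_mul_iff₀ hd]
  have hd' : (d : ℝ) ≠ 0 := Nat.cast_ne_zero.2 (NeZero.ne d)
  refine le_trans (le_of_eq ?_) h
  field_simp

lemma kill_indicator_upper_le {u : Fin d → ℝ} (hu : ∑ i, u i ^ 2 = 1) {c l r a : ℝ}
    (hl0 : 0 ≤ l) (hl1 : l ≤ 1) (hl : l ^ 2 * (1 + l ^ 2) ≤ 2 * d * c) (hr : 1 ≤ r) (N : ℕ)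
    {x : Site d} (hx : height u x ≤ a + 1) :
    kill (upper (height u) (a + r))
      (fun z => Real.exp (-(upper (height u) a).indicator (fun _ => c) z))
      ((upper (height u) (a + r)).indicator 1) N x ≤ (Real.cosh (l * (r - 1)))⁻¹ := by
  set K := Real.cosh (l * (r - 1)) with hK
  have hK0 : 0 < K := Real.cosh_pos _
  set φ : ℝ → ℝ := fun t => Real.cosh (l * max (t - a - 1) 0) with hφ
  have hφ0 : ∀ t, 0 < φ t := fun t => Real.cosh_pos _
  have hF : ∀ z ∈ upper (height u) (a + r), 1 ≤ K⁻¹ * φ (height u z) := by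
    intro z hz
    rw [mem_upper] at hz
    rw [le_inv_mul_iff₀ hK0, mul_one, hK, hφ, Real.cosh_le_cosh,
      abs_of_nonneg (mul_nonneg hl0 (by linarith)),
      abs_of_nonneg (mul_nonneg hl0 (le_max_right _ _))]
    exact mul_le_mul_of_nonneg_left (le_trans (by linarith) (le_max_left _ _)) hl0
  have hind : ∀ z ∈ upper (height u) (a + r),
      (upper (height u) (a + r)).indicator (1 : Site d → ℝ) z ≤ K⁻¹ * φ (height u z) :=
    fun z hz => by rw [Set.indicator_of_mem hz]; exact hF z hz
  have key := kill_le_of_super (D := upper (height u) (a + r))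
    (w := fun z => Real.exp (-(upper (height u) a).indicator (fun _ => c) z))
    (f := (upper (height u) (a + r)).indicator 1)
    (U := fun _ z => K⁻¹ * φ (height u z)) (fun _ => (Real.exp_pos _).le)
    (fun z => by
      by_cases hz : z ∈ upper (height u) (a + r)
      · exact hind z hz
      · rw [Set.indicator_of_notMem hz]; exact (mul_pos (inv_pos.2 hK0) (hφ0 _)).le)
    (fun _ => hind)
    (fun _ z _ => by
      rw [avg_mul_left, mul_left_comm]
      refine mul_le_mul_of_nonneg_left ?_ (inv_pos.2 hK0).le
      rw [avg_height u φ]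
      by_cases hz : z ∈ upper (height u) a
      · rw [Set.indicator_of_mem hz, Real.exp_neg, inv_mul_le_iff₀ (Real.exp_pos c)]
        set t := height u z
        have h1 : ∀ i, φ (t + u i) + φ (t - u i) ≤ φ t * (2 * Real.cosh (l * u i)) := by
          intro i
          have h2 : ∀ e : ℝ, φ (t + e) ≤ Real.cosh (l * (max (t - a - 1) 0 + e)) := by
            intro e
            rw [hφ, Real.cosh_le_cosh, abs_mul, abs_mul]
            refine mul_le_mul_of_nonneg_left ?_ (abs_nonneg l)
            rw [abs_of_nonneg (le_max_right _ _)]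
            refine max_le ?_ (abs_nonneg _)
            refine le_trans ?_ (le_abs_self _)
            linarith [le_max_left (t - a - 1) 0]
          have h3 := h2 (u i)
          have h4 := h2 (-u i)
          rw [← sub_eq_add_neg] at h4
          rw [mul_add, Real.cosh_add] at h3
          rw [mul_add, mul_neg, Real.cosh_add, Real.cosh_neg, Real.sinh_neg] at h4
          calc φ (t + u i) + φ (t - u i) ≤ _ := add_le_add h3 h4
            _ = _ := by simp only [hφ]; ring
        calc (2 * d : ℝ)⁻¹ * ∑ i, (φ (t + u i) + φ (t - u i))
            ≤ (2 * d : ℝ)⁻¹ * ∑ i, φ t * (2 * Real.cosh (l * u i)) :=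
              mul_le_mul_of_nonneg_left (Finset.sum_le_sum fun i _ => h1 i)
                (inv_nonneg.2 card_steps_pos.le)
          _ = φ t * ((2 * d : ℝ)⁻¹ * ∑ i, (2 * Real.cosh (l * u i))) := by
              rw [← Finset.mul_sum]; ring
          _ ≤ φ t * Real.exp c := mul_le_mul_of_nonneg_left (sum_cosh_le hu hl0 hl1 hl) (hφ0 t).le
          _ = Real.exp c * φ t := mul_comm _ _
      · rw [Set.indicator_of_notMem hz, neg_zero, Real.exp_zero, one_mul]
        rw [mem_upper, not_le] at hz
        have hφ1 : ∀ t ≤ a + 1, φ t = 1 := fun t ht => by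
          simp only [hφ]; rw [max_eq_right (by linarith), mul_zero, Real.cosh_zero]
        rw [hφ1 _ (by linarith), ← avg_height u φ]
        refine (avg_mono_at (g := fun _ => 1) fun s => ?_).trans_eq (avg_const 1 z)
        exact (hφ1 _ (by linarith [height_step_le hu z s])).le) N x
  refine key.trans (le_of_eq ?_)
  simp only [hφ]
  rw [max_eq_right (by linarith), mul_zero, Real.cosh_zero, mul_one]

lemma kill_indicator_compl_le {u : Fin d → ℝ} (hu : ∑ i, u i ^ 2 = 1) {b θ : ℝ} (hθ : 0 ≤ θ)
    {w : Site d → ℝ} (hw : ∀ z, 0 ≤ w z) (hw1 : ∀ z, w z ≤ 1) (n : ℕ) {x : Site d}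
    (hx : height u x ≤ b + 1) :
    (1 - ((1 + θ ^ 2 / (2 * d))⁻¹) ^ n) * kill (upper (height u) b) w
      ((upper (height u) b)ᶜ.indicator 1) n x ≤ 1 - Real.exp (-(θ * (b + 1 - height u x))) := by
  set κ := 1 + θ ^ 2 / (2 * d : ℝ) with hκ
  have hκ1 : 1 ≤ κ := by
    have := card_steps_pos (d := d)
    rw [hκ, le_add_iff_nonneg_right]; positivity
  have hRHS : ∀ t ≤ b + 1, 0 ≤ 1 - Real.exp (-(θ * (b + 1 - t))) := fun t ht => by
    have := mul_nonneg hθ (sub_nonneg.2 ht)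
    rw [sub_nonneg, Real.exp_le_one_iff]
    linarith
  induction n generalizing x with
  | zero => simpa using hRHS _ hx
  | succ n ih =>
    by_cases hxD : x ∈ upper (height u) b
    · rw [kill_of_mem hxD]
      simpa [hxD] using hRHS _ hx
    · have hxb : height u x < b := by rwa [mem_upper, not_le] at hxD
      set Q := kill (upper (height u) b) w ((upper (height u) b)ᶜ.indicator 1) n with hQ
      have hq0 : 0 ≤ avg Q x := avg_nonneg (kill_nonneg hw indicator_one_nonneg n) x
      have hq1 : avg Q x ≤ 1 :=
        (avg_mono (kill_le_one hw hw1 indicator_one_le n) x).trans_eq (avg_const 1 x)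
      have h1 : (1 - κ⁻¹ ^ n) * avg Q x ≤
          1 - κ * Real.exp (-(θ * (b + 1 - height u x))) := by
        rw [← avg_mul_left]
        refine (avg_mono_at (g := fun z => (fun t => 1 + (-1) * Real.exp (-(θ * (b + 1 - t))))
          (height u z)) fun s => ?_).trans ?_
        · have := ih (x := x + stepVec s) (by linarith [height_step_le hu x s])
          simp only
          linarith
        · simp only
          rw [avg_add, avg_const, avg_mul_left,
            avg_height u (fun t => Real.exp (-(θ * (b + 1 - t))))]
          have h2 : ∀ i, Real.exp (-(θ * (b + 1 - (height u x + u i)))) +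
              Real.exp (-(θ * (b + 1 - (height u x - u i)))) =
              Real.exp (-(θ * (b + 1 - height u x))) * (2 * Real.cosh (θ * u i)) := by
            intro i
            rw [Real.cosh_eq, mul_div_cancel₀ _ two_ne_zero, mul_add, ← Real.exp_add,
              ← Real.exp_add]
            congr 2 <;> ring
          rw [Finset.sum_congr rfl fun i _ => h2 i, ← Finset.mul_sum, mul_left_comm]
          have := mul_le_mul_of_nonneg_left (le_sum_cosh hu θ)
            (Real.exp_pos (-(θ * (b + 1 - height u x)))).le
          rw [← hκ] at this
          linarith
      rw [kill_succ_of_notMem hxD]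
      have hκi : 0 < κ⁻¹ := inv_pos.2 (by linarith)
      have hκi1 : κ⁻¹ ≤ 1 := inv_le_one_of_one_le₀ hκ1
      have h3 : (1 - κ⁻¹ ^ (n + 1)) * (w x * avg Q x) ≤ (1 - κ⁻¹ ^ (n + 1)) * avg Q x :=
        mul_le_mul_of_nonneg_left (mul_le_of_le_one_left hq0 (hw1 x))
          (sub_nonneg.2 (pow_le_one₀ hκi.le hκi1))
      refine h3.trans ?_
      have h4 := mul_le_mul_of_nonneg_left h1 hκi.le
      have h5 : κ⁻¹ * κ = 1 := inv_mul_cancel₀ (by linarith)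
      have h6 : κ⁻¹ * (1 - κ * Real.exp (-(θ * (b + 1 - height u x)))) =
          κ⁻¹ - Real.exp (-(θ * (b + 1 - height u x))) := by
        rw [mul_sub, ← mul_assoc, h5]; ring
      rw [h6] at h4
      rw [pow_succ]
      nlinarith [mul_nonneg (sub_nonneg.2 hκi1) (sub_nonneg.2 hq1)]

/-- Crossing a slab of width `r` in a constant potential `c`, within `N` steps or not at all. -/
lemma kill_slab_le {u : Fin d → ℝ} (hu : ∑ i, u i ^ 2 = 1) {c l r a θ : ℝ} (hc : 0 ≤ c)
    (hl0 : 0 ≤ l) (hl1 : l ≤ 1) (hl : l ^ 2 * (1 + l ^ 2) ≤ 2 * d * c) (hr : 1 ≤ r) (hθ : 0 ≤ θ)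
    (N : ℕ) {x : Site d} (hax : a ≤ height u x) (hxa : height u x ≤ a + 1) :
    kill (upper (height u) (a + r))
      (fun z => Real.exp (-(upper (height u) a).indicator (fun _ => c) z)) (fun _ => 1) N x ≤
      (Real.cosh (l * (r - 1)))⁻¹ + (θ * (r + 1) + (1 + N * (θ ^ 2 / (2 * d)))⁻¹) := by
  set D := upper (height u) (a + r) with hD
  set w : Site d → ℝ := fun z => Real.exp (-(upper (height u) a).indicator (fun _ => c) z) with hw
  have hsplit : (fun _ : Site d => (1 : ℝ)) = fun z => D.indicator 1 z + Dᶜ.indicator 1 z := by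
    funext z
    by_cases hz : z ∈ D <;> simp [hz]
  have hw0 : ∀ z, 0 ≤ w z := fun z => (Real.exp_pos _).le
  have hw1 : ∀ z, w z ≤ 1 := fun z => Real.exp_le_one_iff.2
    (neg_nonpos.2 (Set.indicator_nonneg (fun _ _ => hc) z))
  rw [hsplit, kill_add]
  refine add_le_add (kill_indicator_upper_le hu hl0 hl1 hl hr N hxa) ?_
  have h := kill_indicator_compl_le hu (b := a + r) hθ hw0 hw1 N (x := x) (by linarith)
  rw [← hD] at h
  set Q := kill D w (Dᶜ.indicator 1) N x
  have hQ1 : Q ≤ 1 := kill_le_one hw0 hw1 indicator_one_le N x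
  have hq : 0 ≤ θ ^ 2 / (2 * d : ℝ) := by have := card_steps_pos (d := d); positivity
  have h1 : (1 + θ ^ 2 / (2 * d : ℝ))⁻¹ ^ N ≤ (1 + N * (θ ^ 2 / (2 * d : ℝ)))⁻¹ := by
    rw [inv_pow]
    exact inv_anti₀ (by positivity) (one_add_mul_le_pow (by linarith) N)
  have h2 : 1 - Real.exp (-(θ * (a + r + 1 - height u x))) ≤ θ * (r + 1) := by
    have h3 := Real.add_one_le_exp (-(θ * (a + r + 1 - height u x)))
    have h4 := mul_le_mul_of_nonneg_left (show a + r + 1 - height u x ≤ r + 1 by linarith) hθ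
    linarith
  have h3 : (1 + θ ^ 2 / (2 * d : ℝ))⁻¹ ^ N * Q ≤ (1 + θ ^ 2 / (2 * d : ℝ))⁻¹ ^ N :=
    mul_le_of_le_one_right (by positivity) hQ1
  linarith

lemma green_le_kill_one {D : Set (Site d)} {v : Env d} (N : ℕ) (x : Site d) :
    green D v x ≤ kill D (wt v) (fun _ => 1) N x := by
  induction N generalizing x with
  | zero => exact green_le_one x
  | succ N ih =>
    by_cases hx : x ∈ D
    · rw [kill_of_mem hx, green_of_mem hx]
    · rw [kill_succ_of_notMem hx, green_of_notMem hx]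
      exact mul_le_mul_of_nonneg_left (avg_mono ih x) (wt_nonneg v x)

variable (ν : Measure ℝ≥0) [IsProbabilityMeasure ν]

/-- The annealed probability to cross one slab. -/
lemma integral_green_slab_le {u : Fin d → ℝ} (hu : ∑ i, u i ^ 2 = 1) (B : ℝ≥0) {l r a θ : ℝ}
    (hl0 : 0 ≤ l) (hl1 : l ≤ 1) (hl : l ^ 2 * (1 + l ^ 2) ≤ 2 * d * truncMean ν B) (hr : 1 ≤ r)
    (hθ : 0 ≤ θ) {N : ℕ} (hN : 0 < N) {x : Site d} (hax : a ≤ height u x)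
    (hxa : height u x ≤ a + 1) :
    ∫ v, green (upper (height u) (a + r)) ((upper (height u) a).indicator v) x ∂(envLaw d ν) ≤
      (Real.cosh (l * (r - 1)))⁻¹ + (θ * (r + 1) + (1 + N * (θ ^ 2 / (2 * d)))⁻¹) +
        (B : ℝ) ^ 2 * (3 * d * (N * √(N : ℝ))) := by
  set S := upper (height u) a
  set D := upper (height u) (a + r)
  refine le_trans ?_ ((integral_kill_trunc_le ν B S D hN x).trans (add_le_add
    (kill_slab_le hu (truncMean_nonneg ν B) hl0 hl1 hl hr hθ N hax hxa) le_rfl))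
  refine integral_mono_of_nonneg (Eventually.of_forall fun v => green_nonneg x) ?_
    (Eventually.of_forall fun v => ?_)
  · exact integrable_kill_trunc ν B S D N x
  · refine (green_le_kill_one N x).trans (kill_mono (wt_nonneg _) (fun _ => (Real.exp_pos _).le)
      (fun z _ => ?_) (fun _ => zero_le_one) (fun _ => le_rfl) N x)
    rw [wt, Real.exp_le_exp, neg_le_neg_iff]
    by_cases hz : z ∈ S
    · simp only [Set.indicator_of_mem hz]; exact_mod_cast min_le_left _ _
    · simp only [Set.indicator_of_notMem hz]; simp

end slab

/-! ### Lower bounds on the annealed exponent -/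

section lowerBound

variable {d : ℕ} [NeZero d] {ν : Measure ℝ≥0} [IsProbabilityMeasure ν]
  {N : Seminorm ℝ (EuclideanSpace ℝ (Fin d))}

lemma mul_norm_le_of_slab
    (hN : ∀ ℓ, Tendsto (fun k : ℕ => annealedCost ν (k • ℓ) / k) atTop (𝓝 (N (latticePoint ℓ))))
    {r ρ : ℝ} (hr : 0 < r) (hρ0 : 0 < ρ) (hρ1 : ρ ≤ 1)
    (hρ : ∀ u : Fin d → ℝ, ∑ i, u i ^ 2 = 1 → ∀ a x, a ≤ height u x → height u x ≤ a + 1 →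
      ∫ v, green (upper (height u) (a + r)) ((upper (height u) a).indicator v) x ∂(envLaw d ν) ≤ ρ)
    (x : EuclideanSpace ℝ (Fin d)) : -Real.log ρ / r * ‖x‖ ≤ N x := by
  have hlog : 0 ≤ -Real.log ρ := neg_nonneg.2 (Real.log_nonpos hρ0.le hρ1)
  refine mul_norm_le_of_lattice (div_nonneg hlog hr.le) (fun z => ?_) x
  set n := ‖latticePoint z‖ with hn
  rcases (norm_nonneg (latticePoint z)).eq_or_lt with h0 | h0
  · rw [hn, ← h0, mul_zero]; exact apply_nonneg N _
  rw [← hn] at h0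
  have hsq : ∑ i, (z i : ℝ) ^ 2 = n ^ 2 := by
    rw [hn, EuclideanSpace.norm_sq_eq]; simp [latticePoint_apply]
  set u : Fin d → ℝ := fun i => z i / n with hu
  have hu1 : ∑ i, u i ^ 2 = 1 := by
    simp only [hu, div_pow, ← Finset.sum_div, hsq]
    exact div_self (by positivity)
  have hheight : ∀ k : ℕ, height u (k • z) = k * n := by
    intro k
    have e : ∀ i, u i * (((k • z) i : ℤ) : ℝ) = k / n * (z i : ℝ) ^ 2 := fun i => by
      simp [hu]; ring
    rw [height, Finset.sum_congr rfl fun i _ => e i, ← Finset.mul_sum, hsq]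
    field_simp
  have hlim : Tendsto (fun k : ℕ => -Real.log ρ / r * n - -Real.log ρ * ((k : ℝ))⁻¹) atTop
      (𝓝 (-Real.log ρ / r * n - -Real.log ρ * 0)) :=
    tendsto_const_nhds.sub (tendsto_const_nhds.mul tendsto_inv_atTop_nhds_zero_nat)
  rw [mul_zero, sub_zero] at hlim
  refine le_of_tendsto_of_tendsto hlim (hN z) ?_
  filter_upwards [eventually_gt_atTop 0] with k hk
  have hk' : (0 : ℝ) < k := Nat.cast_pos.2 hk
  set K := ⌊k * n / r⌋₊
  have hK : (K : ℝ) * r ≤ height u (k • z) := by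
    rw [hheight, ← le_div_iff₀ hr]; exact Nat.floor_le (by positivity)
  have hK' : k * n / r - 1 ≤ K := (Nat.sub_one_lt_floor _).le
  have h1 := annealed_le_pow ν (height_zero u) (height_step_le hu1) hr.le hρ0.le (hρ u hu1) K hK
  have h2 : K * -Real.log ρ ≤ annealedCost ν (k • z) := by
    have := Real.log_le_log (annealed_pos ν (k • z)) h1
    rw [Real.log_pow] at this
    rw [annealedCost]; linarith
  rw [le_div_iff₀ hk']
  have h3 := mul_le_mul_of_nonneg_right hK' hlog
  have h4 : (-Real.log ρ / r * n - -Real.log ρ * ((k : ℝ))⁻¹) * k =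
      (k * n / r - 1) * -Real.log ρ := by field_simp; ring
  rw [h4]
  exact h3.trans h2

/-- The annealed exponent of a potential that does not vanish is a norm. -/
lemma exists_mul_norm_le (hν : Integrable (fun t : ℝ≥0 => (t : ℝ)) ν)
    (hν0 : 0 < ∫ t, (t : ℝ) ∂ν)
    (hN : ∀ ℓ, Tendsto (fun k : ℕ => annealedCost ν (k • ℓ) / k) atTop (𝓝 (N (latticePoint ℓ)))) :
    ∃ c > 0, ∀ x, c * ‖x‖ ≤ N x := by
  have hi : Integrable (fun t : ℝ≥0 => Real.exp (-(t : ℝ))) ν :=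
    integrable_of_mem_Icc (by fun_prop) (fun _ => (Real.exp_pos _).le)
      (fun t => Real.exp_le_one_iff.2 (by simp))
  set ρ := ∫ t : ℝ≥0, Real.exp (-(t : ℝ)) ∂ν with hρ
  have hρ0 : 0 < ρ := integral_exp_pos hi
  have hρ1 : ρ < 1 := by
    have hpos : 0 < ∫ t : ℝ≥0, (1 - Real.exp (-(t : ℝ))) ∂ν := by
      have hnn : ∀ t : ℝ≥0, 0 ≤ 1 - Real.exp (-(t : ℝ)) := fun t =>
        sub_nonneg.2 (Real.exp_le_one_iff.2 (by simp))
      rw [integral_pos_iff_support_of_nonneg hnn ((integrable_const 1).sub hi)]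
      rw [integral_pos_iff_support_of_nonneg (fun t => t.2) hν] at hν0
      refine hν0.trans_le (measure_mono fun t ht => ?_)
      rw [Function.mem_support] at ht ⊢
      have : Real.exp (-(t : ℝ)) < 1 := Real.exp_lt_one_iff.2 (by
        have : 0 < (t : ℝ) := lt_of_le_of_ne t.2 (Ne.symm ht)
        linarith)
      linarith
    rw [integral_sub (integrable_const 1) hi] at hpos
    simp only [integral_const, probReal_univ, smul_eq_mul, mul_one] at hpos
    linarith
  refine ⟨-Real.log ρ / 2, div_pos (neg_pos.2 (Real.log_neg hρ0 hρ1)) two_pos,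
    mul_norm_le_of_slab hN two_pos hρ0 hρ1.le fun u _ a x hax hxa => ?_⟩
  have hxS : x ∈ upper (height u) a := hax
  have hxD : x ∉ upper (height u) (a + 2) := by rw [mem_upper, not_le]; linarith
  rw [hρ, ← integral_eval ν x (f := fun t : ℝ≥0 => Real.exp (-(t : ℝ))) (by fun_prop)]
  refine integral_mono (integrable_green_comp ν _ _ (measurable_indicatorEnv _))
    (integrable_of_mem_Icc (by fun_prop) (fun _ => (Real.exp_pos _).le)
      (fun t => Real.exp_le_one_iff.2 (by simp))) fun v => (green_le_wt hxD).trans (le_of_eq ?_)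
  rw [wt, Set.indicator_of_mem hxS]

lemma eventually_lt_of_continuous {f : ℝ → ℝ} (hf : Continuous f) {c : ℝ} (h : f 0 < c) :
    ∀ᶠ γ in 𝓝[>] (0 : ℝ), f γ < c :=
  ((hf.tendsto 0).eventually_lt_const h).filter_mono nhdsWithin_le_nhds

/-- The lower bound on the annealed exponent in terms of the mean of the truncated potential. -/
theorem eventually_mul_norm_le (d : ℕ) [NeZero d] {s ε m : ℝ} (M : ℝ≥0) (hs : 0 < s) (hε : 0 < ε)
    (hm : s ^ 2 < 2 * d * m) :
    ∀ᶠ γ in 𝓝[>] (0 : ℝ), ∀ (ν : Measure ℝ≥0) [IsProbabilityMeasure ν]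
      (N : Seminorm ℝ (EuclideanSpace ℝ (Fin d))),
      (∀ ℓ, Tendsto (fun k : ℕ => annealedCost ν (k • ℓ) / k) atTop (𝓝 (N (latticePoint ℓ)))) →
      γ * m ≤ truncMean ν (γ.toNNReal * M) → ∀ x, (s - ε) * √γ * ‖x‖ ≤ N x := by
  rcases le_or_gt s ε with hsε | hsε
  · filter_upwards with γ ν _ N _ _ x
    refine le_trans (mul_nonpos_of_nonpos_of_nonneg (mul_nonpos_of_nonpos_of_nonneg ?_ ?_) ?_)
      (apply_nonneg N x)
    · linarith
    · positivity
    · positivity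
  have hd := card_steps_pos (d := d)
  have hd' : (d : ℝ) ≠ 0 := Nat.cast_ne_zero.2 (NeZero.ne d)
  have hL : 0 < Real.log 6 := Real.log_pos (by norm_num)
  set R := Real.log 6 / ε with hR
  have hR0 : 0 < R := div_pos hL hε
  set E := Real.exp (-(s * R)) with hE
  have hE0 : 0 < E := Real.exp_pos _
  have hE6 : 6 * E ≤ 1 := by
    have h1 : Real.log 6 ≤ s * R := by
      rw [hR, ← mul_div_assoc, le_div_iff₀ hε, mul_comm]
      exact mul_le_mul_of_nonneg_right hsε.le hL.le
    have h2 : E ≤ Real.exp (-Real.log 6) := Real.exp_le_exp.2 (by linarith)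
    rw [Real.exp_neg, Real.exp_log (by norm_num)] at h2
    linarith
  set η := E / (2 * R) with hη
  have hη0 : 0 < η := by positivity
  set C := 2 * d / (η ^ 2 * E) with hC
  have hC0 : 0 < C := by positivity
  set K := (M : ℝ) ^ 2 * (3 * d * (2 * C * √(2 * C))) with hK
  filter_upwards [self_mem_nhdsWithin,
    eventually_lt_of_continuous (f := fun γ => Real.exp (s * √γ)) (c := 3 / 2) (by fun_prop)
      (by norm_num),
    eventually_lt_of_continuous (f := fun γ => √γ) (c := R) (by fun_prop) (by simpa using hR0),
    eventually_lt_of_continuous (f := fun γ => K * √γ) (c := E) (by fun_prop) (by simpa using hE0),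
    eventually_lt_of_continuous (f := fun γ => s ^ 2 * (1 + s ^ 2 * γ)) (c := 2 * d * m)
      (by fun_prop) (by simpa using hm),
    eventually_lt_of_continuous (f := fun γ => s * √γ) (c := 1) (by fun_prop) (by simp),
    eventually_lt_of_continuous (f := fun γ => γ) (c := C) (by fun_prop) hC0]
    with γ hγ hexp hgR hKg hsm hsg hγC ν _ N hN htr
  rw [Set.mem_Ioi] at hγ
  set g := √γ with hg
  have hg0 : 0 < g := Real.sqrt_pos.2 hγ
  have hgg : g * g = γ := Real.mul_self_sqrt hγ.le
  set n := ⌈C / γ⌉₊ with hn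
  have hn0 : 0 < n := Nat.ceil_pos.2 (div_pos hC0 hγ)
  have hn1 : C / γ ≤ n := Nat.le_ceil _
  have hn2 : (n : ℝ) ≤ 2 * C / γ := by
    have h1 := (Nat.ceil_lt_add_one (div_pos hC0 hγ).le).le
    have h2 : 1 ≤ C / γ := (one_le_div hγ).2 hγC.le
    rw [mul_div_assoc]
    linarith
  have hr1 : 1 ≤ R / g := (one_le_div hg0).2 hgR.le
  have hl : (s * g) ^ 2 * (1 + (s * g) ^ 2) ≤ 2 * d * truncMean ν (γ.toNNReal * M) := by
    have h1 : (s * g) ^ 2 = s ^ 2 * γ := by rw [← hgg]; ring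
    have h2 := mul_le_mul_of_nonneg_left hsm.le hγ.le
    have h3 := mul_le_mul_of_nonneg_left htr hd.le
    rw [h1]
    linarith
  have hslab : (Real.cosh (s * g * (R / g - 1)))⁻¹ + (η * g * (R / g + 1) +
      (1 + n * ((η * g) ^ 2 / (2 * d)))⁻¹) +
        ((γ.toNNReal * M : ℝ≥0) : ℝ) ^ 2 * (3 * d * (n * √(n : ℝ))) ≤ 6 * E := by
    have t1 : (Real.cosh (s * g * (R / g - 1)))⁻¹ ≤ 3 * E := by
      have e1 : s * g * (R / g - 1) = s * R - s * g := by field_simp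
      have e2 : Real.exp (s * R - s * g) / 2 ≤ Real.cosh (s * R - s * g) := by
        rw [Real.cosh_eq]; linarith [Real.exp_pos (-(s * R - s * g))]
      rw [e1]
      calc (Real.cosh (s * R - s * g))⁻¹ ≤ (Real.exp (s * R - s * g) / 2)⁻¹ :=
            inv_anti₀ (by positivity) e2
        _ = 2 * (E * Real.exp (s * g)) := by
            rw [hE, ← Real.exp_add, inv_div, div_eq_mul_inv, ← Real.exp_neg]; ring_nf
        _ ≤ 3 * E := by nlinarith
    have t2 : η * g * (R / g + 1) ≤ E := by
      have e1 : η * g * (R / g + 1) = η * R + η * g := by field_simp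
      have e2 : η * R = E / 2 := by rw [hη]; field_simp
      have e3 : η * g ≤ η * R := mul_le_mul_of_nonneg_left hgR.le hη0.le
      linarith
    have t3 : (1 + n * ((η * g) ^ 2 / (2 * d)))⁻¹ ≤ E := by
      have e1 : E⁻¹ ≤ 1 + n * ((η * g) ^ 2 / (2 * d)) := by
        have e2 : C / γ * ((η * g) ^ 2 / (2 * d)) = E⁻¹ := by
          rw [mul_pow, pow_two g, hgg, hC]; field_simp
        have e3 := mul_le_mul_of_nonneg_right hn1
          (show 0 ≤ (η * g) ^ 2 / (2 * d : ℝ) by positivity)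
        linarith
      have := inv_anti₀ (inv_pos.2 hE0) e1
      rwa [inv_inv] at this
    have t4 : ((γ.toNNReal * M : ℝ≥0) : ℝ) ^ 2 * (3 * d * (n * √(n : ℝ))) ≤ E := by
      have e1 : √(n : ℝ) ≤ √(2 * C) / g := by
        rw [hg, ← Real.sqrt_div' _ hγ.le]; exact Real.sqrt_le_sqrt hn2
      have e2 : (n : ℝ) * √(n : ℝ) ≤ 2 * C / γ * (√(2 * C) / g) :=
        mul_le_mul hn2 e1 (Real.sqrt_nonneg _) (by positivity)
      refine le_trans ?_ hKg.le
      rw [NNReal.coe_mul, Real.coe_toNNReal _ hγ.le]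
      calc (γ * M) ^ 2 * (3 * d * (n * √(n : ℝ)))
          ≤ (γ * M) ^ 2 * (3 * d * (2 * C / γ * (√(2 * C) / g))) := by gcongr
        _ = K * g := by
            rw [hK, ← hgg]; field_simp
    linarith
  intro x
  have h := mul_norm_le_of_slab hN (r := R / g) (ρ := 6 * E) (by positivity) (by positivity) hE6
    (fun u hu a x hax hxa => (integral_green_slab_le ν hu (γ.toNNReal * M) (l := s * g)
      (θ := η * g) (by positivity) hsg.le hl hr1 (by positivity) hn0 hax hxa).trans hslab) x
  refine le_trans (le_of_eq ?_) h
  congr 1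
  rw [Real.log_mul (by norm_num) hE0.ne', hE, Real.log_exp]
  have : ε = Real.log 6 / R := by rw [hR]; field_simp
  rw [this]
  field_simp
  ring

end lowerBound

/-! ### The Lyapunov exponents of an i.i.d. potential -/

section exponents

variable {d : ℕ} {Ω : Type*} [MeasurableSpace Ω] {μ : Measure Ω}
  {V : (Fin d → ℤ) → Ω → ℝ}

/-- The one-site law of a potential. -/
def siteLaw (μ : Measure Ω) (V : (Fin d → ℤ) → Ω → ℝ) : Measure ℝ≥0 :=
  μ.map fun ω => (V 0 ω).toNNReal

/-- The potential as a random environment. -/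
def toEnv (V : (Fin d → ℤ) → Ω → ℝ) (ω : Ω) : Env d := fun x => (V x ω).toNNReal

lemma IsIIDPotential.measurable_toNNReal (hV : IsIIDPotential μ V) (x : Site d) :
    Measurable fun ω => (V x ω).toNNReal := (hV.measurable x).real_toNNReal

lemma IsIIDPotential.measurable_toEnv (hV : IsIIDPotential μ V) : Measurable (toEnv V) :=
  measurable_pi_iff.2 hV.measurable_toNNReal

lemma IsIIDPotential.isProbabilityMeasure_siteLaw [IsProbabilityMeasure μ]
    (hV : IsIIDPotential μ V) : IsProbabilityMeasure (siteLaw μ V) :=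
  Measure.isProbabilityMeasure_map (hV.measurable_toNNReal 0).aemeasurable

lemma IsIIDPotential.map_toEnv [IsProbabilityMeasure μ] (hV : IsIIDPotential μ V) :
    μ.map (toEnv V) = envLaw d (siteLaw μ V) := by
  have h := hV.indep.comp (fun _ => Real.toNNReal) (fun _ => measurable_real_toNNReal)
  have h2 := (iIndepFun_iff_map_fun_eq_infinitePi_map
    (fun x => hV.measurable_toNNReal x)).1 h
  have h3 : ∀ x, μ.map (fun ω => (V x ω).toNNReal) = siteLaw μ V := fun x =>
    ((hV.identDistrib x).comp measurable_real_toNNReal).map_eq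
  rw [envLaw, ← funext h3]
  exact h2

lemma IsIIDPotential.passage_eq [NeZero d] (hV : IsIIDPotential μ V) (y : Site d) (ω : Ω) :
    passage y (fun x => V x ω) = green {y} (toEnv V ω) 0 := by
  rw [← passage_eq_green]
  congr 1
  funext x
  exact (Real.coe_toNNReal _ (hV.nonneg x ω)).symm

lemma IsIIDPotential.integral_passage [NeZero d] [IsProbabilityMeasure μ]
    (hV : IsIIDPotential μ V) (y : Site d) :
    ∫ ω, passage y (fun x => V x ω) ∂μ = annealed (siteLaw μ V) y := by
  rw [annealed, ← hV.map_toEnv, integral_map hV.measurable_toEnv.aemeasurable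
    (measurable_green _ _).aestronglyMeasurable]
  simp only [hV.passage_eq]

lemma IsIIDPotential.lintegral_siteLaw (hV : IsIIDPotential μ V) :
    ∫⁻ t, (t : ℝ≥0∞) ∂(siteLaw μ V) = ∫⁻ ω, ENNReal.ofReal (V 0 ω) ∂μ :=
  lintegral_map measurable_coe_nnreal_ennreal (hV.measurable_toNNReal 0)

lemma IsIIDPotential.integrable_siteLaw (hV : IsIIDPotential μ V)
    (hfin : ∫⁻ ω, ENNReal.ofReal (V 0 ω) ∂μ ≠ ⊤) :
    Integrable (fun t : ℝ≥0 => (t : ℝ)) (siteLaw μ V) := by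
  refine ⟨by fun_prop, ?_⟩
  rw [hasFiniteIntegral_iff_ofReal (Eventually.of_forall fun t => t.2)]
  simp only [ENNReal.ofReal_coe_nnreal]
  rw [hV.lintegral_siteLaw]
  exact hfin.lt_top

lemma IsIIDPotential.ofReal_integral_siteLaw (hV : IsIIDPotential μ V)
    (hfin : ∫⁻ ω, ENNReal.ofReal (V 0 ω) ∂μ ≠ ⊤) :
    ENNReal.ofReal (∫ t, (t : ℝ) ∂(siteLaw μ V)) = ∫⁻ ω, ENNReal.ofReal (V 0 ω) ∂μ := by
  rw [ofReal_integral_eq_lintegral_ofReal (hV.integrable_siteLaw hfin)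
    (Eventually.of_forall fun t => t.2)]
  simp only [ENNReal.ofReal_coe_nnreal]
  exact hV.lintegral_siteLaw

lemma IsIIDPotential.integral_siteLaw_pos (hV : IsIIDPotential μ V)
    (hpos : 0 < ∫⁻ ω, ENNReal.ofReal (V 0 ω) ∂μ)
    (hfin : ∫⁻ ω, ENNReal.ofReal (V 0 ω) ∂μ ≠ ⊤) : 0 < ∫ t, (t : ℝ) ∂(siteLaw μ V) := by
  rwa [← hV.ofReal_integral_siteLaw hfin, ENNReal.ofReal_pos] at hpos

lemma exists_annealed_seminorm [NeZero d] (ν : Measure ℝ≥0) [IsProbabilityMeasure ν] :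
    ∃ N : Seminorm ℝ (EuclideanSpace ℝ (Fin d)), ∀ ℓ,
      Tendsto (fun k : ℕ => annealedCost ν (k • ℓ) / k) atTop (𝓝 (N (latticePoint ℓ))) := by
  obtain ⟨N, hN, -⟩ := exists_homogenized_seminorm (annealedCost_nonneg (d := d) ν)
    (annealedCost_add_le ν) (annealedCost_neg ν)
  exact ⟨N, hN⟩

lemma exists_quenched_seminorm [NeZero d] {ν : Measure ℝ≥0} [IsProbabilityMeasure ν]
    (hν : Integrable (fun t : ℝ≥0 => (t : ℝ)) ν) :
    ∃ N : Seminorm ℝ (EuclideanSpace ℝ (Fin d)),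
      (∀ᵐ v ∂(envLaw d ν), ∀ ℓ,
        Tendsto (fun k : ℕ => cost 0 (k • ℓ) v / k) atTop (𝓝 (N (latticePoint ℓ)))) ∧
      (∀ ℓ, Tendsto (fun k : ℕ => meanCost ν (k • ℓ) / k) atTop (𝓝 (N (latticePoint ℓ)))) ∧
      ∀ z, N (latticePoint z) ≤ meanCost ν z := by
  obtain ⟨N, hN, hle⟩ := exists_homogenized_seminorm (meanCost_nonneg (d := d) ν)
    (meanCost_add_le hν) (meanCost_neg ν)
  refine ⟨N, ae_all_iff.2 fun ℓ => ae_tendsto_cost hν ℓ (apply_nonneg N _) (fun n => ?_) (hN ℓ),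
    hN, hle⟩
  have := hle (n • ℓ)
  rwa [latticePoint_nsmul, map_smul_eq_mul, Real.norm_natCast] at this

lemma IsAnnealedExponent.tendsto_annealedCost [NeZero d] [IsProbabilityMeasure μ]
    {β : Seminorm ℝ (EuclideanSpace ℝ (Fin d))} (hβ : IsAnnealedExponent μ V β)
    (hV : IsIIDPotential μ V) (ℓ : Site d) :
    Tendsto (fun k : ℕ => annealedCost (siteLaw μ V) (k • ℓ) / k) atTop
      (𝓝 (β (latticePoint ℓ))) := by
  have := hβ.tendsto ℓ
  simpa only [hV.integral_passage, annealedCost] using this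

lemma IsAnnealedExponent.unique {β β' : Seminorm ℝ (EuclideanSpace ℝ (Fin d))}
    (h : IsAnnealedExponent μ V β) (h' : IsAnnealedExponent μ V β') : β = β' :=
  seminorm_ext_lattice fun z => tendsto_nhds_unique (h.tendsto z) (h'.tendsto z)

lemma IsQuenchedExponent.unique [IsProbabilityMeasure μ]
    {α α' : Seminorm ℝ (EuclideanSpace ℝ (Fin d))}
    (h : IsQuenchedExponent μ V α) (h' : IsQuenchedExponent μ V α') : α = α' := by
  obtain ⟨ω, h1, h2⟩ := (h.tendsto.and h'.tendsto).exists
  exact seminorm_ext_lattice fun z => tendsto_nhds_unique (h1 z) (h2 z)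

lemma eq_zero_of_mul_norm_le {N : Seminorm ℝ (EuclideanSpace ℝ (Fin d))} {c : ℝ} (hc : 0 < c)
    (h : ∀ x, c * ‖x‖ ≤ N x) (x : EuclideanSpace ℝ (Fin d)) (hx : N x = 0) : x = 0 := by
  have h1 := h x
  rw [hx] at h1
  exact norm_le_zero_iff.1 (nonpos_of_mul_nonpos_right h1 hc)

variable [NeZero d] [IsProbabilityMeasure μ]

theorem exists_isAnnealedExponent (hV : IsIIDPotential μ V)
    (hpos : 0 < ∫⁻ ω, ENNReal.ofReal (V 0 ω) ∂μ)
    (hfin : ∫⁻ ω, ENNReal.ofReal (V 0 ω) ∂μ ≠ ⊤) : ∃ β, IsAnnealedExponent μ V β := by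
  have := hV.isProbabilityMeasure_siteLaw
  obtain ⟨N, hN⟩ := exists_annealed_seminorm (d := d) (siteLaw μ V)
  obtain ⟨c, hc, hcN⟩ := exists_mul_norm_le (hV.integrable_siteLaw hfin)
    (hV.integral_siteLaw_pos hpos hfin) hN
  refine ⟨N, eq_zero_of_mul_norm_le hc hcN, fun ℓ => ?_⟩
  simpa only [hV.integral_passage, annealedCost] using hN ℓ

/-- The quenched exponent exists, is bounded by the mean cost and dominates the annealed one. -/
theorem exists_isQuenchedExponent (hV : IsIIDPotential μ V)
    (hpos : 0 < ∫⁻ ω, ENNReal.ofReal (V 0 ω) ∂μ)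
    (hfin : ∫⁻ ω, ENNReal.ofReal (V 0 ω) ∂μ ≠ ⊤) :
    ∃ α, IsQuenchedExponent μ V α ∧ (∀ z, α (latticePoint z) ≤ meanCost (siteLaw μ V) z) ∧
      ∀ β, IsAnnealedExponent μ V β → ∀ x, β x ≤ α x := by
  have := hV.isProbabilityMeasure_siteLaw
  obtain ⟨A, hA, hmean, hle⟩ := exists_quenched_seminorm (d := d) (hV.integrable_siteLaw hfin)
  have hdom : ∀ β, IsAnnealedExponent μ V β → ∀ x, β x ≤ A x := fun β hβ =>
    seminorm_le_of_lattice fun z => le_of_tendsto_of_tendsto' (hβ.tendsto_annealedCost hV z)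
      (hmean z) fun k => div_le_div_of_nonneg_right
        (annealedCost_le_meanCost (hV.integrable_siteLaw hfin) _) (Nat.cast_nonneg k)
  refine ⟨A, ⟨fun x hx => ?_, ?_⟩, hle, hdom⟩
  · obtain ⟨β, hβ⟩ := exists_isAnnealedExponent hV hpos hfin
    exact hβ.definite x (le_antisymm (hx ▸ hdom β hβ x) (apply_nonneg β x))
  · rw [← hV.map_toEnv] at hA
    filter_upwards [ae_of_ae_map hV.measurable_toEnv.aemeasurable hA] with ω hω ℓ
    simpa only [hV.passage_eq, cost] using hω ℓ

end exponents

/-! ### Small potentials -/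

section smallPotential

variable {d : ℕ} [NeZero d]

lemma tendsto_sqrt_toZero :
    Tendsto (fun γ : Set.Ioi (0 : ℝ) => √(γ : ℝ)) toZero (𝓝 0) := by
  have h : Tendsto (fun γ : ℝ => √γ) (𝓝[>] 0) (𝓝 0) := by
    have := (Real.continuous_sqrt.tendsto 0).mono_left (nhdsWithin_le_nhds (s := Set.Ioi 0))
    simpa using this
  exact h.comp tendsto_comap

lemma rpow_half_mul_ofReal {m : ℝ≥0∞} (hm : m ≠ ⊤) {n : ℝ} :
    (2 * d * m) ^ (1 / 2 : ℝ) * ENNReal.ofReal n = ENNReal.ofReal (√(2 * d * m.toReal) * n) := by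
  have h : 2 * d * m = ENNReal.ofReal (2 * d * m.toReal) := by
    rw [ENNReal.ofReal_mul (by positivity), ENNReal.ofReal_mul (by positivity),
      ENNReal.ofReal_toReal hm]
    simp
  rw [h, ENNReal.ofReal_rpow_of_nonneg (by positivity) (by norm_num), ← Real.sqrt_eq_rpow,
    ← ENNReal.ofReal_mul (Real.sqrt_nonneg _)]

variable {ν : Set.Ioi (0 : ℝ) → Measure ℝ≥0} [∀ γ, IsProbabilityMeasure (ν γ)]
  {m : ℝ≥0∞} {α β : Set.Ioi (0 : ℝ) → Seminorm ℝ (EuclideanSpace ℝ (Fin d))}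

lemma eventually_quenched_lt (hν : ∀ γ, Integrable (fun t : ℝ≥0 => (t : ℝ)) (ν γ))
    (hpos : ∀ γ, 0 < ∫ t, (t : ℝ) ∂(ν γ))
    (hα : ∀ γ z, α γ (latticePoint z) ≤ meanCost (ν γ) z)
    (hmean : Tendsto (fun γ : Set.Ioi (0 : ℝ) =>
      ENNReal.ofReal ((∫ t, (t : ℝ) ∂(ν γ)) / (γ : ℝ))) toZero (𝓝 m))
    (x : EuclideanSpace ℝ (Fin d)) {b : ℝ≥0∞}
    (hb : (2 * d * m) ^ (1 / 2 : ℝ) * ENNReal.ofReal ‖x‖ < b) :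
    ∀ᶠ γ : Set.Ioi (0 : ℝ) in toZero, ENNReal.ofReal (α γ x / √(γ : ℝ)) < b := by
  by_cases hx : x = 0
  · subst hx
    filter_upwards with γ
    simpa using pos_of_gt hb
  have hd := card_steps_pos (d := d)
  have hm : m ≠ ⊤ := by
    rintro rfl
    refine absurd hb (not_lt.2 ?_)
    rw [ENNReal.mul_top (by simpa using NeZero.ne d), ENNReal.top_rpow_of_pos (by norm_num),
      ENNReal.top_mul (by simpa using hx)]
    exact le_top
  set c : Set.Ioi (0 : ℝ) → ℝ := fun γ => (∫ t, (t : ℝ) ∂(ν γ)) / (γ : ℝ) with hc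
  have hc0 : ∀ γ, 0 < c γ := fun γ => div_pos (hpos γ) γ.2
  have hclim : Tendsto c toZero (𝓝 m.toReal) := by
    refine ((ENNReal.tendsto_toReal hm).comp hmean).congr fun γ => ?_
    exact ENNReal.toReal_ofReal (hc0 γ).le
  have hf : Tendsto (fun γ => √(2 * d * c γ)) toZero (𝓝 √(2 * d * m.toReal)) :=
    (Real.continuous_sqrt.tendsto _).comp (tendsto_const_nhds.mul hclim)
  have hσ : Tendsto (fun γ : Set.Ioi (0 : ℝ) => √(γ : ℝ) * √(2 * d * c γ)) toZero (𝓝 0) := by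
    simpa using tendsto_sqrt_toZero.mul hf
  have hlim : Tendsto (fun γ : Set.Ioi (0 : ℝ) => ENNReal.ofReal
      (√(2 * d * c γ) * (1 + 2 * (√(γ : ℝ) * √(2 * d * c γ))) * ‖x‖)) toZero
      (𝓝 ((2 * d * m) ^ (1 / 2 : ℝ) * ENNReal.ofReal ‖x‖)) := by
    rw [rpow_half_mul_ofReal hm]
    refine (ENNReal.continuous_ofReal.tendsto _).comp ?_
    have := (hf.mul ((hσ.const_mul 2).const_add 1)).mul_const ‖x‖
    simpa using this
  filter_upwards [hlim.eventually_lt_const hb,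
    hσ.eventually_lt_const (show (0 : ℝ) < 1 / 2 by norm_num)] with γ h1 h2
  refine lt_of_le_of_lt (ENNReal.ofReal_le_ofReal ?_) h1
  have hγ : (0 : ℝ) < γ := γ.2
  have hg : 0 < √(γ : ℝ) := Real.sqrt_pos.2 hγ
  have h3 := seminorm_le_sqrt_mean (hν γ) (hα γ) (σ := √(γ : ℝ) * √(2 * d * c γ))
    (mul_pos hg (Real.sqrt_pos.2 (mul_pos hd (hc0 γ))))
    (by
      rw [mul_pow, Real.sq_sqrt hγ.le, Real.sq_sqrt (mul_pos hd (hc0 γ)).le, hc]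
      field_simp) h2.le x
  rw [div_le_iff₀ hg]
  refine h3.trans (le_of_eq ?_)
  ring

lemma eventually_lt_annealed
    (hβ : ∀ γ ℓ, Tendsto (fun k : ℕ => annealedCost (ν γ) (k • ℓ) / k) atTop
      (𝓝 (β γ (latticePoint ℓ))))
    (htrunc : ∀ m₀ : ℝ≥0, (m₀ : ℝ≥0∞) < m → ∃ M : ℝ≥0, ∀ᶠ γ : Set.Ioi (0 : ℝ) in toZero,
      (γ : ℝ) * m₀ ≤ truncMean (ν γ) ((γ : ℝ).toNNReal * M))
    (x : EuclideanSpace ℝ (Fin d)) {b : ℝ≥0∞}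
    (hb : b < (2 * d * m) ^ (1 / 2 : ℝ) * ENNReal.ofReal ‖x‖) :
    ∀ᶠ γ : Set.Ioi (0 : ℝ) in toZero, b < ENNReal.ofReal (β γ x / √(γ : ℝ)) := by
  have hx : 0 < ‖x‖ := by
    by_contra h
    rw [ENNReal.ofReal_of_nonpos (not_lt.1 h), mul_zero] at hb
    exact not_lt_zero hb
  have hx0 : ENNReal.ofReal ‖x‖ ≠ 0 := (ENNReal.ofReal_pos.2 hx).ne'
  have hd0 : (2 * d : ℝ≥0∞) ≠ 0 := by simpa using NeZero.ne d
  have hdt : (2 * d : ℝ≥0∞) ≠ ⊤ := by finiteness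
  have hb' : b / ENNReal.ofReal ‖x‖ < (2 * d * m) ^ (1 / 2 : ℝ) :=
    ENNReal.div_lt_of_lt_mul hb
  obtain ⟨s₁, hbs, hs₁⟩ := ENNReal.lt_iff_exists_nnreal_btwn.1 hb'
  obtain ⟨s₂, hs₁₂, hs₂⟩ := ENNReal.lt_iff_exists_nnreal_btwn.1 hs₁
  rw [ENNReal.coe_lt_coe] at hs₁₂
  have hsq : (s₂ : ℝ≥0∞) ^ 2 / (2 * d) < m := by
    rw [one_div, ENNReal.lt_rpow_inv_iff two_pos] at hs₂
    refine ENNReal.div_lt_of_lt_mul' ?_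
    exact_mod_cast hs₂
  obtain ⟨m₀, hm₀, hm₀m⟩ := ENNReal.lt_iff_exists_nnreal_btwn.1 hsq
  obtain ⟨M, hM⟩ := htrunc m₀ hm₀m
  have hsm : (s₂ : ℝ) ^ 2 < 2 * d * m₀ := by
    rw [ENNReal.div_lt_iff (Or.inl hd0) (Or.inl hdt)] at hm₀
    have : s₂ ^ 2 < m₀ * (2 * d) := by exact_mod_cast hm₀
    have h2 : (s₂ : ℝ) ^ 2 < m₀ * (2 * d) := by exact_mod_cast this
    linarith
  have hs₁₂' : (s₁ : ℝ) < s₂ := by exact_mod_cast hs₁₂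
  have hev := (eventually_mul_norm_le d M (s := s₂) (ε := s₂ - s₁) (m := m₀)
    (lt_of_le_of_lt s₁.2 hs₁₂') (sub_pos.2 hs₁₂') hsm).comap
      (Subtype.val : Set.Ioi (0 : ℝ) → ℝ)
  filter_upwards [hM, hev] with γ h1 h2
  have h3 := h2 (ν γ) (β γ) (hβ γ) h1 x
  have hg : 0 < √(γ : ℝ) := Real.sqrt_pos.2 γ.2
  have h4 : (s₁ : ℝ) * ‖x‖ ≤ β γ x / √(γ : ℝ) := by
    rw [le_div_iff₀ hg]; linarith
  refine lt_of_lt_of_le ?_ (ENNReal.ofReal_le_ofReal h4)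
  rw [ENNReal.ofReal_mul (NNReal.coe_nonneg s₁), ENNReal.ofReal_coe_nnreal]
  rwa [ENNReal.div_lt_iff (Or.inl hx0) (Or.inl ENNReal.ofReal_ne_top)] at hbs

/-- The asymptotics of both exponents as the potential becomes small. -/
theorem tendsto_exponents (hν : ∀ γ, Integrable (fun t : ℝ≥0 => (t : ℝ)) (ν γ))
    (hpos : ∀ γ, 0 < ∫ t, (t : ℝ) ∂(ν γ))
    (hα : ∀ γ z, α γ (latticePoint z) ≤ meanCost (ν γ) z)
    (hβ : ∀ γ ℓ, Tendsto (fun k : ℕ => annealedCost (ν γ) (k • ℓ) / k) atTop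
      (𝓝 (β γ (latticePoint ℓ))))
    (hβα : ∀ γ x, β γ x ≤ α γ x)
    (hmean : Tendsto (fun γ : Set.Ioi (0 : ℝ) =>
      ENNReal.ofReal ((∫ t, (t : ℝ) ∂(ν γ)) / (γ : ℝ))) toZero (𝓝 m))
    (htrunc : ∀ m₀ : ℝ≥0, (m₀ : ℝ≥0∞) < m → ∃ M : ℝ≥0, ∀ᶠ γ : Set.Ioi (0 : ℝ) in toZero,
      (γ : ℝ) * m₀ ≤ truncMean (ν γ) ((γ : ℝ).toNNReal * M))
    (x : EuclideanSpace ℝ (Fin d)) :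
    Tendsto (fun γ : Set.Ioi (0 : ℝ) => ENNReal.ofReal (α γ x / √(γ : ℝ))) toZero
      (𝓝 ((2 * d * m) ^ (1 / 2 : ℝ) * ENNReal.ofReal ‖x‖)) ∧
    Tendsto (fun γ : Set.Ioi (0 : ℝ) => ENNReal.ofReal (β γ x / √(γ : ℝ))) toZero
      (𝓝 ((2 * d * m) ^ (1 / 2 : ℝ) * ENNReal.ofReal ‖x‖)) := by
  have hle : ∀ γ : Set.Ioi (0 : ℝ),
      ENNReal.ofReal (β γ x / √(γ : ℝ)) ≤ ENNReal.ofReal (α γ x / √(γ : ℝ)) := fun γ =>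
    ENNReal.ofReal_le_ofReal (div_le_div_of_nonneg_right (hβα γ x) (Real.sqrt_nonneg _))
  refine ⟨tendsto_order.2 ⟨fun b hb => ?_, fun b hb => ?_⟩,
    tendsto_order.2 ⟨fun b hb => ?_, fun b hb => ?_⟩⟩
  · exact (eventually_lt_annealed hβ htrunc x hb).mono fun γ h => h.trans_le (hle γ)
  · exact eventually_quenched_lt hν hpos hα hmean x hb
  · exact eventually_lt_annealed hβ htrunc x hb
  · exact (eventually_quenched_lt hν hpos hα hmean x hb).mono fun γ h => (hle γ).trans_lt h

/-- Convergence in distribution bounds the truncated means from below. -/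
lemma exists_eventually_le_truncMean {Ω : Set.Ioi (0 : ℝ) → Type*} [∀ γ, MeasurableSpace (Ω γ)]
    {μ : (γ : Set.Ioi (0 : ℝ)) → Measure (Ω γ)} [∀ γ, IsProbabilityMeasure (μ γ)]
    {Vpot : (γ : Set.Ioi (0 : ℝ)) → (Fin d → ℤ) → Ω γ → ℝ}
    (hV : ∀ γ, IsIIDPotential (μ γ) (Vpot γ))
    {Ω' : Type*} [MeasurableSpace Ω'] {μ' : Measure Ω'} [IsProbabilityMeasure μ'] {V : Ω' → ℝ}
    (hdist : TendstoInDistribution (fun γ ω => Vpot γ 0 ω / (γ : ℝ)) toZero V μ μ')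
    (m₀ : ℝ≥0) (hm₀ : (m₀ : ℝ≥0∞) < ∫⁻ ω, ENNReal.ofReal (V ω) ∂μ') :
    ∃ M : ℝ≥0, ∀ᶠ γ : Set.Ioi (0 : ℝ) in toZero,
      (γ : ℝ) * m₀ ≤ truncMean (siteLaw (μ γ) (Vpot γ)) ((γ : ℝ).toNNReal * M) := by
  have hVm := hdist.aemeasurable_limit
  have htr : ∀ M : ℝ≥0, Continuous fun t : ℝ => ((min t.toNNReal M : ℝ≥0) : ℝ) :=
    fun M => by fun_prop
  obtain ⟨M, hM⟩ : ∃ M : ℕ, (m₀ : ℝ≥0∞) < ∫⁻ ω, min (ENNReal.ofReal (V ω)) (M : ℝ≥0∞) ∂μ' := by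
    have hsup : ∫⁻ ω, ENNReal.ofReal (V ω) ∂μ' =
        ⨆ M : ℕ, ∫⁻ ω, min (ENNReal.ofReal (V ω)) (M : ℝ≥0∞) ∂μ' := by
      rw [← lintegral_iSup' (fun M => hVm.ennreal_ofReal.min aemeasurable_const)
        (Eventually.of_forall fun ω M M' h => min_le_min le_rfl (by exact_mod_cast h))]
      refine lintegral_congr fun ω => le_antisymm ?_ (iSup_le fun _ => min_le_left _ _)
      obtain ⟨M, hM⟩ := ENNReal.exists_nat_gt (ENNReal.ofReal_ne_top (r := V ω))
      exact le_iSup_of_le M (le_min le_rfl hM.le)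
    rw [hsup] at hm₀
    exact lt_iSup_iff.1 hm₀
  refine ⟨M, ?_⟩
  have hMint : (m₀ : ℝ) < ∫ t, ((min t.toNNReal (M : ℝ≥0) : ℝ≥0) : ℝ) ∂(μ'.map V) := by
    rw [integral_map hVm (htr M).aestronglyMeasurable,
      integral_eq_lintegral_of_nonneg_ae (Eventually.of_forall fun _ => NNReal.coe_nonneg _)
        ((htr M).measurable.comp_aemeasurable hVm).aestronglyMeasurable]
    simp only [ENNReal.ofReal_coe_nnreal, ENNReal.coe_min, ENNReal.coe_natCast]
    have hfin : ∫⁻ ω, min (ENNReal.ofReal (V ω)) (M : ℝ≥0∞) ∂μ' ≠ ⊤ := by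
      refine ((lintegral_mono fun ω => min_le_right _ _).trans_lt
        (b := ∫⁻ _ω, (M : ℝ≥0∞) ∂μ') ?_).ne
      simp
    exact (ENNReal.toReal_lt_toReal ENNReal.coe_ne_top hfin).2 hM
  let f : BoundedContinuousFunction ℝ ℝ := BoundedContinuousFunction.ofNormedAddCommGroup
    (fun t : ℝ => ((min t.toNNReal (M : ℝ≥0) : ℝ≥0) : ℝ)) (htr M) M (fun t => by
      rw [Real.norm_of_nonneg (NNReal.coe_nonneg _)]
      exact_mod_cast min_le_right t.toNNReal (M : ℝ≥0))
  have hlim := ProbabilityMeasure.tendsto_iff_forall_integral_tendsto.1 hdist.tendsto f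
  filter_upwards [hlim.eventually_const_lt hMint] with γ hγ
  have hγ0 : (0 : ℝ) < γ := γ.2
  have hmeas : Measurable fun ω => Vpot γ 0 ω / (γ : ℝ) := ((hV γ).measurable 0).div_const _
  change (m₀ : ℝ) < ∫ t, ((min t.toNNReal (M : ℝ≥0) : ℝ≥0) : ℝ)
    ∂((μ γ).map fun ω => Vpot γ 0 ω / (γ : ℝ)) at hγ
  rw [integral_map hmeas.aemeasurable (htr M).aestronglyMeasurable] at hγ
  have e : truncMean (siteLaw (μ γ) (Vpot γ)) ((γ : ℝ).toNNReal * M) = (γ : ℝ) *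
      ∫ ω, ((min (Vpot γ 0 ω / (γ : ℝ)).toNNReal (M : ℝ≥0) : ℝ≥0) : ℝ) ∂(μ γ) := by
    rw [truncMean, siteLaw, integral_map ((hV γ).measurable_toNNReal 0).aemeasurable
      (by fun_prop), ← integral_const_mul]
    refine integral_congr_ae (Eventually.of_forall fun ω => ?_)
    have h0 := (hV γ).nonneg 0 ω
    simp only [NNReal.coe_min, NNReal.coe_mul, Real.coe_toNNReal _ h0, Real.coe_toNNReal _ hγ0.le,
      Real.coe_toNNReal _ (div_nonneg h0 hγ0.le)]
    rw [mul_min_of_nonneg _ _ hγ0.le, mul_div_cancel₀ _ hγ0.ne']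
  rw [e]
  exact mul_le_mul_of_nonneg_left hγ.le hγ0.le

end smallPotential

end RandomPotential

end

theorem mainTheorem1 {d : ℕ} (hd : 1 ≤ d)
    {Ω : Set.Ioi (0 : ℝ) → Type*} [∀ γ, MeasurableSpace (Ω γ)]
    (μ : (γ : Set.Ioi (0 : ℝ)) → Measure (Ω γ)) [∀ γ, IsProbabilityMeasure (μ γ)]
    (Vpot : (γ : Set.Ioi (0 : ℝ)) → (Fin d → ℤ) → Ω γ → ℝ)
    (hV : ∀ γ, RandomPotential.IsIIDPotential (μ γ) (Vpot γ))
    {Ω' : Type*} [MeasurableSpace Ω'] (μ' : Measure Ω') [IsProbabilityMeasure μ']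
    (V : Ω' → ℝ)
    (hdist : TendstoInDistribution (fun γ ω => Vpot γ 0 ω / (γ : ℝ)) RandomPotential.toZero V μ μ')
    (hmean : ∀ γ : Set.Ioi (0 : ℝ),
      0 < (∫⁻ ω, ENNReal.ofReal (Vpot γ 0 ω) ∂(μ γ)) / ENNReal.ofReal γ ∧
      (∫⁻ ω, ENNReal.ofReal (Vpot γ 0 ω) ∂(μ γ)) / ENNReal.ofReal γ < ⊤)
    (hmean_tendsto : Tendsto
      (fun γ : Set.Ioi (0 : ℝ) =>
        (∫⁻ ω, ENNReal.ofReal (Vpot γ 0 ω) ∂(μ γ)) / ENNReal.ofReal γ)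
      RandomPotential.toZero (𝓝 (∫⁻ ω, ENNReal.ofReal (V ω) ∂μ'))) :
    -- both families of Lyapunov exponents are well defined
    (∀ γ, ∃! α, RandomPotential.IsQuenchedExponent (μ γ) (Vpot γ) α) ∧
    (∀ γ, ∃! β, RandomPotential.IsAnnealedExponent (μ γ) (Vpot γ) β) ∧
    -- and have the claimed asymptotics
    ∀ α β : Set.Ioi (0 : ℝ) → Seminorm ℝ (EuclideanSpace ℝ (Fin d)),
      (∀ γ, RandomPotential.IsQuenchedExponent (μ γ) (Vpot γ) (α γ)) →
      (∀ γ, RandomPotential.IsAnnealedExponent (μ γ) (Vpot γ) (β γ)) →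
      ∀ ℓ : EuclideanSpace ℝ (Fin d),
        Tendsto (fun γ : Set.Ioi (0 : ℝ) => ENNReal.ofReal (α γ ℓ / √(γ : ℝ)))
          RandomPotential.toZero
          (𝓝 ((2 * d * ∫⁻ ω, ENNReal.ofReal (V ω) ∂μ') ^ (1 / 2 : ℝ) * ENNReal.ofReal ‖ℓ‖)) ∧
        Tendsto (fun γ : Set.Ioi (0 : ℝ) => ENNReal.ofReal (β γ ℓ / √(γ : ℝ)))
          RandomPotential.toZero
          (𝓝 ((2 * d * ∫⁻ ω, ENNReal.ofReal (V ω) ∂μ') ^ (1 / 2 : ℝ) * ENNReal.ofReal ‖ℓ‖)) := by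
  have : NeZero d := ⟨by omega⟩
  have hfin : ∀ γ, ∫⁻ ω, ENNReal.ofReal (Vpot γ 0 ω) ∂(μ γ) ≠ ⊤ := fun γ h => by
    have h1 := (hmean γ).2
    rw [h, ENNReal.top_div_of_ne_top ENNReal.ofReal_ne_top] at h1
    exact lt_irrefl _ h1
  have hpos : ∀ γ, 0 < ∫⁻ ω, ENNReal.ofReal (Vpot γ 0 ω) ∂(μ γ) := fun γ =>
    (ENNReal.div_pos_iff.1 (hmean γ).1).1.bot_lt
  refine ⟨fun γ => ?_, fun γ => ?_, fun α β hα hβ ℓ => ?_⟩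
  · obtain ⟨α, hα, -⟩ := RandomPotential.exists_isQuenchedExponent (hV γ) (hpos γ) (hfin γ)
    exact ⟨α, hα, fun _ h => h.unique hα⟩
  · obtain ⟨β, hβ⟩ := RandomPotential.exists_isAnnealedExponent (hV γ) (hpos γ) (hfin γ)
    exact ⟨β, hβ, fun _ h => h.unique hβ⟩
  · have hprob := fun γ => (hV γ).isProbabilityMeasure_siteLaw
    have hquenched : ∀ γ, (∀ z, α γ (RandomPotential.latticePoint z) ≤
        RandomPotential.meanCost (RandomPotential.siteLaw (μ γ) (Vpot γ)) z) ∧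
        ∀ x, β γ x ≤ α γ x := fun γ => by
      obtain ⟨A, hA, hle, hdom⟩ :=
        RandomPotential.exists_isQuenchedExponent (hV γ) (hpos γ) (hfin γ)
      rw [(hα γ).unique hA]
      exact ⟨hle, hdom _ (hβ γ)⟩
    refine RandomPotential.tendsto_exponents (fun γ => (hV γ).integrable_siteLaw (hfin γ))
      (fun γ => (hV γ).integral_siteLaw_pos (hpos γ) (hfin γ)) (fun γ => (hquenched γ).1)
      (fun γ => (hβ γ).tendsto_annealedCost (hV γ)) (fun γ => (hquenched γ).2) ?_
      (RandomPotential.exists_eventually_le_truncMean hV hdist) ℓ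
    refine hmean_tendsto.congr fun γ => ?_
    rw [ENNReal.ofReal_div_of_pos γ.2, (hV γ).ofReal_integral_siteLaw (hfin γ)]
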